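/- Let $p$ be a prime, let $\mathbb{C}_p$ be the completion of an algebraic closure of $\mathbb{Q}_p$ with its absolute value $|\cdot|$, and write $D(b,R)=\{x\in\mathbb{C}_p:|x-b|<R\}$ and $\bar D(b,R)=\{x\in\mathbb{C}_p:|x-b|\le R\}$. A rational open disk in $\mathbb{P}^1(\mathbb{C}_p)=\mathbb{C}_p\cup\{\infty\}$ is a set $D(b,R)$ or $\mathbb{P}^1(\mathbb{C}_p)\smallsetminus\bar D(b,R)$ with $b\in\mathbb{C}_p$ and $R\in|\mathbb{C}_p^\times|$. For $S>0$ let $\mathbb{M}_p(D(0,S))$ be the field of meromorphic functions on $D(0,S)$, that is, of quotients $g/h$ of power series over $\mathbb{C}_p$ that converge on $D(0,S)$, and let $\mathbb{P}^1(\mathbb{M}_p(D(0,S)))=\mathbb{M}_p(D(0,S))\cup\{\infty\}$. A point $x$ is preperiodic under a map $f$ if $f^n(x)=f^m(x)$ for some integers $n>m\ge 0$. Let $S>0$, let $f_c(z):=\Phi(c,z)$ with $\Phi\in\mathbb{M}_p(D(0,S))(z)$, and let $\alpha\in\mathbb{P}^1(\mathbb{M}_p(D(0,S)))$. Let $d\ge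 2$ be an integer and suppose that for each $c\in D(0,S)$, $f_c(z)$ is a rational function in $\mathbb{C}_p(z)$ of degree $d$. Let $N>M\ge 0$ be integers, and let $U_0,\dots,U_N\subseteq\mathbb{P}^1(\mathbb{C}_p)$ be rational open disks such that for all $c\in D(0,S)$, - $\alpha(c)\in U_0$, - $f_c(U_j)\subseteq U_{j+1}$ for all $j=0,\dots,N-1$, and - $U_N\subseteq U_M$. Then either (a) for every $s\in(0,S)$ there are only finitely many $c\in\bar D(0,s)$ such that $\alpha(c)$ and all critical points of $f_c$ in $U_M\cup\dots\cup U_{N-1}$ are preperiodic under $f_c$; or (b) there are integers $n>m\ge 0$ such that $f_c^n(\alpha(c))=f_c^m(\alpha(c))$ for all $c\in D(0,S)$. -/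

import Mathlib

open Filter Topology Polynomial

noncomputable section

namespace PadicFamily

/-! ### The projective line and rational maps -/

open Classical in
/-- The point `[a : b]` of the projective line `K ∪ {∞}` (used only for `(a, b) ≠ (0, 0)`). -/
def ratio {K : Type*} [Field K] (a b : K) : OnePoint K :=
  if b = 0 then OnePoint.infty else ((a / b : K) : OnePoint K)

/-- The degree of a rational function: the maximum of the degrees of its numerator and its
denominator in lowest terms. -/
def ratDegree {K : Type*} [Field K] (φ : RatFunc K) : ℕ :=
  max φ.num.natDegree φ.denom.natDegree

/-- The self-map of the projective line given by a rational function. In lowest terms and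
homogeneous coordinates, `φ` at `∞ = [1 : 0]` is the ratio of the coefficients of degree
`ratDegree φ`. -/
def ratMap {K : Type*} [Field K] (φ : RatFunc K) (x : OnePoint K) : OnePoint K :=
  x.elim
    (ratio (φ.num.coeff (ratDegree φ)) (φ.denom.coeff (ratDegree φ)))
    (fun z => ratio (φ.num.eval z) (φ.denom.eval z))

/-- Critical points of a rational map on the projective line. In lowest terms the Wronskian of
numerator and denominator is, up to sign, the numerator of the derivative both of `φ` and of
`1 / φ`, so that its vanishing at `z` says that `φ`, read in a coordinate around `φ z`, has
derivative zero at `z`. The point `∞` is critical for `φ` when `0` is critical for `φ (1 / z)`,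
the fraction of the reversed polynomials. -/
def IsCriticalPoint {K : Type*} [Field K] (φ : RatFunc K) (x : OnePoint K) : Prop :=
  x.elim
    ((wronskian (φ.num.reflect (ratDegree φ)) (φ.denom.reflect (ratDegree φ))).eval 0 = 0)
    (fun z => (wronskian φ.num φ.denom).eval z = 0)

/-- `x` is preperiodic under `T`. -/
def IsPreperiodic {X : Type*} (T : X → X) (x : X) : Prop :=
  ∃ m n : ℕ, m < n ∧ T^[n] x = T^[m] x

variable {p : ℕ} [Fact p.Prime]

/-- Rational open disks of the projective line over `ℂ_[p]`: the open disks `D(b, R)` and the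
complements of the closed disks `D̄(b, R)`, with `R` in the value group of `ℂ_[p]`. -/
def IsRationalOpenDisk (U : Set (OnePoint ℂ_[p])) : Prop :=
  ∃ (b : ℂ_[p]) (R : ℝ), (∃ r : ℂ_[p], r ≠ 0 ∧ ‖r‖ = R) ∧
    (U = (fun z : ℂ_[p] => (z : OnePoint ℂ_[p])) '' Metric.ball b R ∨
      U = ((fun z : ℂ_[p] => (z : OnePoint ℂ_[p])) '' Metric.closedBall b R)ᶜ)

/-! ### Analytic and meromorphic functions on the open disk `D(0, S)` -/

variable (p) in
/-- The ring of power series over `ℂ_[p]` that converge on the open disk `D(0, S)`. -/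
def Analytic (S : ℝ) : Subring (PowerSeries ℂ_[p]) where
  carrier := {F | ∀ r : ℝ, 0 < r → r < S →
    Tendsto (fun n : ℕ => ‖PowerSeries.coeff n F‖ * r ^ n) atTop (𝓝 0)}
  mul_mem' {F G} hF hG r h0 h1 := (PowerSeries.isRestricted_iff' r (F * G)).1
    (PowerSeries.isRestricted.mul r ((PowerSeries.isRestricted_iff' r F).2 (hF r h0 h1))
      ((PowerSeries.isRestricted_iff' r G).2 (hG r h0 h1)))
  one_mem' r _ _ := (PowerSeries.isRestricted_iff' r _).1 (PowerSeries.isRestricted_one r)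
  add_mem' {F G} hF hG r h0 h1 := (PowerSeries.isRestricted_iff' r (F + G)).1
    (PowerSeries.isRestricted.add r ((PowerSeries.isRestricted_iff' r F).2 (hF r h0 h1))
      ((PowerSeries.isRestricted_iff' r G).2 (hG r h0 h1)))
  zero_mem' r _ _ := (PowerSeries.isRestricted_iff' r _).1 (PowerSeries.isRestricted_zero r)
  neg_mem' {F} hF r h0 h1 := (PowerSeries.isRestricted_iff' r (-F)).1
    (PowerSeries.isRestricted.neg r ((PowerSeries.isRestricted_iff' r F).2 (hF r h0 h1)))

variable {S : ℝ}

theorem Analytic.summable_norm (c : Metric.ball (0 : ℂ_[p]) S) (F : Analytic p S) :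
    Summable fun n : ℕ => ‖PowerSeries.coeff n (F : PowerSeries ℂ_[p]) * (c : ℂ_[p]) ^ n‖ := by
  have hc : ‖(c : ℂ_[p])‖ < S := mem_ball_zero_iff.1 c.2
  obtain ⟨r, hcr, hrS⟩ := exists_between hc
  have hr : 0 < r := lt_of_le_of_lt (norm_nonneg _) hcr
  have hF := F.2 r hr hrS
  have hq : ‖(c : ℂ_[p])‖ / r < 1 := (div_lt_one hr).2 hcr
  have hq0 : 0 ≤ ‖(c : ℂ_[p])‖ / r := by positivity
  refine summable_of_isBigO_nat (summable_geometric_of_lt_one hq0 hq) ?_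
  refine Asymptotics.IsBigO.of_bound 1 ?_
  filter_upwards [hF.eventually_lt_const one_pos] with n hn
  rw [norm_norm, norm_mul, norm_pow, norm_pow, Real.norm_of_nonneg hq0, one_mul]
  calc ‖PowerSeries.coeff n (F : PowerSeries ℂ_[p])‖ * ‖(c : ℂ_[p])‖ ^ n
      = (‖PowerSeries.coeff n (F : PowerSeries ℂ_[p])‖ * r ^ n) * (‖(c : ℂ_[p])‖ / r) ^ n := by
        rw [div_pow]; field_simp
    _ ≤ 1 * (‖(c : ℂ_[p])‖ / r) ^ n := by gcongr
    _ = _ := one_mul _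

/-- Evaluation of convergent power series at a point `c` of `D(0, S)`, as a ring homomorphism. -/
def Analytic.eval (c : Metric.ball (0 : ℂ_[p]) S) : Analytic p S →+* ℂ_[p] where
  toFun F := ∑' n : ℕ, PowerSeries.coeff n (F : PowerSeries ℂ_[p]) * (c : ℂ_[p]) ^ n
  map_one' := by
    rw [tsum_eq_single 0]
    · simp
    · intro n hn
      simp [PowerSeries.coeff_one, hn]
  map_zero' := by simp
  map_add' F G := by
    rw [← (Analytic.summable_norm c F).of_norm.tsum_add (Analytic.summable_norm c G).of_norm]
    simp [add_mul]
  map_mul' F G := by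
    rw [tsum_mul_tsum_eq_tsum_sum_antidiagonal_of_summable_norm
      (Analytic.summable_norm c F) (Analytic.summable_norm c G)]
    refine tsum_congr fun n => ?_
    rw [Subring.coe_mul, PowerSeries.coeff_mul, Finset.sum_mul]
    refine Finset.sum_congr rfl fun x hx => ?_
    rw [← Finset.HasAntidiagonal.mem_antidiagonal.1 hx, pow_add]
    ring

variable (p S) in
/-- The field of meromorphic functions on `D(0, S)`: the quotients of convergent power series. -/
def Mero : Type := FractionRing (Analytic p S)

instance : Field (Mero p S) := inferInstanceAs (Field (FractionRing (Analytic p S)))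

instance : Algebra (Analytic p S) (Mero p S) :=
  inferInstanceAs (Algebra (Analytic p S) (FractionRing (Analytic p S)))

instance : IsFractionRing (Analytic p S) (Mero p S) :=
  inferInstanceAs (IsFractionRing (Analytic p S) (FractionRing (Analytic p S)))

/-- `HasValue α c v` says that `α(c) = v`, for a point `α` of the projective line over the field
of meromorphic functions. The value is read off from a representative `α = [g : h]` by power
series without a common zero at `c`; there is one for each `c`, since a common factor that
vanishes at `c` can be divided out, and `v` does not depend on it. -/
def HasValue (α : OnePoint (Mero p S)) (c : Metric.ball (0 : ℂ_[p]) S)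
    (v : OnePoint ℂ_[p]) : Prop :=
  ∃ g h : Analytic p S,
    α = ratio (algebraMap (Analytic p S) (Mero p S) g) (algebraMap (Analytic p S) (Mero p S) h) ∧
    (Analytic.eval c g ≠ 0 ∨ Analytic.eval c h ≠ 0) ∧
    v = ratio (Analytic.eval c g) (Analytic.eval c h)

/-- `IsSpecialization Φ c φ` says that `Φ(c, z)` is the rational function `φ(z)` over `ℂ_[p]`, for
a rational function `Φ` over the field of meromorphic functions: `Φ` is a fraction `G / H` of
polynomials in `z` with coefficients convergent power series in `c` such that `H(c, z)` is not
identically zero in `z`, and `φ(z) = G(c, z) / H(c, z)`. There is at most one such `φ`. -/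
def IsSpecialization (Φ : RatFunc (Mero p S)) (c : Metric.ball (0 : ℂ_[p]) S)
    (φ : RatFunc ℂ_[p]) : Prop :=
  ∃ G H : (Analytic p S)[X], H.map (Analytic.eval c) ≠ 0 ∧
    Φ = algebraMap (Mero p S)[X] (RatFunc (Mero p S))
          (G.map (algebraMap (Analytic p S) (Mero p S))) /
        algebraMap (Mero p S)[X] (RatFunc (Mero p S))
          (H.map (algebraMap (Analytic p S) (Mero p S))) ∧
    φ = algebraMap ℂ_[p][X] (RatFunc ℂ_[p]) (G.map (Analytic.eval c)) /
        algebraMap ℂ_[p][X] (RatFunc ℂ_[p]) (H.map (Analytic.eval c))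

end PadicFamily

end

open Filter Topology Polynomial

noncomputable section

set_option linter.unusedSectionVars false

namespace PadicFamily

/-! ### Ultrametric norm estimates and density of the value group. -/

section Basic

variable {K : Type*} [NontriviallyNormedField K] [IsUltrametricDist K]

/-! Fix `s < S`. It is enough to find one pair `m < n` such that, apart from finitely many `c` in
the closed disk of radius `s`, every parameter of the set in (a) satisfies `f_c^n(α(c)) =
f_c^m(α(c))`. In homogeneous coordinates this relation is the vanishing of one analytic function of
`c`. If (b) fails, that function is not identically zero, so it has finitely many zeros in the
closed disk (`finite_orbit_relation`), and (a) follows.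

To find the pair, choose a Möbius map from `D(0,1)` onto `U_M` and conjugate `f_c^(N-M)` by it. The
result is a family `F_c` of analytic self-maps of the unit disk, analytic also in `c`, with an
analytic marked point (`exists_uniform_orbit_relation_ratMap`). By the chain rule, a critical point
of `F_c` corresponds to an orbit through a critical point of `f_c` in `U_M, …, U_(N-1)`. All Taylor
coefficients of `F_c` have norm at most 1, so by the Schwarz lemma the linear coefficient stays, on
a smaller parameter disk, within a constant less than 1 of its value `a` at `c = 0`. Two cases arise
(`exists_uniform_orbit_relation`).

If `‖a‖ = 1`, every `F_c` is uniformly close to the rotation by `a` on a disk containing the marked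
points. It is an isometry there, so preperiodic points are periodic. Their periods are bounded: once
a power of `a` is close to 1, each further `p`-th iteration shrinks the distance to the identity,
and a map close enough to the identity has only fixed points as periodic points. Critical points
play no role.

If `‖a‖ < 1`, there is an attracting fixed point, analytic in `c`, which is moved to 0, and
preperiodic points are eventually mapped to 0. Let `a_m(c)` be the first Taylor coefficient at 0
that is not identically zero in `c`. Where `a_m(c)` is bounded away from 0, no other zero of `F_c`
is close to 0, so the marked point reaches 0 after a uniform number of steps. Near a zero `c₀` of
`a_m` the critical points are decisive: the local degree jumps from `m` to some `e > m` at `c₀`, and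
for nearby `c ≠ c₀` not all critical points are eventually mapped to 0
(`not_forall_critical_eventually_zero`). Otherwise the norms of the logarithmic derivatives of two
consecutive high iterates would be determined by the same simple poles, up to a constant. Comparing
them by the chain rule, close to 0 and at a larger radius, gives incompatible values. -/

theorem norm_sub_le_max' (x y : K) : ‖x - y‖ ≤ max ‖x‖ ‖y‖ := by
  simpa [sub_eq_add_neg] using IsUltrametricDist.norm_add_le_max x (-y)

theorem norm_sub_le_of_le {x y : K} {C : ℝ} (hx : ‖x‖ ≤ C) (hy : ‖y‖ ≤ C) : ‖x - y‖ ≤ C :=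
  (norm_sub_le_max' x y).trans (max_le hx hy)

theorem norm_sub_lt_of_lt {x y : K} {C : ℝ} (hx : ‖x‖ < C) (hy : ‖y‖ < C) : ‖x - y‖ < C :=
  (norm_sub_le_max' x y).trans_lt (max_lt hx hy)

theorem norm_add_le_of_le' {x y : K} {C : ℝ} (hx : ‖x‖ ≤ C) (hy : ‖y‖ ≤ C) : ‖x + y‖ ≤ C :=
  (IsUltrametricDist.norm_add_le_max x y).trans (max_le hx hy)

theorem norm_add_lt_of_lt' {x y : K} {C : ℝ} (hx : ‖x‖ < C) (hy : ‖y‖ < C) : ‖x + y‖ < C :=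
  (IsUltrametricDist.norm_add_le_max x y).trans_lt (max_lt hx hy)

theorem norm_eq_of_norm_sub_lt {x y : K} (h : ‖x - y‖ < ‖x‖) : ‖y‖ = ‖x‖ := by
  have hne : ‖x‖ ≠ ‖y - x‖ := by rw [norm_sub_rev y x]; exact h.ne'
  have := IsUltrametricDist.norm_add_eq_max_of_norm_ne_norm hne
  rw [add_sub_cancel, norm_sub_rev y x, max_eq_left h.le] at this
  exact this

theorem norm_add_eq_left_of_lt {x y : K} (h : ‖y‖ < ‖x‖) : ‖x + y‖ = ‖x‖ := by
  rw [IsUltrametricDist.norm_add_eq_max_of_norm_ne_norm h.ne', max_eq_left h.le]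

theorem norm_hasSum_le {f : ℕ → K} {a : K} {C : ℝ} (hf : HasSum f a) (hC : ∀ n, ‖f n‖ ≤ C) :
    ‖a‖ ≤ C := by
  have h0 : 0 ≤ C := (norm_nonneg _).trans (hC 0)
  refine le_of_tendsto hf.norm (Eventually.of_forall fun s => ?_)
  exact IsUltrametricDist.norm_sum_le_of_forall_le_of_nonneg h0 fun i _ => hC i

/-- Either `N` or `N + 1` is a unit of the valuation ring. -/
theorem exists_norm_natCast_eq_one (B : ℕ) : ∃ N, B ≤ N ∧ ‖(N : K)‖ = 1 := by
  by_cases h : ‖(B : K)‖ = 1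
  · exact ⟨B, le_rfl, h⟩
  · refine ⟨B + 1, Nat.le_succ B, ?_⟩
    have hB : ‖(B : K)‖ < 1 := lt_of_le_of_ne (IsUltrametricDist.norm_natCast_le_one K B) h
    have := norm_add_eq_left_of_lt (x := (1 : K)) (y := (B : K)) (by simpa using hB)
    rw [Nat.cast_succ, add_comm, this, norm_one]

/-- Roots of high order of an element of norm above 1 have norm above 1 but as close to 1 as
desired. The integral powers of such a root cannot jump over the interval. -/
theorem exists_norm_between [IsAlgClosed K] {a b : ℝ} (ha : 0 ≤ a) (hab : a < b) :
    ∃ x : K, a < ‖x‖ ∧ ‖x‖ < b := by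
  wlog ha0 : 0 < a generalizing a
  · obtain ⟨a', h1, h2⟩ := exists_between hab
    obtain ⟨x, hx1, hx2⟩ := this (ha.trans h1.le) h2 (ha.trans_lt h1)
    exact ⟨x, h1.trans hx1, hx2⟩
  obtain ⟨y, hy⟩ := NontriviallyNormedField.non_trivial (α := K)
  have hq : 1 < b / a := (one_lt_div ha0).2 hab
  obtain ⟨n, hn⟩ := pow_unbounded_of_one_lt ‖y‖ hq
  have hn0 : 0 < n := by
    rcases Nat.eq_zero_or_pos n with rfl | h
    · simp at hn; linarith
    · exact h
  obtain ⟨ξ, hξ⟩ := IsAlgClosed.exists_pow_nat_eq y hn0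
  have hξn : ‖ξ‖ ^ n = ‖y‖ := by rw [← norm_pow, hξ]
  have hξ1 : 1 < ‖ξ‖ := by
    by_contra h
    have := pow_le_one₀ (norm_nonneg ξ) (not_lt.1 h) (n := n)
    linarith
  have hξ2 : ‖ξ‖ < b / a := lt_of_pow_lt_pow_left₀ n (by positivity) (by rw [hξn]; exact hn)
  obtain ⟨k, hk1, hk2⟩ := exists_mem_Ico_zpow ha0 hξ1
  refine ⟨ξ ^ (k + 1), by rwa [norm_zpow], ?_⟩
  rw [norm_zpow, zpow_add_one₀ (by positivity)]
  calc ‖ξ‖ ^ k * ‖ξ‖ ≤ a * ‖ξ‖ := by gcongr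
    _ < a * (b / a) := by gcongr
    _ = b := by field_simp

end Basic

/-! ### Functions given by convergent power series. -/

section Expansion

variable {K : Type*} [NontriviallyNormedField K]

/-- `φ` is given on the open disk of radius `S` around `0` by the power series `F`, which converges
there. -/
structure HasExp (S : ℝ) (F : PowerSeries K) (φ : K → K) : Prop where
  conv : ∀ r : ℝ, 0 < r → r < S →
    Tendsto (fun n : ℕ => ‖PowerSeries.coeff n F‖ * r ^ n) atTop (𝓝 0)
  hasSum : ∀ z : K, ‖z‖ < S → HasSum (fun n => PowerSeries.coeff n F * z ^ n) (φ z)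

/-- `φ` is given by a convergent power series on the open disk of radius `S` around `0`. -/
def An (S : ℝ) (φ : K → K) : Prop := ∃ F, HasExp S F φ

theorem summable_norm_of_conv {S : ℝ} {F : PowerSeries K}
    (hF : ∀ r : ℝ, 0 < r → r < S →
      Tendsto (fun n : ℕ => ‖PowerSeries.coeff n F‖ * r ^ n) atTop (𝓝 0)) {c : K} (hc : ‖c‖ < S) :
    Summable fun n : ℕ => ‖PowerSeries.coeff n F * c ^ n‖ := by
  obtain ⟨r, hcr, hrS⟩ := exists_between hc
  have hr : 0 < r := lt_of_le_of_lt (norm_nonneg _) hcr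
  have hq : ‖c‖ / r < 1 := (div_lt_one hr).2 hcr
  have hq0 : 0 ≤ ‖c‖ / r := by positivity
  refine summable_of_isBigO_nat (summable_geometric_of_lt_one hq0 hq) ?_
  refine Asymptotics.IsBigO.of_bound 1 ?_
  filter_upwards [(hF r hr hrS).eventually_lt_const one_pos] with n hn
  rw [norm_norm, norm_mul, norm_pow, norm_pow, Real.norm_of_nonneg hq0, one_mul]
  calc ‖PowerSeries.coeff n F‖ * ‖c‖ ^ n
      = (‖PowerSeries.coeff n F‖ * r ^ n) * (‖c‖ / r) ^ n := by
        rw [div_pow]; field_simp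
    _ ≤ 1 * (‖c‖ / r) ^ n := by gcongr
    _ = _ := one_mul _

theorem HasExp.mono {S S' : ℝ} {F : PowerSeries K} {φ : K → K} (h : HasExp S F φ) (hS : S' ≤ S) :
    HasExp S' F φ :=
  ⟨fun r h0 h1 => h.conv r h0 (h1.trans_le hS), fun z hz => h.hasSum z (hz.trans_le hS)⟩

theorem An.mono {S S' : ℝ} {φ : K → K} (h : An S φ) (hS : S' ≤ S) : An S' φ :=
  let ⟨F, hF⟩ := h; ⟨F, hF.mono hS⟩

theorem HasExp.congr {S : ℝ} {F : PowerSeries K} {φ ψ : K → K} (h : HasExp S F φ)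
    (he : ∀ z, ‖z‖ < S → φ z = ψ z) : HasExp S F ψ :=
  ⟨h.conv, fun z hz => he z hz ▸ h.hasSum z hz⟩

theorem An.congr {S : ℝ} {φ ψ : K → K} (h : An S φ) (he : ∀ z, ‖z‖ < S → φ z = ψ z) : An S ψ :=
  let ⟨F, hF⟩ := h; ⟨F, hF.congr he⟩

theorem HasExp.zero_eq {S : ℝ} {F : PowerSeries K} {φ : K → K} (h : HasExp S F φ) (hS : 0 < S) :
    φ 0 = PowerSeries.coeff 0 F := by
  have h1 := h.hasSum 0 (by simpa using hS)
  refine h1.unique ?_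
  convert hasSum_single 0 ?_ using 1
  · simp
  · intro n hn; simp [hn]

theorem HasExp.add {S : ℝ} {F G : PowerSeries K} {φ ψ : K → K} (h : HasExp S F φ)
    (h' : HasExp S G ψ) : HasExp S (F + G) (fun z => φ z + ψ z) := by
  refine ⟨fun r h0 h1 => (PowerSeries.isRestricted_iff' r _).1
    (PowerSeries.isRestricted.add r ((PowerSeries.isRestricted_iff' r F).2 (h.conv r h0 h1))
      ((PowerSeries.isRestricted_iff' r G).2 (h'.conv r h0 h1))), fun z hz => ?_⟩
  simpa [add_mul] using (h.hasSum z hz).add (h'.hasSum z hz)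

theorem HasExp.neg {S : ℝ} {F : PowerSeries K} {φ : K → K} (h : HasExp S F φ) :
    HasExp S (-F) (fun z => -φ z) := by
  refine ⟨fun r h0 h1 => by simpa using h.conv r h0 h1, fun z hz => ?_⟩
  simpa using (h.hasSum z hz).neg

theorem HasExp.sub {S : ℝ} {F G : PowerSeries K} {φ ψ : K → K} (h : HasExp S F φ)
    (h' : HasExp S G ψ) : HasExp S (F - G) (fun z => φ z - ψ z) := by
  simpa [sub_eq_add_neg] using h.add h'.neg

theorem HasExp.mul [IsUltrametricDist K] [CompleteSpace K] {S : ℝ} {F G : PowerSeries K}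
    {φ ψ : K → K} (h : HasExp S F φ) (h' : HasExp S G ψ) :
    HasExp S (F * G) (fun z => φ z * ψ z) := by
  have hc : ∀ r : ℝ, 0 < r → r < S →
      Tendsto (fun n : ℕ => ‖PowerSeries.coeff n (F * G)‖ * r ^ n) atTop (𝓝 0) :=
    fun r h0 h1 => (PowerSeries.isRestricted_iff' r (F * G)).1
      (PowerSeries.isRestricted.mul r ((PowerSeries.isRestricted_iff' r F).2 (h.conv r h0 h1))
        ((PowerSeries.isRestricted_iff' r G).2 (h'.conv r h0 h1)))
  refine ⟨hc, fun z hz => ?_⟩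
  have hs := summable_norm_of_conv hc hz
  suffices φ z * ψ z = ∑' n, PowerSeries.coeff n (F * G) * z ^ n by
    rw [this]; exact hs.of_norm.hasSum
  rw [← (h.hasSum z hz).tsum_eq, ← (h'.hasSum z hz).tsum_eq,
    tsum_mul_tsum_eq_tsum_sum_antidiagonal_of_summable_norm
      (summable_norm_of_conv h.conv hz) (summable_norm_of_conv h'.conv hz)]
  refine tsum_congr fun n => ?_
  rw [PowerSeries.coeff_mul, Finset.sum_mul]
  refine Finset.sum_congr rfl fun x hx => ?_
  rw [← Finset.HasAntidiagonal.mem_antidiagonal.1 hx, pow_add]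
  ring

theorem HasExp.polynomial (S : ℝ) (P : K[X]) : HasExp S (P : PowerSeries K) (fun z => P.eval z) := by
  refine ⟨fun r _ _ => ?_, fun z _ => ?_⟩
  · refine tendsto_const_nhds.congr' ?_
    filter_upwards [eventually_gt_atTop P.natDegree] with n hn
    simp [Polynomial.coeff_eq_zero_of_natDegree_lt hn]
  · rw [Polynomial.eval_eq_sum_range]
    have : ∀ n ∉ Finset.range (P.natDegree + 1),
        PowerSeries.coeff n (P : PowerSeries K) * z ^ n = 0 := by
      intro n hn
      have : P.natDegree < n := by simpa [Nat.lt_succ_iff] using hn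
      simp [Polynomial.coeff_eq_zero_of_natDegree_lt this]
    simpa using hasSum_sum_of_ne_finset_zero this

theorem An.polynomial (S : ℝ) (P : K[X]) : An S (fun z => P.eval z) := ⟨_, HasExp.polynomial S P⟩

theorem An.const (S : ℝ) (a : K) : An S (fun _ => a) := by simpa using An.polynomial S (C a)

theorem An.id (S : ℝ) : An S (fun z : K => z) := by simpa using An.polynomial S (X : K[X])

theorem An.add {S : ℝ} {φ ψ : K → K} (h : An S φ) (h' : An S ψ) : An S (fun z => φ z + ψ z) :=
  let ⟨_, hF⟩ := h; let ⟨_, hG⟩ := h'; ⟨_, hF.add hG⟩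

theorem An.sub {S : ℝ} {φ ψ : K → K} (h : An S φ) (h' : An S ψ) : An S (fun z => φ z - ψ z) :=
  let ⟨_, hF⟩ := h; let ⟨_, hG⟩ := h'; ⟨_, hF.sub hG⟩

variable [IsUltrametricDist K] [CompleteSpace K]

theorem An.mul {S : ℝ} {φ ψ : K → K} (h : An S φ) (h' : An S ψ) : An S (fun z => φ z * ψ z) :=
  let ⟨_, hF⟩ := h; let ⟨_, hG⟩ := h'; ⟨_, hF.mul hG⟩

theorem An.pow {S : ℝ} {φ : K → K} (h : An S φ) (n : ℕ) : An S (fun z => φ z ^ n) := by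
  induction n with
  | zero => simpa using An.const S (1 : K)
  | succ n ih => simpa [pow_succ] using ih.mul h

theorem An.sum {ι : Type*} {S : ℝ} {φ : ι → K → K} (s : Finset ι) (h : ∀ i ∈ s, An S (φ i)) :
    An S (fun z => ∑ i ∈ s, φ i z) := by
  classical
  induction s using Finset.induction_on with
  | empty => simpa using An.const S (0 : K)
  | insert i s hi ih =>
    have := (h i (Finset.mem_insert_self i s)).add
      (ih fun j hj => h j (Finset.mem_insert_of_mem hj))
    exact this.congr fun z _ => by rw [Finset.sum_insert hi]

theorem hasSum_of_conv {S : ℝ} {F : PowerSeries K}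
    (hF : ∀ r : ℝ, 0 < r → r < S →
      Tendsto (fun n : ℕ => ‖PowerSeries.coeff n F‖ * r ^ n) atTop (𝓝 0)) :
    HasExp S F (fun z => ∑' n, PowerSeries.coeff n F * z ^ n) :=
  ⟨hF, fun _ hz => (summable_norm_of_conv hF hz).of_norm.hasSum⟩

theorem HasExp.norm_le {S : ℝ} {F : PowerSeries K} {φ : K → K} (h : HasExp S F φ) {z : K}
    (hz : ‖z‖ < S) {C : ℝ} (hC : ∀ n, ‖PowerSeries.coeff n F‖ * ‖z‖ ^ n ≤ C) : ‖φ z‖ ≤ C :=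
  norm_hasSum_le (h.hasSum z hz) fun n => by rw [norm_mul, norm_pow]; exact hC n

end Expansion

/-! ### Cauchy estimates, the identity theorem and uniform limits. -/

section Cauchy

variable {K : Type*} [NontriviallyNormedField K] [IsUltrametricDist K]
  [IsAlgClosed K] [CharZero K]

/-- The Cauchy estimate on a circle, by averaging over roots of unity of large order prime to the
residue characteristic. -/
theorem HasExp.cauchy_circle {S : ℝ} {F : PowerSeries K} {φ : K → K} (h : HasExp S F φ) {C : ℝ}
    {x : K} (hx : ‖x‖ < S) (hC : ∀ z, ‖z‖ = ‖x‖ → ‖φ z‖ ≤ C) (n : ℕ) :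
    ‖PowerSeries.coeff n F‖ * ‖x‖ ^ n ≤ C := by
  have hC0 : 0 ≤ C := (norm_nonneg _).trans (hC x rfl)
  refine le_of_forall_pos_le_add fun ε hε => ?_
  have ht : Tendsto (fun n => ‖PowerSeries.coeff n F * x ^ n‖) atTop (𝓝 0) := by
    have := (h.hasSum x hx).summable.tendsto_atTop_zero.norm
    simpa using this
  obtain ⟨N₁, hN₁⟩ := eventually_atTop.1 (ht.eventually_lt_const hε)
  -- Averaging over `N`-th roots of unity isolates the `n`-th term up to terms of index at least
  -- `N`, which are below `ε` since `N > N₁`. As `‖N‖ = 1`, the factor `N` in front of the `n`-th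
  -- term costs nothing.
  obtain ⟨N, hN, hN1⟩ := exists_norm_natCast_eq_one (K := K) (N₁ + n + 1)
  have hNpos : 0 < N := by omega
  have : NeZero (N : K) := ⟨by intro h0; rw [h0] at hN1; simp at hN1⟩
  obtain ⟨ζ, hζ⟩ := HasEnoughRootsOfUnity.exists_primitiveRoot K N
  have hζ1 : ‖ζ‖ = 1 := by
    have : ‖ζ‖ ^ N = 1 := by rw [← norm_pow, hζ.pow_eq_one, norm_one]
    exact (pow_eq_one_iff_of_nonneg (norm_nonneg _) hNpos.ne').1 this
  have hζ0 : ζ ≠ 0 := by intro h0; simp [h0] at hζ1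
  set χ : ℕ → K := fun m => ∑ k ∈ Finset.range N, (ζ ^ m / ζ ^ n) ^ k with hχ
  have hχn : χ n = N := by simp [hχ, hζ0]
  have hχ1 : ∀ m, ‖χ m‖ ≤ 1 := fun m =>
    IsUltrametricDist.norm_sum_le_of_forall_le_of_nonneg zero_le_one fun k _ => by
      simp [hζ1]
  have hχ0 : ∀ m, m < N → m ≠ n → χ m = 0 := by
    intro m hm hmn
    have hne : ζ ^ m / ζ ^ n ≠ 1 := by
      intro h1
      rw [div_eq_one_iff_eq (pow_ne_zero _ hζ0)] at h1
      exact hmn (hζ.pow_inj hm (by omega) h1)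
    have : (ζ ^ m / ζ ^ n) ^ N = 1 := by
      rw [div_pow, ← pow_mul, ← pow_mul, mul_comm m, mul_comm n, pow_mul, pow_mul, hζ.pow_eq_one]
      simp
    rw [hχ]
    simp only
    rw [geom_sum_eq hne, this, sub_self, zero_div]
  have hsum : HasSum (fun m => PowerSeries.coeff m F * x ^ m * χ m)
      (∑ k ∈ Finset.range N, ((ζ ^ n) ^ k)⁻¹ * φ (ζ ^ k * x)) := by
    have : ∀ k ∈ Finset.range N, HasSum
        (fun m => ((ζ ^ n) ^ k)⁻¹ * (PowerSeries.coeff m F * (ζ ^ k * x) ^ m))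
        (((ζ ^ n) ^ k)⁻¹ * φ (ζ ^ k * x)) := fun k _ =>
      (h.hasSum (ζ ^ k * x) (by simpa [hζ1] using hx)).mul_left _
    convert hasSum_sum this using 2 with m
    rw [hχ]
    simp only
    rw [Finset.mul_sum]
    refine Finset.sum_congr rfl fun k _ => ?_
    rw [div_pow, mul_pow, ← pow_mul ζ k m, ← pow_mul ζ m k, mul_comm k m]
    field_simp
  have hsum' := hsum.sub (hasSum_ite_eq n (PowerSeries.coeff n F * x ^ n * N))
  have hle := norm_hasSum_le (C := ε) hsum' (fun m => ?_)
  · have hφ : ‖∑ k ∈ Finset.range N, ((ζ ^ n) ^ k)⁻¹ * φ (ζ ^ k * x)‖ ≤ C :=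
      IsUltrametricDist.norm_sum_le_of_forall_le_of_nonneg hC0 fun k _ => by
        rw [norm_mul]
        simpa [hζ1] using hC (ζ ^ k * x) (by simp [hζ1])
    have hfin := norm_sub_le_of_le (C := C + ε) (hφ.trans (by linarith)) (hle.trans (by linarith))
    rw [sub_sub_cancel, norm_mul, norm_mul, hN1, mul_one, norm_pow] at hfin
    exact hfin
  · by_cases hm : m = n
    · subst hm; simp [hχn, hε.le]
    · rw [if_neg hm, sub_zero]
      by_cases hmN : m < N
      · rw [hχ0 m hmN hm]; simp [hε.le]
      · rw [norm_mul]
        have := hN₁ m (by omega)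
        calc _ ≤ ‖PowerSeries.coeff m F * x ^ m‖ * 1 := by gcongr; exact hχ1 m
          _ ≤ ε := by linarith

/-- The radii of circles with a point of `K` on them are dense, so the estimate on circles passes to
every `t < S` and then to the limit `t → S`. -/
theorem HasExp.cauchy {S : ℝ} (hS : 0 < S) {F : PowerSeries K} {φ : K → K} (h : HasExp S F φ)
    {C : ℝ} (hC : ∀ z, ‖z‖ < S → ‖φ z‖ ≤ C) (n : ℕ) : ‖PowerSeries.coeff n F‖ * S ^ n ≤ C := by
  have key : ∀ t, 0 < t → t < S → ‖PowerSeries.coeff n F‖ * t ^ n ≤ C := by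
    intro t h0 h1
    obtain ⟨x, hx1, hx2⟩ := exists_norm_between (K := K) h0.le h1
    calc ‖PowerSeries.coeff n F‖ * t ^ n ≤ ‖PowerSeries.coeff n F‖ * ‖x‖ ^ n := by gcongr
      _ ≤ C := h.cauchy_circle hx2 (fun z hz => hC z (hz ▸ hx2)) n
  have hcont : Tendsto (fun t : ℝ => ‖PowerSeries.coeff n F‖ * t ^ n) (𝓝[<] S)
      (𝓝 (‖PowerSeries.coeff n F‖ * S ^ n)) :=
    ((continuous_const.mul (continuous_pow n)).tendsto S).mono_left nhdsWithin_le_nhds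
  refine le_of_tendsto hcont ?_
  filter_upwards [Ioo_mem_nhdsLT hS] with t ht using key t ht.1 ht.2

theorem HasExp.eq_zero {S : ℝ} (hS : 0 < S) {F : PowerSeries K} {φ : K → K} (h : HasExp S F φ)
    (h0 : ∀ z, ‖z‖ < S → φ z = 0) : F = 0 := by
  ext n
  have := h.cauchy hS (C := 0) (fun z hz => by simp [h0 z hz]) n
  have hn : ‖PowerSeries.coeff n F‖ ≤ 0 := by
    by_contra hlt
    have : 0 < ‖PowerSeries.coeff n F‖ * S ^ n := mul_pos (not_le.1 hlt) (pow_pos hS n)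
    linarith
  simpa using hn

theorem HasExp.unique {S : ℝ} (hS : 0 < S) {F G : PowerSeries K} {φ : K → K} (h : HasExp S F φ)
    (h' : HasExp S G φ) : F = G :=
  sub_eq_zero.1 ((h.sub h').eq_zero hS fun _ _ => sub_self _)

/-- Functions that are analytic on all smaller disks are analytic. -/
theorem An.of_forall_lt {S : ℝ} (hS : 0 < S) {φ : K → K} (h : ∀ r, 0 < r → r < S → An r φ) :
    An S φ := by
  obtain ⟨F, hF⟩ := h (S / 2) (by linarith) (by linarith)
  have key : ∀ r, 0 < r → r < S → HasExp r F φ := by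
    intro r h0 h1
    obtain ⟨G, hG⟩ := h r h0 h1
    have : F = G := (hF.mono (min_le_left _ r)).unique (lt_min (by linarith) h0)
      (hG.mono (min_le_right _ _))
    exact this ▸ hG
  refine ⟨F, ⟨fun r h0 h1 => ?_, fun z hz => ?_⟩⟩
  · obtain ⟨t, ht1, ht2⟩ := exists_between h1
    exact (key t (h0.trans ht1) ht2).conv r h0 ht1
  · obtain ⟨t, ht1, ht2⟩ := exists_between hz
    exact (key t ((norm_nonneg z).trans_lt ht1) ht2).hasSum z ht1

variable [CompleteSpace K]

/-- Uniform limits of analytic functions are analytic. -/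
theorem An.of_uniform_approx {S : ℝ} (hS : 0 < S) {φ : K → K}
    (h : ∀ ε > 0, ∃ ψ, An S ψ ∧ ∀ z, ‖z‖ < S → ‖φ z - ψ z‖ ≤ ε) : An S φ := by
  have h' : ∀ k : ℕ, ∃ (ψ : K → K) (F : PowerSeries K), HasExp S F ψ ∧
      ∀ z, ‖z‖ < S → ‖φ z - ψ z‖ ≤ 1 / ((k : ℝ) + 1) := by
    intro k
    obtain ⟨ψ, ⟨F, hF⟩, hψ⟩ := h (1 / ((k : ℝ) + 1)) Nat.one_div_pos_of_nat
    exact ⟨ψ, F, hF, hψ⟩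
  choose ψ F hF hψ using h'
  have hε : Tendsto (fun k : ℕ => 1 / ((k : ℝ) + 1)) atTop (𝓝 0) :=
    tendsto_one_div_add_atTop_nhds_zero_nat
  have hanti : ∀ {k l : ℕ}, k ≤ l → 1 / ((l : ℝ) + 1) ≤ 1 / ((k : ℝ) + 1) := fun hkl =>
    one_div_le_one_div_of_le (by positivity) (by gcongr)
  -- The Cauchy estimates turn uniform closeness of the functions into closeness of the
  -- coefficients, weighted by the full radius `S`. The coefficientwise limit therefore converges on
  -- the whole disk.
  have hcoef : ∀ k l n, k ≤ l →
      ‖PowerSeries.coeff n (F k) - PowerSeries.coeff n (F l)‖ * S ^ n ≤ 1 / ((k : ℝ) + 1) := by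
    intro k l n hkl
    have := ((hF k).sub (hF l)).cauchy hS (C := 1 / ((k : ℝ) + 1)) (fun z hz => ?_) n
    · simpa using this
    · have h1 := hψ k z hz
      have h2 := (hψ l z hz).trans (hanti hkl)
      have := norm_sub_le_of_le h2 h1
      simpa using this
  have hlim : ∀ n, ∃ g, Tendsto (fun k => PowerSeries.coeff n (F k)) atTop (𝓝 g) := by
    intro n
    refine cauchySeq_tendsto_of_complete ?_
    refine cauchySeq_of_le_tendsto_0 (fun k : ℕ => 1 / ((k : ℝ) + 1) / S ^ n * 1) ?_ ?_
    · intro k l N hk hl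
      rw [mul_one, le_div_iff₀ (pow_pos hS n), dist_eq_norm]
      rcases le_total k l with hkl | hkl
      · exact (hcoef k l n hkl).trans (hanti hk)
      · rw [norm_sub_rev]; exact (hcoef l k n hkl).trans (hanti hl)
    · simpa using (hε.div_const (S ^ n))
  choose g hg using hlim
  have hdiff : ∀ k n, ‖PowerSeries.coeff n (F k) - g n‖ * S ^ n ≤ 1 / ((k : ℝ) + 1) := by
    intro k n
    refine le_of_tendsto (((tendsto_const_nhds.sub (hg n)).norm).mul_const (S ^ n)) ?_
    filter_upwards [eventually_ge_atTop k] with l hl using hcoef k l n hl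
  have hconv : ∀ r : ℝ, 0 < r → r < S →
      Tendsto (fun n : ℕ => ‖PowerSeries.coeff n (PowerSeries.mk g)‖ * r ^ n) atTop (𝓝 0) := by
    intro r h0 h1
    rw [Metric.tendsto_atTop]
    intro ε hε0
    obtain ⟨k, hk⟩ := (hε.eventually_lt_const hε0).exists
    obtain ⟨N, hN⟩ := eventually_atTop.1 (((hF k).conv r h0 h1).eventually_lt_const hε0)
    refine ⟨N, fun n hn => ?_⟩
    have hr : 0 ≤ r ^ n := by positivity
    rw [Real.dist_eq, sub_zero, abs_of_nonneg (by positivity), PowerSeries.coeff_mk]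
    have e1 : ‖g n‖ ≤ max ‖PowerSeries.coeff n (F k)‖ ‖PowerSeries.coeff n (F k) - g n‖ := by
      have := norm_sub_le_max' (PowerSeries.coeff n (F k)) (PowerSeries.coeff n (F k) - g n)
      simpa using this
    have e2 : ‖PowerSeries.coeff n (F k) - g n‖ * r ^ n < ε := by
      refine lt_of_le_of_lt ?_ hk
      refine le_trans ?_ (hdiff k n)
      gcongr
    calc ‖g n‖ * r ^ n ≤ max ‖PowerSeries.coeff n (F k)‖ ‖PowerSeries.coeff n (F k) - g n‖ * r ^ n :=
          by gcongr
      _ = max (‖PowerSeries.coeff n (F k)‖ * r ^ n)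
          (‖PowerSeries.coeff n (F k) - g n‖ * r ^ n) := by rw [max_mul_of_nonneg _ _ hr]
      _ < ε := max_lt (hN n hn) e2
  refine ⟨PowerSeries.mk g, (hasSum_of_conv hconv).congr fun z hz => ?_⟩
  have hle : ∀ k : ℕ, ‖(∑' n, PowerSeries.coeff n (PowerSeries.mk g) * z ^ n) - φ z‖ ≤
      1 / ((k : ℝ) + 1) := by
    intro k
    have h1 := ((hasSum_of_conv hconv).sub (hF k)).norm_le hz (C := 1 / ((k : ℝ) + 1)) (fun n => by
      rw [map_sub, PowerSeries.coeff_mk, norm_sub_rev]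
      refine le_trans ?_ (hdiff k n)
      gcongr)
    have h2 := hψ k z hz
    have := norm_sub_le_of_le h1 h2
    rwa [sub_sub_sub_cancel_right] at this
  have := ge_of_tendsto' hε hle
  simpa [sub_eq_zero] using this

end Cauchy

/-! ### The Schwarz lemma, composition and derivatives of analytic functions. -/

section Calculus

variable {K : Type*} [NontriviallyNormedField K] [IsUltrametricDist K]
  [IsAlgClosed K] [CharZero K] [CompleteSpace K]

/-- The power series `(F - ∑_{i<m} bᵢ Xⁱ) / X^m`. -/
def shiftSeries (m : ℕ) (F : PowerSeries K) : PowerSeries K :=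
  PowerSeries.mk fun n => PowerSeries.coeff (n + m) F

@[simp] theorem coeff_shiftSeries (m n : ℕ) (F : PowerSeries K) :
    PowerSeries.coeff n (shiftSeries m F) = PowerSeries.coeff (n + m) F := by
  simp [shiftSeries]

theorem HasExp.shift {S : ℝ} {F : PowerSeries K} {φ : K → K} (h : HasExp S F φ) (m : ℕ) :
    ∃ ψ, HasExp S (shiftSeries m F) ψ ∧ ∀ z, ‖z‖ < S →
      φ z = ∑ i ∈ Finset.range m, PowerSeries.coeff i F * z ^ i + z ^ m * ψ z := by
  have hc : ∀ r : ℝ, 0 < r → r < S →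
      Tendsto (fun n : ℕ => ‖PowerSeries.coeff n (shiftSeries m F)‖ * r ^ n) atTop (𝓝 0) := by
    intro r h0 h1
    have := ((tendsto_add_atTop_iff_nat m).2 (h.conv r h0 h1)).div_const (r ^ m)
    simp only [zero_div] at this
    refine this.congr fun n => ?_
    rw [coeff_shiftSeries, pow_add]
    field_simp
  refine ⟨_, hasSum_of_conv hc, fun z hz => ?_⟩
  have h1 := (hasSum_nat_add_iff' m).2 (h.hasSum z hz)
  have h2 := ((hasSum_of_conv hc).hasSum z hz).mul_left (z ^ m)
  have h3 : HasSum (fun n => z ^ m * (PowerSeries.coeff n (shiftSeries m F) * z ^ n))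
      (φ z - ∑ i ∈ Finset.range m, PowerSeries.coeff i F * z ^ i) := by
    have e : (fun n => z ^ m * (PowerSeries.coeff n (shiftSeries m F) * z ^ n)) =
        fun n => PowerSeries.coeff (n + m) F * z ^ (n + m) := by
      funext n; rw [coeff_shiftSeries, pow_add]; ring
    rw [e]; exact h1
  rw [h2.unique h3]; ring

theorem HasExp.bounded {S r : ℝ} {F : PowerSeries K} {φ : K → K} (h : HasExp S F φ) (hr0 : 0 < r)
    (hr : r < S) : ∃ C, 0 < C ∧ ∀ z, ‖z‖ ≤ r → ‖φ z‖ ≤ C := by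
  obtain ⟨C, hC⟩ := (h.conv r hr0 hr).bddAbove_range
  refine ⟨max C 1, by positivity, fun z hz => h.norm_le (hz.trans_lt hr) fun n => ?_⟩
  calc ‖PowerSeries.coeff n F‖ * ‖z‖ ^ n ≤ ‖PowerSeries.coeff n F‖ * r ^ n := by gcongr
    _ ≤ C := hC ⟨n, rfl⟩
    _ ≤ _ := le_max_left _ _

/-- The Schwarz lemma. The quotient `(φ z - φ 0) / z` has the shifted coefficients of `φ`, and the
Cauchy estimates at radius `S` bound it by `C / S`. -/
theorem HasExp.norm_sub_zero_le {S : ℝ} (hS : 0 < S) {F : PowerSeries K} {φ : K → K}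
    (h : HasExp S F φ) {C : ℝ} (hC : ∀ z, ‖z‖ < S → ‖φ z‖ ≤ C) {z : K} (hz : ‖z‖ < S) :
    ‖φ z - φ 0‖ ≤ C / S * ‖z‖ := by
  obtain ⟨ψ, hψ, he⟩ := h.shift 1
  have hC0 : 0 ≤ C := (norm_nonneg _).trans (hC 0 (by simpa using hS))
  have hψz : ‖ψ z‖ ≤ C / S := by
    refine hψ.norm_le hz fun n => ?_
    rw [le_div_iff₀ hS, coeff_shiftSeries]
    refine le_trans ?_ (h.cauchy hS hC (n + 1))
    rw [pow_succ, ← mul_assoc]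
    gcongr
  have : φ z - φ 0 = z * ψ z := by
    rw [he z hz, h.zero_eq hS]; simp
  rw [this, norm_mul, mul_comm]
  gcongr

/-- In the ultrametric setting a tail is no larger than its largest term, so terms that tend to zero
uniformly already give uniform convergence of the partial sums. -/
theorem An.of_hasSum {S : ℝ} (hS : 0 < S) {a : ℕ → K → K} {B : ℕ → ℝ} {φ : K → K}
    (ha : ∀ n, An S (a n)) (hB : Tendsto B atTop (𝓝 0)) (hle : ∀ n z, ‖z‖ < S → ‖a n z‖ ≤ B n)
    (hs : ∀ z, ‖z‖ < S → HasSum (fun n => a n z) (φ z)) : An S φ := by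
  refine An.of_uniform_approx hS fun ε hε => ?_
  obtain ⟨N, hN⟩ := eventually_atTop.1 (hB.eventually_lt_const hε)
  refine ⟨fun z => ∑ i ∈ Finset.range N, a i z, An.sum _ fun i _ => ha i, fun z hz => ?_⟩
  refine norm_hasSum_le ((hasSum_nat_add_iff' N).2 (hs z hz)) fun n => ?_
  exact (hle _ z hz).trans (hN (n + N) (Nat.le_add_left _ _)).le

/-- The Schwarz lemma supplies the missing compactness: `ψ` deviates from `ψ 0` by at most `S * r /
S' < S`, and `‖ψ 0‖ < S`. -/
theorem An.exists_bound_lt {S S' r : ℝ} (hS' : 0 < S') {ψ : K → K} (h : An S' ψ)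
    (hψ : ∀ z, ‖z‖ < S' → ‖ψ z‖ < S) (hr0 : 0 < r) (hr : r < S') :
    ∃ ρ, 0 < ρ ∧ ρ < S ∧ ∀ z, ‖z‖ ≤ r → ‖ψ z‖ ≤ ρ := by
  obtain ⟨F, hF⟩ := h
  have h0 := hψ 0 (by simpa using hS')
  have hS : 0 < S := (norm_nonneg _).trans_lt h0
  have hrS : S / S' * r < S := by
    rw [div_mul_eq_mul_div, div_lt_iff₀ hS']; gcongr
  refine ⟨max ‖ψ 0‖ (S / S' * r), lt_max_of_lt_right (by positivity), max_lt h0 hrS,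
    fun z hz => ?_⟩
  have h1 := hF.norm_sub_zero_le hS' (fun z hz => (hψ z hz).le) (hz.trans_lt hr)
  have h2 : ‖ψ z - ψ 0‖ ≤ S / S' * r := h1.trans (by gcongr)
  have := IsUltrametricDist.norm_add_le_max (ψ z - ψ 0) (ψ 0)
  rw [sub_add_cancel, max_comm] at this
  exact this.trans (max_le_max le_rfl h2)

theorem An.comp {S S' : ℝ} (hS' : 0 < S') {φ ψ : K → K} (hφ : An S φ) (hψ : An S' ψ)
    (hm : ∀ z, ‖z‖ < S' → ‖ψ z‖ < S) : An S' (fun z => φ (ψ z)) := by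
  obtain ⟨F, hF⟩ := hφ
  refine An.of_forall_lt hS' fun r hr0 hr => ?_
  obtain ⟨ρ, hρ0, hρ, hle⟩ := hψ.exists_bound_lt hS' hm hr0 hr
  refine An.of_hasSum hr0 (a := fun n z => PowerSeries.coeff n F * ψ z ^ n)
    (fun n => (An.const r _).mul ((hψ.mono hr.le).pow n)) (hF.conv ρ hρ0 hρ) (fun n z hz => ?_)
    fun z hz => hF.hasSum _ (hm z (hz.trans hr))
  rw [norm_mul, norm_pow]
  have := hle z hz.le
  gcongr

theorem An.translate {S : ℝ} {φ : K → K} (hφ : An S φ) {w : K} (hw : ‖w‖ < S) :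
    An S (fun z => φ (z + w)) :=
  An.comp ((norm_nonneg _).trans_lt hw) hφ ((An.id S).add (An.const S w))
    fun _ hz => norm_add_lt_of_lt' hz hw

/-- Every point of an ultrametric disk is a centre of it, so the Schwarz lemma applies around `w`.
-/
theorem An.lipschitz {S : ℝ} {φ : K → K} (hφ : An S φ) {C : ℝ}
    (hC : ∀ z, ‖z‖ < S → ‖φ z‖ ≤ C) {z w : K} (hz : ‖z‖ < S) (hw : ‖w‖ < S) :
    ‖φ z - φ w‖ ≤ C / S * ‖z - w‖ := by
  obtain ⟨F, hF⟩ := hφ.translate hw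
  have := hF.norm_sub_zero_le ((norm_nonneg _).trans_lt hw)
    (fun z hz => hC _ (norm_add_lt_of_lt' hz hw)) (norm_sub_lt_of_lt hz hw)
  simpa using this

theorem An.continuousAt {S : ℝ} {φ : K → K} (hφ : An S φ) {w : K} (hw : ‖w‖ < S) :
    ContinuousAt φ w := by
  obtain ⟨r, hr1, hr2⟩ := exists_between hw
  have hr0 := (norm_nonneg w).trans_lt hr1
  obtain ⟨F, hF⟩ := hφ
  obtain ⟨C, hC0, hC⟩ := hF.bounded hr0 hr2
  have hφr : An r φ := An.mono ⟨F, hF⟩ hr2.le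
  rw [ContinuousAt, tendsto_iff_norm_sub_tendsto_zero]
  have h0 : Tendsto (fun z => C / r * ‖z - w‖) (𝓝 w) (𝓝 0) := by
    have : Tendsto (fun z => C / r * ‖z - w‖) (𝓝 w) (𝓝 (C / r * ‖w - w‖)) := by
      apply Continuous.tendsto; fun_prop
    simpa using this
  refine tendsto_of_tendsto_of_tendsto_of_le_of_le' tendsto_const_nhds h0
    (Eventually.of_forall fun _ => norm_nonneg _) ?_
  filter_upwards [(isOpen_lt continuous_norm continuous_const).mem_nhds hr1] with z hz
  exact hφr.lipschitz (fun z hz => hC z hz.le) hz hr1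

theorem HasExp.hasDerivAt_zero {S : ℝ} (hS : 0 < S) {F : PowerSeries K} {φ : K → K}
    (h : HasExp S F φ) : HasDerivAt φ (PowerSeries.coeff 1 F) 0 := by
  obtain ⟨ψ, hψ, he⟩ := h.shift 1
  rw [hasDerivAt_iff_tendsto_slope]
  have h1 : Tendsto ψ (𝓝[≠] 0) (𝓝 (PowerSeries.coeff 1 F)) := by
    have := (An.continuousAt ⟨_, hψ⟩ (w := 0) (by simpa using hS)).tendsto
    rw [hψ.zero_eq hS, coeff_shiftSeries, zero_add] at this
    exact this.mono_left nhdsWithin_le_nhds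
  refine h1.congr' ?_
  have hmem : {z : K | ‖z‖ < S} ∈ 𝓝[≠] (0 : K) :=
    nhdsWithin_le_nhds ((isOpen_lt continuous_norm continuous_const).mem_nhds (by simpa using hS))
  filter_upwards [hmem, self_mem_nhdsWithin] with z hz hz0
  have hz0 : z ≠ 0 := hz0
  rw [slope_def_field, h.zero_eq hS, he z hz]
  simp [hz0]

theorem An.differentiableAt {S : ℝ} {φ : K → K} (hφ : An S φ) {w : K} (hw : ‖w‖ < S) :
    DifferentiableAt K φ w := by
  obtain ⟨F, hF⟩ := hφ.translate hw
  have h := hF.hasDerivAt_zero ((norm_nonneg _).trans_lt hw)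
  have h' : HasDerivAt (fun z => φ (z + w)) (PowerSeries.coeff 1 F) (w - w) := by
    rwa [sub_self]
  simpa using (HasDerivAt.comp_sub_const w w h').differentiableAt

theorem An.norm_deriv_le {S : ℝ} {φ : K → K} (hφ : An S φ) {C : ℝ}
    (hC : ∀ z, ‖z‖ < S → ‖φ z‖ ≤ C) {w : K} (hw : ‖w‖ < S) : ‖deriv φ w‖ ≤ C / S := by
  have hS := (norm_nonneg w).trans_lt hw
  have h := (hφ.differentiableAt hw).hasDerivAt
  rw [hasDerivAt_iff_tendsto_slope] at h
  refine le_of_tendsto h.norm ?_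
  have hmem : {z : K | ‖z‖ < S} ∈ 𝓝[≠] w :=
    nhdsWithin_le_nhds ((isOpen_lt continuous_norm continuous_const).mem_nhds hw)
  filter_upwards [hmem, self_mem_nhdsWithin] with z hz hz0
  have hz0 : z ≠ w := hz0
  rw [slope_def_field, norm_div, div_le_iff₀ (norm_pos_iff.2 (sub_ne_zero.2 hz0))]
  exact hφ.lipschitz hC hz hw

theorem HasExp.deriv {S : ℝ} {F : PowerSeries K} {φ : K → K} (h : HasExp S F φ) :
    HasExp S (PowerSeries.derivative K F) (deriv φ) := by
  have hc : ∀ r : ℝ, 0 < r → r < S → Tendsto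
      (fun n : ℕ => ‖PowerSeries.coeff n (PowerSeries.derivative K F)‖ * r ^ n) atTop (𝓝 0) := by
    intro r h0 h1
    have := ((tendsto_add_atTop_iff_nat 1).2 (h.conv r h0 h1)).div_const r
    rw [zero_div] at this
    refine squeeze_zero (fun _ => by positivity) (fun n => ?_) this
    rw [PowerSeries.coeff_derivative, norm_mul, pow_succ, ← mul_assoc, mul_div_cancel_right₀ _ h0.ne']
    have hn : ‖((n : K) + 1)‖ ≤ 1 := by exact_mod_cast IsUltrametricDist.norm_natCast_le_one K (n + 1)
    calc _ ≤ ‖PowerSeries.coeff (n + 1) F‖ * 1 * r ^ n := by gcongr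
      _ = _ := by ring
  refine (hasSum_of_conv hc).congr fun z hz => ?_
  obtain ⟨r, hr1, hr2⟩ := exists_between hz
  have hr0 := (norm_nonneg z).trans_lt hr1
  have h1 := ((hasSum_of_conv hc).hasSum z hz).tendsto_sum_nat
  refine tendsto_nhds_unique h1 ?_
  rw [Metric.tendsto_atTop]
  intro ε hε
  obtain ⟨N, hN⟩ := eventually_atTop.1 ((h.conv r hr0 hr2).eventually_lt_const
    (show 0 < ε * r / 2 by positivity))
  refine ⟨N, fun n hn => ?_⟩
  set P : K[X] := PowerSeries.trunc (n + 1) F with hP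
  have hPcoef : ∀ i, P.coeff i = if i < n + 1 then PowerSeries.coeff i F else 0 := fun i => by
    rw [hP, PowerSeries.coeff_trunc]
  have hPdeg : P.natDegree < n + 1 := by
    rw [hP]; exact PowerSeries.natDegree_trunc_lt F n
  have hd : ∑ i ∈ Finset.range n, PowerSeries.coeff i (PowerSeries.derivative K F) * z ^ i =
      P.derivative.eval z := by
    have hdeg : P.derivative.natDegree < n + 1 := by
      exact lt_of_le_of_lt ((Polynomial.natDegree_derivative_le P).trans (Nat.sub_le _ _)) hPdeg
    rw [Polynomial.eval_eq_sum_range' hdeg, Finset.sum_range_succ, Polynomial.coeff_derivative,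
      hPcoef]
    simp only [lt_self_iff_false, if_false, zero_mul, add_zero]
    refine Finset.sum_congr rfl fun i hi => ?_
    rw [Polynomial.coeff_derivative, PowerSeries.coeff_derivative, hPcoef, if_pos]
    have := Finset.mem_range.1 hi; omega
  -- The remainder after truncation is uniformly small on the disk of radius `r`. By the Lipschitz
  -- bound its derivative is small too, so the derivatives of the truncations converge to that of
  -- `φ`.
  have hsub : HasExp r (F - (P : PowerSeries K)) (fun z => φ z - P.eval z) :=
    (h.mono hr2.le).sub (HasExp.polynomial r P)
  have hbd : ∀ w, ‖w‖ < r → ‖φ w - P.eval w‖ ≤ ε * r / 2 := by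
    intro w hw
    refine hsub.norm_le hw fun i => ?_
    rw [map_sub, Polynomial.coeff_coe, hPcoef]
    split_ifs with hi
    · simp; positivity
    · rw [sub_zero]
      refine le_trans ?_ (hN i (by omega)).le
      gcongr
  have hder := An.norm_deriv_le ⟨_, hsub⟩ hbd hr1
  rw [deriv_fun_sub (An.differentiableAt ⟨F, h⟩ hz) P.differentiable.differentiableAt,
    Polynomial.deriv] at hder
  rw [dist_comm, dist_eq_norm, hd]
  refine hder.trans_lt ?_
  rw [div_lt_iff₀ hr0]
  nlinarith [mul_pos hε hr0]

theorem An.deriv {S : ℝ} {φ : K → K} (h : An S φ) : An S (deriv φ) :=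
  let ⟨_, hF⟩ := h; ⟨_, hF.deriv⟩

end Calculus

/-! ### Zeros of power series and Weierstrass factorization. -/

section Zeros

variable {K : Type*} [NontriviallyNormedField K] [IsUltrametricDist K]
  [IsAlgClosed K] [CharZero K] [CompleteSpace K]

theorem norm_sum_lt {ι : Type*} {s : Finset ι} {f : ι → K} {C : ℝ} (hC : 0 < C)
    (h : ∀ i ∈ s, ‖f i‖ < C) : ‖∑ i ∈ s, f i‖ < C := by
  rcases s.eq_empty_or_nonempty with rfl | hs
  · simpa using hC
  · obtain ⟨i, hi, hle⟩ := IsUltrametricDist.exists_norm_finsetSum_le_of_nonempty hs f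
    exact hle.trans_lt (h i hi)

/-- A polynomial whose constant term does not strictly dominate at radius `t` has a root in the
closed disk of radius `t`. -/
theorem exists_root_norm_le (P : K[X]) {t : ℝ} (ht : 0 ≤ t) {n : ℕ} (hn : n ≠ 0)
    (h : ‖P.coeff 0‖ ≤ ‖P.coeff n‖ * t ^ n) : ∃ ξ, P.eval ξ = 0 ∧ ‖ξ‖ ≤ t := by
  by_contra! hcon
  have hP0 : P ≠ 0 := by
    rintro rfl
    exact absurd (hcon 0 (by simp)) (by simpa using ht)
  -- `Dom Q` says that the constant term strictly dominates at radius `t`. It holds for `X - a` with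
  -- `‖a‖ > t` and is stable under products, so it would hold for `P` if all roots lay outside the
  -- closed disk.
  let Dom : K[X] → Prop := fun Q => Q.coeff 0 ≠ 0 ∧
    ∀ n, n ≠ 0 → ‖Q.coeff n‖ * t ^ n < ‖Q.coeff 0‖
  have hmul : ∀ A B, Dom A → Dom B → Dom (A * B) := by
    rintro A B ⟨hA0, hA⟩ ⟨hB0, hB⟩
    refine ⟨by rw [mul_coeff_zero]; exact mul_ne_zero hA0 hB0, fun n hn => ?_⟩
    have hA' : 0 < ‖A.coeff 0‖ := norm_pos_iff.2 hA0
    have hB' : 0 < ‖B.coeff 0‖ := norm_pos_iff.2 hB0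
    have hle : ∀ i, ‖A.coeff i‖ * t ^ i ≤ ‖A.coeff 0‖ := fun i => by
      rcases eq_or_ne i 0 with rfl | hi
      · simp
      · exact (hA i hi).le
    have hle' : ∀ i, ‖B.coeff i‖ * t ^ i ≤ ‖B.coeff 0‖ := fun i => by
      rcases eq_or_ne i 0 with rfl | hi
      · simp
      · exact (hB i hi).le
    rw [mul_coeff_zero, norm_mul, coeff_mul]
    obtain ⟨x, hx, hxle⟩ := IsUltrametricDist.exists_norm_finsetSum_le_of_nonempty
      (t := Finset.HasAntidiagonal.antidiagonal n) (M := K)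
      ⟨(0, n), by simp⟩ (fun x => A.coeff x.1 * B.coeff x.2)
    have hx' := Finset.HasAntidiagonal.mem_antidiagonal.1 hx
    calc _ ≤ ‖A.coeff x.1 * B.coeff x.2‖ * t ^ n := by gcongr
      _ = (‖A.coeff x.1‖ * t ^ x.1) * (‖B.coeff x.2‖ * t ^ x.2) := by
        rw [norm_mul, ← hx', pow_add]; ring
      _ < ‖A.coeff 0‖ * ‖B.coeff 0‖ := by
        rcases eq_or_ne x.1 0 with h1 | h1
        · have h2 : x.2 ≠ 0 := by omega
          rw [h1]
          simp only [pow_zero, mul_one]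
          exact mul_lt_mul_of_pos_left (hB _ h2) hA'
        · exact mul_lt_mul_of_lt_of_le_of_nonneg_of_pos (hA _ h1) (hle' _) (by positivity) hB'
  have hC : ∀ a : K, a ≠ 0 → Dom (C a) := fun a ha =>
    ⟨by simpa using ha, fun n hn => by simpa [coeff_C, hn] using ha⟩
  have hX : ∀ a ∈ P.roots, Dom (X - C a) := by
    intro a ha
    have hta := hcon a ((mem_roots hP0).1 ha)
    have ha0 : a ≠ 0 := by rintro rfl; simp at hta; linarith
    refine ⟨by simpa using ha0, fun n hn => ?_⟩
    rcases eq_or_ne n 1 with rfl | h1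
    · simpa using hta
    · simpa [coeff_X, coeff_C, hn, h1.symm] using ha0
  have hprod : Dom (P.roots.map fun a => X - C a).prod := by
    refine Multiset.prod_induction Dom _ hmul ?_ ?_
    · simpa using hC 1 one_ne_zero
    · intro q hq
      obtain ⟨a, ha, rfl⟩ := Multiset.mem_map.1 hq
      exact hX a ha
  have hDom : Dom P := by
    rw [(IsAlgClosed.splits P).eq_prod_roots]
    exact hmul _ _ (hC _ (leadingCoeff_ne_zero.2 hP0)) hprod
  exact absurd h (not_le.2 (hDom.2 n hn))

/-- The `n`-th Taylor coefficient involves only the coefficients of index at least `n`, multiplied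
by binomial coefficients, which have norm at most 1, and by powers of `x`. -/
theorem norm_taylor_coeff_lt (P : K[X]) {x : K} {r B : ℝ} (hr : 0 < r) (hx : ‖x‖ ≤ r) (hB : 0 < B)
    {n : ℕ} (h : ∀ j, n ≤ j → ‖P.coeff j‖ * r ^ j < B) :
    ‖(taylor x P).coeff n‖ * r ^ n < B := by
  rw [taylor_coeff, eval_eq_sum_range, ← lt_div_iff₀ (by positivity)]
  refine norm_sum_lt (by positivity) fun i _ => ?_
  rw [hasseDeriv_coeff, lt_div_iff₀ (by positivity), norm_mul, norm_mul, norm_pow]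
  have h1 : ‖(((i + n).choose n : ℕ) : K)‖ ≤ 1 := IsUltrametricDist.norm_natCast_le_one K _
  refine lt_of_le_of_lt ?_ (h (i + n) (Nat.le_add_left _ _))
  calc _ ≤ 1 * ‖P.coeff (i + n)‖ * r ^ i * r ^ n := by gcongr
    _ = _ := by rw [pow_add]; ring

/-- If `M = ‖b_e‖ r^e` is the Gauss norm of `P` at radius `r` and the coefficients after the `E`-th
are strictly smaller, then near a point where `P` is small there is a root of `P`. -/
theorem exists_root_near (P : K[X]) {r M t : ℝ} {e E : ℕ} (hr : 0 < r) (hM : 0 < M)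
    (he : M ≤ ‖P.coeff e‖ * r ^ e)
    (hE : ∀ j, E < j → ‖P.coeff j‖ * r ^ j < M) {x : K} (hx : ‖x‖ ≤ r) (ht : 0 ≤ t) (htr : t ≤ r)
    (hPM : ‖P.eval x‖ < M) (hPx : ‖P.eval x‖ ≤ M * (t / r) ^ E) :
    ∃ ξ, P.eval ξ = 0 ∧ ‖ξ - x‖ ≤ t := by
  have hQ0 : (taylor x P).coeff 0 = P.eval x := taylor_coeff_zero x P
  -- If every Taylor coefficient at `x` were below `M` at radius `r`, translating back by `-x` would
  -- put every coefficient of `P` below `M`, contrary to `he`.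
  obtain ⟨n, hn⟩ : ∃ n, M ≤ ‖(taylor x P).coeff n‖ * r ^ n := by
    by_contra! hcon
    have := norm_taylor_coeff_lt (taylor x P) (x := -x) (n := e) hr (by simpa using hx) hM
      fun j _ => hcon j
    rw [taylor_taylor, neg_add_cancel, taylor_zero] at this
    exact absurd he (not_le.2 this)
  have hn0 : n ≠ 0 := by
    rintro rfl
    rw [hQ0, pow_zero, mul_one] at hn
    exact absurd hPM (not_lt.2 hn)
  have hnE : n ≤ E := by
    by_contra! hlt
    exact absurd hn (not_le.2 (norm_taylor_coeff_lt P hr hx hM fun j hj => hE j (hlt.trans_le hj)))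
  obtain ⟨ζ, hζ, hζt⟩ := exists_root_norm_le (taylor x P) ht hn0 (by
    rw [hQ0]
    calc ‖P.eval x‖ ≤ M * (t / r) ^ E := hPx
      _ ≤ (‖(taylor x P).coeff n‖ * r ^ n) * (t / r) ^ n := by
        refine mul_le_mul hn ?_ (by positivity) (by positivity)
        exact pow_le_pow_of_le_one (by positivity) ((div_le_one hr).2 htr) hnE
      _ = _ := by rw [div_pow]; field_simp)
  refine ⟨ζ + x, ?_, by simpa using hζt⟩
  rwa [taylor_eval] at hζ

/-- A sequence of reals that converges to zero and has a positive term has a last index at which it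
attains its maximum. -/
theorem exists_last_argmax {g : ℕ → ℝ} (hg : Tendsto g atTop (𝓝 0)) {m : ℕ} (hm : 0 < g m) :
    ∃ e, 0 < g e ∧ (∀ n, g n ≤ g e) ∧ ∀ n, e < n → g n < g e := by
  obtain ⟨N, hN⟩ := eventually_atTop.1 (hg.eventually_lt_const hm)
  have hmN : m < N := by
    by_contra h
    exact lt_irrefl _ (hN m (not_lt.1 h))
  obtain ⟨e₀, _, he₀⟩ := Finset.exists_max_image (Finset.range N) g ⟨m, Finset.mem_range.2 hmN⟩
  have hmax : ∀ n, g n ≤ g e₀ := by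
    intro n
    rcases lt_or_ge n N with h | h
    · exact he₀ n (Finset.mem_range.2 h)
    · exact (hN n h).le.trans (he₀ m (Finset.mem_range.2 hmN))
  have hlt : ∀ n, N ≤ n → g n < g e₀ := fun n h =>
    (hN n h).trans_le (he₀ m (Finset.mem_range.2 hmN))
  have hne : ((Finset.range N).filter fun n => g n = g e₀).Nonempty :=
    ⟨e₀, by simpa using not_le.1 fun h => lt_irrefl _ (hlt e₀ h)⟩
  obtain ⟨e, he, hee⟩ := Finset.exists_max_image _ id hne
  have hge : g e = g e₀ := (Finset.mem_filter.1 he).2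
  refine ⟨e, hge ▸ hm.trans_le (hmax m), fun n => hge ▸ hmax n, fun n hn => ?_⟩
  rw [hge]
  refine lt_of_le_of_ne (hmax n) fun heq => ?_
  have hnN : n < N := not_le.1 fun h => (hlt n h).ne heq
  have := hee n (Finset.mem_filter.2 ⟨Finset.mem_range.2 hnN, heq⟩)
  simp only [id] at this
  omega

/-- A convergent power series whose constant term does not strictly dominate at radius `r` has a
zero in the closed disk of radius `r`. -/
theorem HasExp.exists_zero {S r : ℝ} {F : PowerSeries K} {φ : K → K} (h : HasExp S F φ)
    (hr0 : 0 < r) (hr : r < S) {m : ℕ} (hm : m ≠ 0)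
    (hle : ‖PowerSeries.coeff 0 F‖ ≤ ‖PowerSeries.coeff m F‖ * r ^ m) :
    ∃ z, ‖z‖ ≤ r ∧ φ z = 0 := by
  by_cases hb0 : PowerSeries.coeff 0 F = 0
  · exact ⟨0, by simpa using hr0.le, by rw [h.zero_eq (hr0.trans hr), hb0]⟩
  set g : ℕ → ℝ := fun n => ‖PowerSeries.coeff n F‖ * r ^ n with hg
  have hg0 : Tendsto g atTop (𝓝 0) := h.conv r hr0 hr
  have hgm : 0 < g m := (norm_pos_iff.2 hb0).trans_le hle
  obtain ⟨E, hM, hmax, hlt⟩ := exists_last_argmax hg0 hgm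
  have hE0 : E ≠ 0 := by
    rintro rfl
    have := hlt m (Nat.pos_of_ne_zero hm)
    simp only [hg, pow_zero, mul_one] at this
    exact absurd hle (not_le.2 this)
  set M := g E with hMdef
  -- `P k` keeps the terms of index up to `E + k`, hence always the dominant one. The zero of `φ` is
  -- the limit of a sequence in which each root of `P k` is followed by a nearby root of `P (k +
  -- 1)`.
  let P : ℕ → K[X] := fun k => PowerSeries.trunc (E + k + 1) F
  have hPc : ∀ k i, (P k).coeff i = if i < E + k + 1 then PowerSeries.coeff i F else 0 :=
    fun k i => PowerSeries.coeff_trunc _ _ _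
  have hPle : ∀ k j, E < j → ‖(P k).coeff j‖ * r ^ j < M := by
    intro k j hj
    rw [hPc]
    split_ifs
    · exact hlt j hj
    · simpa using hM
  have hPE : ∀ k, M ≤ ‖(P k).coeff E‖ * r ^ E := by
    intro k
    rw [hPc, if_pos (by omega)]
  have hPsucc : ∀ k x, (P (k + 1)).eval x =
      (P k).eval x + PowerSeries.coeff (E + k + 1) F * x ^ (E + k + 1) := by
    intro k x
    simp only [P]
    rw [show E + (k + 1) + 1 = (E + k + 1) + 1 by ring, PowerSeries.trunc_succ]
    simp
  have hdiff : ∀ k x, ‖x‖ ≤ r → ∀ ε, 0 ≤ ε → (∀ n, E + k < n → g n ≤ ε) →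
      ‖φ x - (P k).eval x‖ ≤ ε := by
    intro k x hx ε hε0 hε
    refine (h.sub (HasExp.polynomial S (P k))).norm_le (hx.trans_lt hr) fun n => ?_
    rw [map_sub, Polynomial.coeff_coe, hPc]
    split_ifs with hn
    · simpa using hε0
    · rw [sub_zero]
      refine le_trans ?_ (hε n (by omega))
      simp only [hg]
      gcongr
  have hP0 : ‖(P 0).coeff 0‖ ≤ ‖(P 0).coeff E‖ * r ^ E := by
    refine le_trans (le_of_eq_of_le ?_ (hmax 0)) (hPE 0)
    have := hPc 0 0
    rw [if_pos (by omega)] at this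
    simp only [hg, pow_zero, mul_one]
    rw [← this]
  -- This solves `M * (t k / r) ^ E = g (E + k + 1)`. The right-hand side bounds `P (k + 1)` at a
  -- root of `P k`, so `exists_root_near` finds the next root within `t k`.
  let t : ℕ → ℝ := fun k => r * (g (E + k + 1) / M) ^ ((E : ℝ)⁻¹)
  have hgnn : ∀ n, 0 ≤ g n := fun n => by simp only [hg]; positivity
  have hstep : ∀ k, ∀ x : {x : K // (P k).eval x = 0 ∧ ‖x‖ ≤ r},
      ∃ y : {x : K // (P (k + 1)).eval x = 0 ∧ ‖x‖ ≤ r}, ‖(y : K) - x‖ ≤ t k := by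
    rintro k ⟨x, hx, hxr⟩
    have hq0 : 0 ≤ g (E + k + 1) / M := div_nonneg (hgnn _) hM.le
    have hq1 : g (E + k + 1) / M ≤ 1 := (div_le_one hM).2 (hmax _)
    have ht0 : 0 ≤ t k := mul_nonneg hr0.le (Real.rpow_nonneg hq0 _)
    have htr : t k ≤ r := by
      have := Real.rpow_le_one hq0 hq1 (inv_nonneg.2 (Nat.cast_nonneg E))
      calc t k ≤ r * 1 := by simp only [t]; gcongr
        _ = r := mul_one r
    have hval : ‖(P (k + 1)).eval x‖ ≤ g (E + k + 1) := by
      rw [hPsucc, hx, zero_add, norm_mul, norm_pow]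
      simp only [hg]; gcongr
    have htE : M * (t k / r) ^ E = g (E + k + 1) := by
      simp only [t]
      rw [mul_div_cancel_left₀ _ hr0.ne', ← Real.rpow_natCast, ← Real.rpow_mul hq0,
        inv_mul_cancel₀ (by exact_mod_cast hE0), Real.rpow_one]
      field_simp
    obtain ⟨y, hy, hyx⟩ := exists_root_near (P (k + 1)) hr0 hM (hPE _) (hPle _) hxr ht0 htr
      (hval.trans_lt (hlt _ (by omega))) (htE ▸ hval)
    refine ⟨⟨y, hy, ?_⟩, hyx⟩
    have := norm_add_le_of_le' (hyx.trans htr) hxr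
    simpa using this
  choose next hnext using hstep
  obtain ⟨x₀, hx₀, hx₀r⟩ := exists_root_norm_le (P 0) hr0.le hE0 hP0
  let y : ∀ k, {x : K // (P k).eval x = 0 ∧ ‖x‖ ≤ r} := fun k =>
    Nat.rec (motive := fun k => {x : K // (P k).eval x = 0 ∧ ‖x‖ ≤ r}) ⟨x₀, hx₀, hx₀r⟩
      (fun k y => next k y) k
  have hxs : ∀ k, ‖(y (k + 1)).1 - (y k).1‖ ≤ t k := fun k => hnext k (y k)
  obtain ⟨x, hx⟩ : ∃ x : ℕ → K, ∀ k, (P k).eval (x k) = 0 ∧ ‖x k‖ ≤ r ∧ ‖x (k + 1) - x k‖ ≤ t k :=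
    ⟨fun k => (y k).1, fun k => ⟨(y k).2.1, (y k).2.2, hxs k⟩⟩
  have ht : Tendsto t atTop (𝓝 0) := by
    have h1 : Tendsto (fun k => g (E + k + 1) / M) atTop (𝓝 0) := by
      have := ((tendsto_add_atTop_iff_nat (E + 1)).2 hg0).div_const M
      rw [zero_div] at this
      refine this.congr fun k => ?_
      rw [show k + (E + 1) = E + k + 1 by ring]
    have hE' : (0 : ℝ) < (E : ℝ)⁻¹ := inv_pos.2 (by exact_mod_cast Nat.pos_of_ne_zero hE0)
    have h2 := (h1.rpow_const (p := (E : ℝ)⁻¹) (Or.inr hE'.le)).const_mul r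
    rwa [Real.zero_rpow hE'.ne', mul_zero] at h2
  have hcau : CauchySeq x := by
    refine NonarchimedeanAddGroup.cauchySeq_of_tendsto_sub_nhds_zero ?_
    exact squeeze_zero_norm (fun k => (hx k).2.2) ht
  obtain ⟨z, hz⟩ := cauchySeq_tendsto_of_complete hcau
  have hzr : ‖z‖ ≤ r := le_of_tendsto hz.norm (Eventually.of_forall fun k => (hx k).2.1)
  refine ⟨z, hzr, ?_⟩
  have hφ : Tendsto (fun k => φ (x k)) atTop (𝓝 (φ z)) :=
    (An.continuousAt ⟨F, h⟩ (hzr.trans_lt hr)).tendsto.comp hz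
  refine tendsto_nhds_unique hφ ?_
  rw [tendsto_zero_iff_norm_tendsto_zero, Metric.tendsto_atTop]
  intro ε hε
  obtain ⟨N, hN⟩ := eventually_atTop.1 (hg0.eventually_lt_const (half_pos hε))
  refine ⟨N, fun k hk => ?_⟩
  have := hdiff k (x k) (hx k).2.1 (ε / 2) (half_pos hε).le fun n hn => (hN n (by omega)).le
  rw [(hx k).1, sub_zero] at this
  rw [Real.dist_eq, sub_zero, abs_of_nonneg (norm_nonneg _)]
  linarith

/-- Nonvanishing analytic functions on a closed disk are dominated by their constant term. -/
theorem HasExp.coeff_lt_of_ne_zero {S r : ℝ} {F : PowerSeries K} {φ : K → K} (h : HasExp S F φ)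
    (hr0 : 0 < r) (hr : r < S) (hne : ∀ z, ‖z‖ ≤ r → φ z ≠ 0) {n : ℕ} (hn : n ≠ 0) :
    ‖PowerSeries.coeff n F‖ * r ^ n < ‖PowerSeries.coeff 0 F‖ := by
  by_contra! hcon
  obtain ⟨z, hz, h0⟩ := h.exists_zero hr0 hr hn hcon
  exact hne z hz h0

/-- Without zeros the constant term strictly dominates all others, and the ultrametric inequality
leaves the norm no freedom. -/
theorem An.norm_eq_of_ne_zero {S r : ℝ} {φ : K → K} (h : An S φ)
    (hr0 : 0 < r) (hr : r < S) (hne : ∀ z, ‖z‖ ≤ r → φ z ≠ 0) {z : K} (hz : ‖z‖ ≤ r) :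
    ‖φ z‖ = ‖φ 0‖ := by
  obtain ⟨F, hF⟩ := h
  set g : ℕ → ℝ := fun n => ‖PowerSeries.coeff (n + 1) F‖ * r ^ (n + 1) with hg
  have hS := hr0.trans hr
  have h0 : 0 < ‖PowerSeries.coeff 0 F‖ := by
    rw [norm_pos_iff, ← hF.zero_eq hS]
    exact hne 0 (by simpa using hr0.le)
  -- A uniform gap is needed for an infinite sum. It exists because the terms tend to zero, so that
  -- the largest non-constant one is attained.
  have hbd : ∃ B, B < ‖PowerSeries.coeff 0 F‖ ∧ ∀ n, g n ≤ B := by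
    have hlim : Tendsto g atTop (𝓝 0) := (tendsto_add_atTop_iff_nat 1).2 (hF.conv r hr0 hr)
    by_cases hpos : ∃ m, 0 < g m
    · obtain ⟨m, hm⟩ := hpos
      obtain ⟨e, -, he, -⟩ := exists_last_argmax hlim hm
      exact ⟨g e, hF.coeff_lt_of_ne_zero hr0 hr hne (Nat.succ_ne_zero e), he⟩
    · push Not at hpos
      exact ⟨0, h0, hpos⟩
  obtain ⟨B, hB, hgB⟩ := hbd
  obtain ⟨ψ, hψ, he⟩ := hF.shift 1
  have hle : ‖φ z - φ 0‖ ≤ B := by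
    have hs := (hasSum_nat_add_iff' 1).2 (hF.hasSum z (hz.trans_lt hr))
    have h2 := norm_hasSum_le (C := B) hs fun n => by
      rw [norm_mul, norm_pow]
      refine le_trans ?_ (hgB n)
      simp only [hg]; gcongr
    simpa [hF.zero_eq hS] using h2
  refine norm_eq_of_norm_sub_lt ?_
  rw [norm_sub_rev, hF.zero_eq hS]
  rw [hF.zero_eq hS] at hle
  exact hle.trans_lt hB

/-- The reciprocal of a nonvanishing analytic function is analytic. -/
theorem An.inv {S : ℝ} (hS : 0 < S) {φ : K → K} (h : An S φ) (hne : ∀ z, ‖z‖ < S → φ z ≠ 0) :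
    An S (fun z => (φ z)⁻¹) := by
  refine An.of_forall_lt hS fun r hr0 hr => ?_
  obtain ⟨r', hr1, hr2⟩ := exists_between hr
  have hr0' := hr0.trans hr1
  have h0 : φ 0 ≠ 0 := hne 0 (by simpa using hS)
  have hA : An r' (fun z => 1 - φ z / φ 0) := by
    have := (An.const r' (1 : K)).sub ((h.mono hr2.le).mul (An.const r' (φ 0)⁻¹))
    simpa [div_eq_mul_inv] using this
  have hnorm : ∀ z, ‖z‖ < r' → ‖φ z‖ = ‖φ 0‖ := fun z hz =>
    h.norm_eq_of_ne_zero hr0' hr2 (fun w hw => hne w (hw.trans_lt hr2)) hz.le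
  have hle : ∀ z, ‖z‖ < r' → ‖1 - φ z / φ 0‖ ≤ 1 := fun z hz =>
    norm_sub_le_of_le (by simp) (by rw [norm_div, hnorm z hz, div_self (norm_ne_zero_iff.2 h0)])
  set q : ℝ := r / r' with hq
  have hq0 : 0 ≤ q := by positivity
  have hq1 : q < 1 := (div_lt_one hr0').2 hr1
  -- On the disk of radius `r'` the function `1 - φ / φ 0` is only known to be bounded by 1. It
  -- vanishes at 0, so the Schwarz lemma gives `q < 1` on the smaller disk, where the geometric
  -- series converges uniformly.
  have hsmall : ∀ z, ‖z‖ < r → ‖1 - φ z / φ 0‖ ≤ q := by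
    intro z hz
    have := hA.lipschitz hle (hz.trans hr1) (w := 0) (by simpa using hr0')
    rw [div_self h0, sub_self, sub_zero, sub_zero] at this
    refine this.trans ?_
    rw [hq, div_mul_eq_mul_div, one_mul]
    gcongr
  refine An.of_hasSum hr0 (a := fun n z => (φ 0)⁻¹ * (1 - φ z / φ 0) ^ n)
    (B := fun n => ‖(φ 0)⁻¹‖ * q ^ n) (fun n => (An.const r _).mul ((hA.mono hr1.le).pow n)) ?_ ?_ ?_
  · simpa using (tendsto_pow_atTop_nhds_zero_of_lt_one hq0 hq1).const_mul ‖(φ 0)⁻¹‖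
  · intro n z hz
    rw [norm_mul, norm_pow]
    have := hsmall z hz
    gcongr
  · intro z hz
    have h1 := (hasSum_geometric_of_norm_lt_one ((hsmall z hz).trans_lt hq1)).mul_left (φ 0)⁻¹
    have h2 : (φ 0)⁻¹ * (1 - (1 - φ z / φ 0))⁻¹ = (φ z)⁻¹ := by
      have := hne z (hz.trans hr)
      rw [sub_sub_cancel]; field_simp
    rwa [h2] at h1

theorem An.div {S : ℝ} (hS : 0 < S) {φ ψ : K → K} (h : An S φ) (h' : An S ψ)
    (hne : ∀ z, ‖z‖ < S → ψ z ≠ 0) : An S (fun z => φ z / ψ z) := by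
  simpa [div_eq_mul_inv] using h.mul (h'.inv hS hne)

/-- Division by a linear factor. -/
theorem An.exists_factor {S : ℝ} {φ : K → K} (h : An S φ) {w : K} (hw : ‖w‖ < S) :
    ∃ ψ, An S ψ ∧ ∀ z, ‖z‖ < S → φ z = φ w + (z - w) * ψ z := by
  have hS := (norm_nonneg w).trans_lt hw
  obtain ⟨F, hF⟩ := h.translate hw
  obtain ⟨ψ, hψ, he⟩ := hF.shift 1
  refine ⟨_, An.translate ⟨_, hψ⟩ (w := -w) (by simpa using hw), fun z hz => ?_⟩
  have h1 := he (z + -w) (norm_add_lt_of_lt' hz (by simpa using hw))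
  have h2 := hF.zero_eq hS
  simp only [zero_add] at h2
  simpa [h2, sub_eq_add_neg] using h1

/-- Weierstrass factorization on the closed disk of radius `r`. -/
theorem HasExp.exists_factorization {S r : ℝ} (hr0 : 0 < r) (hr : r < S) {F : PowerSeries K}
    {φ : K → K} (h : HasExp S F φ) (hF : F ≠ 0) :
    ∃ (T : Multiset K) (u : K → K), An S u ∧ (∀ w ∈ T, ‖w‖ ≤ r) ∧ (∀ z, ‖z‖ ≤ r → u z ≠ 0) ∧
      ∀ z, ‖z‖ < S → φ z = (T.map fun w => z - w).prod * u z := by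
  have hS := hr0.trans hr
  have hexists : ∀ {F : PowerSeries K} {φ : K → K}, HasExp S F φ → F ≠ 0 →
      ∃ e, 0 < ‖PowerSeries.coeff e F‖ * r ^ e ∧
        (∀ n, ‖PowerSeries.coeff n F‖ * r ^ n ≤ ‖PowerSeries.coeff e F‖ * r ^ e) ∧
        ∀ n, e < n → ‖PowerSeries.coeff n F‖ * r ^ n < ‖PowerSeries.coeff e F‖ * r ^ e := by
    intro F φ h hF
    obtain ⟨m, hm⟩ := (PowerSeries.exists_coeff_ne_zero_iff_ne_zero).2 hF
    exact exists_last_argmax (g := fun n => ‖PowerSeries.coeff n F‖ * r ^ n) (h.conv r hr0 hr)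
      (m := m) (mul_pos (norm_pos_iff.2 hm) (pow_pos hr0 m))
  -- The last index `E` at which `‖F_n‖ * r ^ n` is maximal counts the zeros in the closed disk.
  -- Dividing by a linear factor with root in the disk lowers it by exactly one, which drives the
  -- induction on `E`.
  have hdiv : ∀ {F : PowerSeries K} {φ : K → K} {w : K}, HasExp S F φ → F ≠ 0 → ‖w‖ ≤ r →
      φ w = 0 → ∀ {E : ℕ}, (∀ n, ‖PowerSeries.coeff n F‖ * r ^ n ≤ ‖PowerSeries.coeff E F‖ * r ^ E) →
        (∀ n, E < n → ‖PowerSeries.coeff n F‖ * r ^ n < ‖PowerSeries.coeff E F‖ * r ^ E) →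
      ∃ (E' : ℕ) (G : PowerSeries K) (ψ : K → K), E = E' + 1 ∧ HasExp S G ψ ∧ G ≠ 0 ∧
        (∀ n, ‖PowerSeries.coeff n G‖ * r ^ n ≤ ‖PowerSeries.coeff E' G‖ * r ^ E') ∧
        (∀ n, E' < n → ‖PowerSeries.coeff n G‖ * r ^ n < ‖PowerSeries.coeff E' G‖ * r ^ E') ∧
        ∀ z, ‖z‖ < S → φ z = (z - w) * ψ z := by
    intro F φ w h hF hw h0 E hE1 hE2
    obtain ⟨ψ, ⟨G, hG⟩, he⟩ := An.exists_factor ⟨F, h⟩ (hw.trans_lt hr)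
    have hFG : F = (PowerSeries.X - PowerSeries.C w) * G := by
      have h1 : HasExp S (PowerSeries.X - PowerSeries.C w : PowerSeries K) (fun z => z - w) := by
        have h2 := HasExp.polynomial S (X - C w : K[X])
        rw [Polynomial.coe_sub, Polynomial.coe_X, Polynomial.coe_C] at h2
        exact h2.congr fun z _ => by simp
      refine h.unique hS ((h1.mul hG).congr fun z hz => ?_)
      rw [he z hz, h0, zero_add]
    have hG0 : G ≠ 0 := by rintro rfl; exact hF (by rw [hFG, mul_zero])
    obtain ⟨e, hepos, he1, he2⟩ := hexists hG hG0
    have hc : ∀ n, PowerSeries.coeff (n + 1) F =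
        PowerSeries.coeff n G - w * PowerSeries.coeff (n + 1) G := by
      intro n
      rw [hFG, sub_mul, map_sub, PowerSeries.coeff_succ_X_mul, PowerSeries.coeff_C_mul]
    have hwG : ∀ n, ‖w * PowerSeries.coeff n G‖ * r ^ n ≤ ‖PowerSeries.coeff n G‖ * r ^ n * r := by
      intro n
      rw [norm_mul]
      calc _ ≤ r * ‖PowerSeries.coeff n G‖ * r ^ n := by gcongr
        _ = _ := by ring
    set m := ‖PowerSeries.coeff e G‖ * r ^ e with hm
    -- Multiplying `G` by `X - w` moves its dominant term from `e` to `e + 1`. Since `e` is the last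
    -- maximum and `‖w‖ ≤ r`, the contribution of `w * G` at `e + 1` is strictly smaller.
    have htop : ‖PowerSeries.coeff (e + 1) F‖ * r ^ (e + 1) = m * r := by
      have hlt : ‖w * PowerSeries.coeff (e + 1) G‖ < ‖PowerSeries.coeff e G‖ := by
        have h1 := (hwG (e + 1)).trans_lt (mul_lt_mul_of_pos_right (he2 (e + 1) (by omega)) hr0)
        rw [hm, mul_assoc, ← pow_succ] at h1
        exact lt_of_mul_lt_mul_right h1 (by positivity)
      rw [hc, sub_eq_add_neg, norm_add_eq_left_of_lt (by rwa [norm_neg]), hm, pow_succ]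
      ring
    have hlater : ∀ n, e + 1 < n → ‖PowerSeries.coeff n F‖ * r ^ n < m * r := by
      intro n hn
      obtain ⟨k, rfl⟩ : ∃ k, n = k + 1 := ⟨n - 1, by omega⟩
      rw [hc]
      have h1 : ‖PowerSeries.coeff k G‖ * r ^ (k + 1) < m * r := by
        rw [pow_succ, ← mul_assoc]
        exact mul_lt_mul_of_pos_right (he2 k (by omega)) hr0
      have h2 : ‖w * PowerSeries.coeff (k + 1) G‖ * r ^ (k + 1) < m * r :=
        (hwG (k + 1)).trans_lt (mul_lt_mul_of_pos_right (he2 (k + 1) (by omega)) hr0)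
      refine lt_of_le_of_lt ?_ (max_lt h1 h2)
      rw [← max_mul_of_nonneg _ _ (by positivity)]
      gcongr
      exact norm_sub_le_max' _ _
    have hEe : E = e + 1 := by
      rcases lt_trichotomy E (e + 1) with hlt | heq | hgt
      · have h1 := hE2 (e + 1) hlt
        rw [htop] at h1
        have h2 : ‖PowerSeries.coeff E F‖ * r ^ E ≤ m * r := by
          rcases E with _ | k
          · rw [hFG, sub_mul, map_sub, PowerSeries.coeff_zero_X_mul, PowerSeries.coeff_C_mul,
              zero_sub, norm_neg]
            refine (hwG 0).trans ?_
            gcongr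
            exact he1 0
          · rw [hc]
            have h1 : ‖PowerSeries.coeff k G‖ * r ^ (k + 1) ≤ m * r := by
              rw [pow_succ, ← mul_assoc]
              exact mul_le_mul_of_nonneg_right (he1 k) hr0.le
            have h2 : ‖w * PowerSeries.coeff (k + 1) G‖ * r ^ (k + 1) ≤ m * r :=
              (hwG (k + 1)).trans (mul_le_mul_of_nonneg_right (he1 (k + 1)) hr0.le)
            refine le_trans ?_ (max_le h1 h2)
            rw [← max_mul_of_nonneg _ _ (by positivity)]
            gcongr
            exact norm_sub_le_max' _ _
        exact absurd h1 (not_lt.2 h2)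
      · exact heq
      · have h1 := hlater E hgt
        have h2 := hE1 (e + 1)
        rw [htop] at h2
        exact absurd h1 (not_lt.2 h2)
    exact ⟨e, G, ψ, hEe, hG, hG0, he1, he2, fun z hz => by rw [he z hz, h0, zero_add]⟩
  obtain ⟨E, -, hE1, hE2⟩ := hexists h hF
  induction E generalizing F φ with
  | zero =>
    refine ⟨0, φ, ⟨F, h⟩, by simp, fun z hz h0 => ?_, by simp⟩
    obtain ⟨_, _, _, h1, -⟩ := hdiv h hF hz h0 hE1 hE2
    omega
  | succ E ih =>
    by_cases hz : ∃ w, ‖w‖ ≤ r ∧ φ w = 0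
    · obtain ⟨w, hw, h0⟩ := hz
      obtain ⟨E', G, ψ, hEE, hG, hG0, h1, h2, he⟩ := hdiv h hF hw h0 hE1 hE2
      obtain rfl : E = E' := by omega
      obtain ⟨T, u, hu, hT, hu0, hfac⟩ := ih hG hG0 h1 h2
      refine ⟨w ::ₘ T, u, hu, ?_, hu0, fun z hz => ?_⟩
      · intro v hv
        rcases Multiset.mem_cons.1 hv with rfl | hv
        · exact hw
        · exact hT v hv
      · rw [he z hz, hfac z hz, Multiset.map_cons, Multiset.prod_cons, mul_assoc]
    · push Not at hz
      exact ⟨0, φ, ⟨F, h⟩, by simp, hz, by simp⟩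

theorem An.exists_factorization {S r : ℝ} (hr0 : 0 < r) (hr : r < S)
    {φ : K → K} (h : An S φ) (hne : ∃ z, ‖z‖ < S ∧ φ z ≠ 0) :
    ∃ (T : Multiset K) (u : K → K), An S u ∧ (∀ w ∈ T, ‖w‖ ≤ r) ∧ (∀ z, ‖z‖ ≤ r → u z ≠ 0) ∧
      ∀ z, ‖z‖ < S → φ z = (T.map fun w => z - w).prod * u z := by
  obtain ⟨F, hF⟩ := h
  refine hF.exists_factorization hr0 hr ?_
  rintro rfl
  obtain ⟨z, hz, h0⟩ := hne
  refine h0 ((hF.hasSum z hz).unique ?_)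
  simp [hasSum_zero]

theorem An.finite_zeros {S r : ℝ} (hr : r < S) {φ : K → K} (h : An S φ)
    (hne : ∃ z, ‖z‖ < S ∧ φ z ≠ 0) : {z | ‖z‖ ≤ r ∧ φ z = 0}.Finite := by
  classical
  obtain ⟨z₀, hz₀, h0⟩ := hne
  have hS := (norm_nonneg z₀).trans_lt hz₀
  obtain ⟨r', hr1, hr2⟩ := exists_between (max_lt hr hS)
  obtain ⟨T, u, hu, hT, hu0, hfac⟩ := h.exists_factorization
    ((le_max_right _ _).trans_lt hr1) hr2 ⟨z₀, hz₀, h0⟩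
  refine T.toFinset.finite_toSet.subset ?_
  rintro z ⟨hz, hz0⟩
  have hzr : ‖z‖ ≤ r' := hz.trans ((le_max_left _ _).trans hr1.le)
  rw [hfac z (hzr.trans_lt hr2)] at hz0
  have := (mul_eq_zero.1 hz0).resolve_right (hu0 z hzr)
  obtain ⟨w, hw, hw0⟩ := Multiset.mem_map.1 (Multiset.prod_eq_zero_iff.1 this)
  rw [sub_eq_zero.1 hw0]
  simpa using hw

/-- The product of two analytic functions vanishes identically only if one of them does. -/
theorem An.mul_eq_zero {S : ℝ} (hS : 0 < S) {φ ψ : K → K} (h : An S φ) (h' : An S ψ)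
    (h0 : ∀ z, ‖z‖ < S → φ z * ψ z = 0) :
    (∀ z, ‖z‖ < S → φ z = 0) ∨ ∀ z, ‖z‖ < S → ψ z = 0 := by
  have aux : ∀ {G : PowerSeries K} {χ : K → K}, HasExp S G χ → G = 0 → ∀ z, ‖z‖ < S → χ z = 0 := by
    rintro G χ hG rfl z hz
    refine (hG.hasSum z hz).unique ?_
    simp [hasSum_zero]
  obtain ⟨F, hF⟩ := h
  obtain ⟨G, hG⟩ := h'
  exact (_root_.mul_eq_zero.1 ((hF.mul hG).eq_zero hS h0)).imp (aux hF) (aux hG)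

end Zeros

/-! ### Logarithmic derivatives and critical points near a superattracting map. -/

section Critical

variable {K : Type*} [NontriviallyNormedField K] [IsUltrametricDist K]
  [IsAlgClosed K] [CharZero K] [CompleteSpace K]

/-- The partial fraction expansion of `P' / P` with denominators cleared. Multiplicities become
residues, which do not vanish in characteristic zero. -/
theorem derivative_prod_mul_radical (Ms : Multiset K) [DecidableEq K] :
    derivative (Ms.map fun w => X - C w).prod * ∏ w ∈ Ms.toFinset, (X - C w) =
      (Ms.map fun w => X - C w).prod *
        ∑ w ∈ Ms.toFinset, C (Ms.count w : K) * ∏ v ∈ Ms.toFinset.erase w, (X - C v) := by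
  rw [Finset.prod_multiset_map_count, derivative_prod_finset, Finset.sum_mul, Finset.mul_sum]
  refine Finset.sum_congr rfl fun w hw => ?_
  obtain ⟨n, hn⟩ : ∃ n, Ms.count w = n + 1 :=
    ⟨Ms.count w - 1, by have := Multiset.count_pos.2 (Multiset.mem_toFinset.1 hw); omega⟩
  rw [← Finset.mul_prod_erase _ _ hw, ← Finset.mul_prod_erase _ (fun w => (X - C w) ^ _) hw, hn,
    derivative_X_sub_C_pow]
  simp only [Nat.add_sub_cancel, Nat.cast_add, Nat.cast_one, map_add, map_natCast, map_one]
  ring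

/-- If all critical points of `G` in a closed disk are zeros of `G`, then the logarithmic
derivative of `G` has simple poles and no zeros there. -/
theorem exists_norm_logDeriv {S r : ℝ} (hr0 : 0 < r) (hr : r < S) {G : K → K} (hG : An S G)
    (hne : ∃ z, ‖z‖ < S ∧ G z ≠ 0) (hcrit : ∀ z, ‖z‖ ≤ r → deriv G z = 0 → G z = 0)
    (T : Finset K) (hT : ∀ w, w ∈ T ↔ ‖w‖ ≤ r ∧ G w = 0) :
    ∃ c : ℝ, 0 < c ∧ ∀ z, ‖z‖ ≤ r → ‖deriv G z‖ * ∏ w ∈ T, ‖z - w‖ = c * ‖G z‖ := by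
  classical
  obtain ⟨Ms, u, hu, hMs, hu0, hfac⟩ := hG.exists_factorization hr0 hr hne
  set P : K[X] := (Ms.map fun w => X - C w).prod with hP
  have hPe : ∀ z, P.eval z = (Ms.map fun w => z - w).prod := by
    intro z
    rw [hP, eval_multiset_prod, Multiset.map_map]
    simp
  have hTM : T = Ms.toFinset := by
    ext w
    rw [hT, Multiset.mem_toFinset]
    constructor
    · rintro ⟨hw, h0⟩
      rw [hfac w (hw.trans_lt hr)] at h0
      obtain ⟨v, hv, hv0⟩ := Multiset.mem_map.1
        (Multiset.prod_eq_zero_iff.1 ((_root_.mul_eq_zero.1 h0).resolve_right (hu0 w hw)))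
      rwa [sub_eq_zero.1 hv0]
    · intro hw
      refine ⟨hMs w hw, ?_⟩
      rw [hfac w ((hMs w hw).trans_lt hr), Multiset.prod_eq_zero, zero_mul]
      exact Multiset.mem_map.2 ⟨w, hw, sub_self w⟩
  set rad : K[X] := ∏ w ∈ T, (X - C w) with hrad
  set R : K[X] := ∑ w ∈ T, C (Ms.count w : K) * ∏ v ∈ T.erase w, (X - C v) with hR
  have hPR : derivative P * rad = P * R := by
    rw [hP, hrad, hR, hTM]; exact derivative_prod_mul_radical Ms
  have hrade : ∀ z, rad.eval z = ∏ w ∈ T, (z - w) := fun z => by simp [hrad, eval_prod]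
  have hRe : ∀ w ∈ T, R.eval w ≠ 0 := by
    intro w hw
    rw [hR, eval_finsetSum, Finset.sum_eq_single_of_mem w hw]
    · rw [eval_mul, eval_C, eval_prod]
      refine mul_ne_zero ?_ (Finset.prod_ne_zero_iff.2 fun v hv => ?_)
      · rw [hTM, Multiset.mem_toFinset] at hw
        exact_mod_cast (Multiset.count_pos.2 hw).ne'
      · simpa [sub_eq_zero] using (Finset.ne_of_mem_erase hv).symm
    · intro v hv hvw
      rw [eval_mul, eval_prod, Finset.prod_eq_zero (Finset.mem_erase.2 ⟨hvw.symm, hw⟩), mul_zero]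
      simp
  have hderiv : ∀ z, ‖z‖ < S → deriv G z = P.derivative.eval z * u z + P.eval z * deriv u z := by
    intro z hz
    have heq : G =ᶠ[𝓝 z] fun z => P.eval z * u z := by
      filter_upwards [(isOpen_lt continuous_norm continuous_const).mem_nhds hz] with w hw
      rw [hfac w hw, hPe]
    rw [heq.deriv_eq, deriv_fun_mul P.differentiable.differentiableAt (hu.differentiableAt hz),
      Polynomial.deriv]
  -- From `G = P * u` follows `G' * rad = P * v`. The function `v` has no zeros in the disk: on `T`
  -- the term with `rad` drops out and `R` is nonzero, while off `T` a zero of `v` would be a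
  -- critical point of `G` and so lie in `T`. Hence `u` and `v` both have constant norm.
  set v : K → K := fun z => R.eval z * u z + rad.eval z * deriv u z with hv
  have hvA : An S v := ((An.polynomial S R).mul hu).add ((An.polynomial S rad).mul hu.deriv)
  have hkey : ∀ z, ‖z‖ < S → deriv G z * rad.eval z = P.eval z * v z := by
    intro z hz
    have := congrArg (eval z) hPR
    rw [eval_mul, eval_mul] at this
    rw [hderiv z hz, hv]
    linear_combination u z * this
  have hv0 : ∀ z, ‖z‖ ≤ r → v z ≠ 0 := by
    intro z hz h0
    by_cases hzT : z ∈ T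
    · have hz0 : rad.eval z = 0 := by rw [hrade]; exact Finset.prod_eq_zero hzT (sub_self z)
      simp only [hv, hz0, zero_mul, add_zero] at h0
      exact mul_ne_zero (hRe z hzT) (hu0 z hz) h0
    · have h1 := hkey z (hz.trans_lt hr)
      rw [h0, mul_zero] at h1
      have hz0 : rad.eval z ≠ 0 := by
        rw [hrade]
        exact Finset.prod_ne_zero_iff.2 fun w hw => sub_ne_zero.2 fun h => hzT (h ▸ hw)
      exact hzT ((hT z).2 ⟨hz, hcrit z hz ((_root_.mul_eq_zero.1 h1).resolve_right hz0)⟩)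
  have hz0 : ‖(0 : K)‖ ≤ r := by simpa using hr0.le
  have hu0' : 0 < ‖u 0‖ := norm_pos_iff.2 (hu0 0 hz0)
  refine ⟨‖v 0‖ / ‖u 0‖, div_pos (norm_pos_iff.2 (hv0 0 hz0)) hu0', fun z hz => ?_⟩
  have h1 := congrArg norm (hkey z (hz.trans_lt hr))
  rw [norm_mul, norm_mul, hrade, norm_prod, hvA.norm_eq_of_ne_zero hr0 hr hv0 hz] at h1
  rw [h1, hfac z (hz.trans_lt hr), ← hPe, norm_mul, hu.norm_eq_of_ne_zero hr0 hr hu0 hz]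
  field_simp

/-- The bound `B` on the other terms is uniform, so that their infinite sum is still strictly
smaller than the dominant term. -/
theorem HasExp.norm_eq_of_dominant {S : ℝ} {F : PowerSeries K} {φ : K → K} (h : HasExp S F φ)
    {z : K} (hz : ‖z‖ < S) {e : ℕ} {B : ℝ}
    (hB : ∀ n, n ≠ e → ‖PowerSeries.coeff n F‖ * ‖z‖ ^ n ≤ B)
    (hlt : B < ‖PowerSeries.coeff e F‖ * ‖z‖ ^ e) :
    ‖φ z‖ = ‖PowerSeries.coeff e F‖ * ‖z‖ ^ e := by
  have hB0 : 0 ≤ B := (by positivity : 0 ≤ ‖PowerSeries.coeff (e + 1) F‖ * ‖z‖ ^ (e + 1)).trans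
    (hB (e + 1) (by omega))
  have hs := (h.hasSum z hz).sub (hasSum_ite_eq e (PowerSeries.coeff e F * z ^ e))
  have hle := norm_hasSum_le (C := B) hs fun n => by
    by_cases hn : n = e
    · subst hn; simpa using hB0
    · rw [if_neg hn, sub_zero, norm_mul, norm_pow]; exact hB n hn
  rw [← norm_pow, ← norm_mul]
  refine norm_eq_of_norm_sub_lt ?_
  rw [norm_sub_rev, norm_mul, norm_pow]
  exact hle.trans_lt hlt

/-- At a radius that avoids the norms of finitely many points `w`, the distance `‖z - w‖` is the
larger of the two norms. -/
theorem exists_norm_between_notMem {a b : ℝ} (ha : 0 ≤ a) (hab : a < b) (s : Finset ℝ) :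
    ∃ x : K, a < ‖x‖ ∧ ‖x‖ < b ∧ ‖x‖ ∉ s := by
  induction s using Finset.induction_on generalizing b with
  | empty =>
    obtain ⟨x, h1, h2⟩ := exists_norm_between (K := K) ha hab
    exact ⟨x, h1, h2, by simp⟩
  | insert t s _ ih =>
    have hab' : a < if a < t then min t b else b := by
      split_ifs with h
      · exact lt_min h hab
      · exact hab
    obtain ⟨x, h1, h2, h3⟩ := ih hab'
    have hlt : ‖x‖ < b := by
      split_ifs at h2
      · exact h2.trans_le (min_le_right _ _)
      · exact h2
    refine ⟨x, h1, hlt, fun hmem => ?_⟩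
    rcases Finset.mem_insert.1 hmem with h | h
    · rw [if_pos (h ▸ h1)] at h2
      exact absurd h (h2.trans_le (min_le_left _ _)).ne
    · exact h3 h

theorem exists_pos_le_norm (s : Finset K) (hs : (0 : K) ∉ s) : ∃ δ > 0, ∀ w ∈ s, δ ≤ ‖w‖ := by
  classical
  induction s using Finset.induction_on with
  | empty => exact ⟨1, one_pos, by simp⟩
  | insert t s _ ih =>
    obtain ⟨δ, h0, h1⟩ := ih fun h => hs (Finset.mem_insert_of_mem h)
    have ht : t ≠ 0 := fun h => hs (h ▸ Finset.mem_insert_self t s)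
    refine ⟨min δ ‖t‖, lt_min h0 (norm_pos_iff.2 ht), fun w hw => ?_⟩
    rcases Finset.mem_insert.1 hw with rfl | h
    · exact min_le_right _ _
    · exact (min_le_left _ _).trans (h1 w h)

theorem An.iterate {S : ℝ} (hS : 0 < S) {φ : K → K} (h : An S φ) (hm : ∀ z, ‖z‖ < S → ‖φ z‖ < S)
    (n : ℕ) : An S (φ^[n]) := by
  induction n with
  | zero => exact An.id S
  | succ n ih =>
    have : An S fun z => φ^[n] (φ z) := An.comp hS ih h hm
    exact this

theorem iterate_norm_lt {S : ℝ} {φ : K → K} (hm : ∀ z, ‖z‖ < S → ‖φ z‖ < S) (n : ℕ) {z : K}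
    (hz : ‖z‖ < S) : ‖φ^[n] z‖ < S := by
  induction n generalizing z with
  | zero => exact hz
  | succ n ih => exact ih (hm z hz)

/-- Critical points of an iterate. -/
theorem exists_deriv_eq_zero_of_iterate {S : ℝ} (hS : 0 < S) {φ : K → K} (h : An S φ)
    (hm : ∀ z, ‖z‖ < S → ‖φ z‖ < S) (n : ℕ) {z : K} (hz : ‖z‖ < S) (h0 : deriv (φ^[n]) z = 0) :
    ∃ i, i < n ∧ deriv φ (φ^[i] z) = 0 := by
  induction n generalizing z with
  | zero => simp at h0
  | succ n ih =>
    have hcomp : deriv (φ^[n + 1]) z = deriv (φ^[n]) (φ z) * deriv φ z := by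
      rw [Function.iterate_succ]
      exact deriv_comp z ((h.iterate hS hm n).differentiableAt (hm z hz)) (h.differentiableAt hz)
    rw [hcomp] at h0
    rcases _root_.mul_eq_zero.1 h0 with h1 | h1
    · obtain ⟨i, hi, h2⟩ := ih (hm z hz) h1
      exact ⟨i + 1, by omega, h2⟩
    · exact ⟨0, by omega, h1⟩

/-- A map that is close, on a small disk, to a superattracting one of larger local degree `e > m`
cannot have all its nearby critical points eventually mapped to the attracting fixed point. -/
theorem not_forall_critical_eventually_zero {F : K → K} {A : PowerSeries K} (hF : HasExp 1 A F)
    (hA : ∀ n, ‖PowerSeries.coeff n A‖ ≤ 1) {m e : ℕ} (hm : 1 ≤ m) (hme : m < e)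
    (hlow : ∀ i, i < m → PowerSeries.coeff i A = 0) (ham : PowerSeries.coeff m A ≠ 0)
    {r r' η : ℝ} (hr0' : 0 < r')
    (hη : ∀ i, i < e → ‖PowerSeries.coeff i A‖ ≤ η)
    (hη' : η < ‖(e : K)‖ * ‖PowerSeries.coeff e A‖ * r' ^ e)
    (hr : r < ‖(e : K)‖ * ‖PowerSeries.coeff e A‖) (hrr : r' < ‖(e : K)‖ * r)
    (hcrit : ∀ x, ‖x‖ ≤ r → deriv F x = 0 → ∃ k, F^[k] x = 0) : False := by
  classical
  set A0 := ‖PowerSeries.coeff e A‖ with hA0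
  have he1 : ‖(e : K)‖ ≤ 1 := IsUltrametricDist.norm_natCast_le_one K e
  have hA01 : A0 ≤ 1 := hA e
  have he0 : 0 < ‖(e : K)‖ := norm_pos_iff.2 (by exact_mod_cast (by omega : e ≠ 0))
  have hη0 : 0 ≤ η := (norm_nonneg _).trans (hη 0 (by omega))
  have hr0 : 0 < r := by
    by_contra h
    have : ‖(e : K)‖ * r ≤ 0 := mul_nonpos_of_nonneg_of_nonpos he0.le (not_lt.1 h)
    linarith
  have hre : r < ‖(e : K)‖ := hr.trans_le (mul_le_of_le_one_right he0.le hA01)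
  have hr1 : r < 1 := hre.trans_le he1
  have hA0pos : 0 < A0 := by
    by_contra h
    have : ‖(e : K)‖ * A0 ≤ 0 := mul_nonpos_of_nonneg_of_nonpos he0.le (not_lt.1 h)
    linarith
  have hr'r : r' < r := hrr.trans_le (mul_le_of_le_one_left hr0.le he1)
  have hr'1 : r' < 1 := hr'r.trans hr1
  have hηe : η < ‖(e : K)‖ := by
    refine hη'.trans_le ?_
    calc _ ≤ ‖(e : K)‖ * 1 * 1 := by gcongr; exact pow_le_one₀ hr0'.le hr'1.le
      _ = _ := by ring
  have ham0 : 0 < ‖PowerSeries.coeff m A‖ := norm_pos_iff.2 ham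
  -- the size of `F` and its derivative on the annulus `r' ≤ ‖z‖ ≤ r`
  have hbd : ∀ z : K, r' ≤ ‖z‖ → ‖z‖ ≤ r → ∀ n, n ≠ e →
      ‖PowerSeries.coeff n A‖ * ‖z‖ ^ n ≤ max η (r * ‖z‖ ^ e) := by
    intro z hz1 hz2 n hn
    rcases lt_or_gt_of_ne hn with h | h
    · refine le_max_of_le_left ?_
      calc _ ≤ η * 1 := by
            gcongr
            · exact hη n h
            · exact pow_le_one₀ (norm_nonneg _) (hz2.trans hr1.le)
        _ = η := mul_one η
    · refine le_max_of_le_right ?_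
      calc _ ≤ 1 * ‖z‖ ^ (e + 1) := by
            refine mul_le_mul (hA n) ?_ (by positivity) zero_le_one
            exact pow_le_pow_of_le_one (norm_nonneg _) (hz2.trans hr1.le) h
        _ = ‖z‖ * ‖z‖ ^ e := by rw [one_mul, pow_succ, mul_comm]
        _ ≤ r * ‖z‖ ^ e := by gcongr
  -- The factor `‖e‖` is included because the `e`-th coefficient of `z * F'` is `e` times that of
  -- `F`. Thus the term of index `e` dominates both series, and `‖z * F'‖ = ‖e‖ * ‖F‖` on the
  -- annulus.
  have hbd' : ∀ z : K, r' ≤ ‖z‖ → max η (r * ‖z‖ ^ e) < ‖(e : K)‖ * A0 * ‖z‖ ^ e := by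
    intro z hz1
    have : 0 < ‖z‖ := hr0'.trans_le hz1
    refine max_lt (hη'.trans_le ?_) ?_
    · gcongr
    · gcongr
  have hFann : ∀ z : K, r' ≤ ‖z‖ → ‖z‖ ≤ r → ‖F z‖ = A0 * ‖z‖ ^ e := by
    intro z hz1 hz2
    refine hF.norm_eq_of_dominant (hz2.trans_lt hr1) (hbd z hz1 hz2) ((hbd' z hz1).trans_le ?_)
    calc _ ≤ 1 * A0 * ‖z‖ ^ e := by gcongr
      _ = _ := by rw [one_mul]
  have hzF : HasExp 1 (PowerSeries.X * PowerSeries.derivative K A) (fun z => z * deriv F z) := by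
    have h1 : HasExp 1 (PowerSeries.X : PowerSeries K) (fun z : K => z) := by
      have := HasExp.polynomial 1 (X : K[X])
      rw [Polynomial.coe_X] at this
      exact this.congr fun z _ => by simp
    exact h1.mul hF.deriv
  have hzFc : ∀ n, ‖PowerSeries.coeff n (PowerSeries.X * PowerSeries.derivative K A)‖ =
      ‖(n : K)‖ * ‖PowerSeries.coeff n A‖ := by
    intro n
    rcases n with _ | n
    · simp
    · rw [PowerSeries.coeff_succ_X_mul, PowerSeries.coeff_derivative, norm_mul, mul_comm]
      push_cast; rfl
  have hzFle : ∀ n, ‖PowerSeries.coeff n (PowerSeries.X * PowerSeries.derivative K A)‖ ≤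
      ‖PowerSeries.coeff n A‖ := fun n => by
    rw [hzFc]
    exact mul_le_of_le_one_left (norm_nonneg _) (IsUltrametricDist.norm_natCast_le_one K n)
  have hdann : ∀ z : K, r' ≤ ‖z‖ → ‖z‖ ≤ r → ‖z * deriv F z‖ = ‖(e : K)‖ * A0 * ‖z‖ ^ e := by
    intro z hz1 hz2
    have := hzF.norm_eq_of_dominant (hz2.trans_lt hr1) (e := e) (fun n hn =>
      (mul_le_mul_of_nonneg_right (hzFle n) (by positivity)).trans (hbd z hz1 hz2 n hn)) (by
        rw [hzFc]; exact hbd' z hz1)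
    rw [this, hzFc]
  -- contraction
  set κ := max η r with hκ
  have hκe : κ < ‖(e : K)‖ := max_lt hηe hre
  have hκ1 : κ < 1 := hκe.trans_le he1
  have hκ0 : 0 ≤ κ := le_max_of_le_left hη0
  have hcontr : ∀ z, ‖z‖ ≤ r → ‖F z‖ ≤ κ * ‖z‖ := by
    intro z hz
    refine hF.norm_le (hz.trans_lt hr1) fun n => ?_
    rcases n with _ | _ | n
    · rw [hlow 0 (by omega)]; simp; positivity
    · rw [zero_add, pow_one]
      gcongr
      exact (hη 1 (by omega)).trans (le_max_left _ _)
    · calc _ ≤ 1 * ‖z‖ ^ 2 := by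
            refine mul_le_mul (hA _) ?_ (by positivity) zero_le_one
            exact pow_le_pow_of_le_one (norm_nonneg _) (hz.trans hr1.le) (by omega)
        _ = ‖z‖ * ‖z‖ := by ring
        _ ≤ κ * ‖z‖ := by gcongr; exact hz.trans (le_max_right _ _)
  have hself : ∀ z, ‖z‖ ≤ r → ‖F z‖ ≤ r := fun z hz =>
    (hcontr z hz).trans ((mul_le_of_le_one_left (norm_nonneg _) hκ1.le).trans hz)
  have hD : ∀ z, ‖z‖ < 1 → ‖F z‖ < 1 := by
    intro z hz
    refine (hF.norm_le hz (C := ‖z‖) fun n => ?_).trans_lt hz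
    rcases n with _ | n
    · rw [hlow 0 (by omega)]; simp
    · calc _ ≤ 1 * ‖z‖ ^ 1 := by
            refine mul_le_mul (hA _) ?_ (by positivity) zero_le_one
            exact pow_le_pow_of_le_one (norm_nonneg _) hz.le (by omega)
        _ = ‖z‖ := by ring
  have hiter : ∀ k z, ‖z‖ ≤ r → ‖F^[k] z‖ ≤ κ ^ k * ‖z‖ ∧ ‖F^[k] z‖ ≤ r := by
    intro k
    induction k with
    | zero => intro z hz; simpa using hz
    | succ k ih =>
      intro z hz
      obtain ⟨h1, h2⟩ := ih (F z) (hself z hz)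
      refine ⟨h1.trans ?_, h2⟩
      calc _ ≤ κ ^ k * (κ * ‖z‖) := by gcongr; exact hcontr z hz
        _ = _ := by ring
  have hF0 : F 0 = 0 := by rw [hF.zero_eq one_pos, hlow 0 (by omega)]
  have hit0 : ∀ k, F^[k] 0 = 0 := fun k => Function.iterate_fixed hF0 k
  -- near zero
  have hbdm : ∀ z : K, ‖z‖ ≤ 1 → ∀ n, n ≠ m → ‖PowerSeries.coeff n A‖ * ‖z‖ ^ n ≤ ‖z‖ * ‖z‖ ^ m := by
    intro z hz n hn
    rcases lt_or_gt_of_ne hn with h | h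
    · rw [hlow n h]; simp; positivity
    · calc _ ≤ 1 * ‖z‖ ^ (m + 1) := by
            refine mul_le_mul (hA _) ?_ (by positivity) zero_le_one
            exact pow_le_pow_of_le_one (norm_nonneg _) hz h
        _ = _ := by rw [one_mul, pow_succ, mul_comm]
  have hFm : ∀ z, z ≠ 0 → ‖z‖ < ‖PowerSeries.coeff m A‖ →
      ‖F z‖ = ‖PowerSeries.coeff m A‖ * ‖z‖ ^ m := by
    intro z hz0 hz
    have hz1 : ‖z‖ < 1 := hz.trans_le (hA m)
    exact hF.norm_eq_of_dominant hz1 (hbdm z hz1.le)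
      (mul_lt_mul_of_pos_right hz (pow_pos (norm_pos_iff.2 hz0) m))
  have hFm0 : ∀ z, ‖z‖ < ‖PowerSeries.coeff m A‖ → F z = 0 → z = 0 := by
    intro z hz h0
    by_contra hz0
    have := hFm z hz0 hz
    rw [h0, norm_zero] at this
    have h2 : 0 < ‖PowerSeries.coeff m A‖ * ‖z‖ ^ m :=
      mul_pos ham0 (pow_pos (norm_pos_iff.2 hz0) m)
    linarith
  -- After `j` steps every point of the disk has norm below that of the `m`-th coefficient, where 0
  -- is the only zero of `F`. From then on no new points are mapped to 0.
  obtain ⟨j, hj⟩ := exists_pow_lt_of_lt_one ham0 hκ1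
  have hstab : ∀ k z, ‖z‖ ≤ r → F^[k] z = 0 → F^[j] z = 0 := by
    intro k z hz hk
    rcases le_total k j with h | h
    · obtain ⟨i, rfl⟩ := Nat.exists_eq_add_of_le h
      rw [Nat.add_comm, Function.iterate_add_apply, hk, hit0]
    · induction k, h using Nat.le_induction with
      | base => exact hk
      | succ k hjk ih =>
        refine ih (hFm0 _ ?_ ?_)
        · refine lt_of_le_of_lt (hiter k z hz).1 (lt_of_le_of_lt ?_ hj)
          calc κ ^ k * ‖z‖ ≤ κ ^ j * 1 := by
                refine mul_le_mul (pow_le_pow_of_le_one hκ0 hκ1.le hjk) (hz.trans hr1.le) ?_ ?_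
                · positivity
                · positivity
            _ = κ ^ j := mul_one _
        · rwa [← Function.iterate_succ_apply' F k z]
  -- the finite set of points eventually mapped to zero
  have hAn : An 1 F := ⟨A, hF⟩
  have hit_ne : ∀ k z, z ≠ 0 → ‖z‖ < ‖PowerSeries.coeff m A‖ → ‖z‖ ≤ r → F^[k] z ≠ 0 := by
    intro k
    induction k with
    | zero => intro z hz _ _; exact hz
    | succ k ih =>
      intro z hz h1 h2
      have h3 : ‖F z‖ ≤ ‖z‖ :=
        (hcontr z h2).trans (mul_le_of_le_one_left (norm_nonneg _) hκ1.le)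
      exact ih (F z) (fun h => hz (hFm0 z h1 h)) (h3.trans_lt h1) (h3.trans h2)
  have hne : ∀ k, ∃ z, ‖z‖ < 1 ∧ F^[k] z ≠ 0 := by
    intro k
    obtain ⟨z, hz1, hz2⟩ := exists_norm_between (K := K) le_rfl (lt_min ham0 hr0)
    exact ⟨z, hz2.trans ((min_le_right _ _).trans_lt hr1),
      hit_ne k z (norm_pos_iff.1 hz1) (hz2.trans_le (min_le_left _ _))
        (hz2.le.trans (min_le_right _ _))⟩
  have hfin : {z | ‖z‖ ≤ r ∧ F^[j] z = 0}.Finite :=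
    (hAn.iterate one_pos hD j).finite_zeros hr1 (hne j)
  set T := hfin.toFinset with hTdef
  have hT : ∀ w, w ∈ T ↔ ‖w‖ ≤ r ∧ F^[j] w = 0 := fun w => by simp [hTdef]
  have hT' : ∀ w, w ∈ T ↔ ‖w‖ ≤ r ∧ F^[j + 1] w = 0 := fun w => by
    rw [hT]
    refine and_congr_right fun hw => ⟨fun h => ?_, fun h => hstab _ w hw h⟩
    rw [Function.iterate_succ_apply', h, hF0]
  have hcritk : ∀ k, j ≤ k → ∀ z, ‖z‖ ≤ r → deriv (F^[k]) z = 0 → F^[k] z = 0 := by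
    intro k hk z hz h0
    obtain ⟨i, -, hi⟩ := exists_deriv_eq_zero_of_iterate one_pos hAn hD k (hz.trans_lt hr1) h0
    obtain ⟨l, hl⟩ := hcrit _ (hiter i z hz).2 hi
    rw [← Function.iterate_add_apply] at hl
    have hj0 := hstab _ z hz hl
    obtain ⟨q, rfl⟩ := Nat.exists_eq_add_of_le hk
    rw [Nat.add_comm, Function.iterate_add_apply, hj0, hit0]
  obtain ⟨c, hc0, hc⟩ := exists_norm_logDeriv hr0 hr1 (hAn.iterate one_pos hD j) (hne j)
    (hcritk j le_rfl) T hT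
  obtain ⟨c', hc0', hc'⟩ := exists_norm_logDeriv hr0 hr1
    (hAn.iterate one_pos hD (j + 1)) (hne (j + 1)) (hcritk (j + 1) (by omega)) T hT'
  have hcomp : ∀ z, ‖z‖ ≤ r → deriv (F^[j + 1]) z = deriv (F^[j]) (F z) * deriv F z := by
    intro z hz
    have hz1 := hz.trans_lt hr1
    rw [Function.iterate_succ]
    exact deriv_comp z ((hAn.iterate one_pos hD j).differentiableAt (hD z hz1))
      (hAn.differentiableAt hz1)
  have h0T : (0 : K) ∈ T := (hT 0).2 ⟨by simpa using hr0.le, hit0 j⟩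
  set T₀ := T.erase 0 with hT₀
  have hprod : ∀ z : K, ∏ w ∈ T, ‖z - w‖ = ‖z‖ * ∏ w ∈ T₀, ‖z - w‖ := by
    intro z
    rw [← Finset.mul_prod_erase T _ h0T, sub_zero]
  -- The logarithmic derivatives of `F^[j]` at `F z` and of `F^[j + 1]` at `z` differ by the factor
  -- `F' z`. Both have the pole set `T`, so this identity involves `F` only through `F z` and `z *
  -- F' z`.
  have hrel : ∀ z, ‖z‖ ≤ r → z ∉ T →
      c' * (‖F z‖ * ∏ w ∈ T₀, ‖F z - w‖) = c * (‖z * deriv F z‖ * ∏ w ∈ T₀, ‖z - w‖) := by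
    intro z hz hzT
    have h1 := hc' z hz
    have h2 := hc (F z) (hself z hz)
    rw [hcomp z hz, norm_mul, hprod, Function.iterate_succ_apply] at h1
    rw [hprod] at h2
    have hne0 : ‖F^[j] (F z)‖ ≠ 0 := by
      rw [norm_ne_zero_iff]
      exact fun h => hzT ((hT' z).2 ⟨hz, h⟩)
    apply mul_right_cancel₀ hne0
    rw [norm_mul]
    linear_combination (-(‖F z‖ * ∏ w ∈ T₀, ‖F z - w‖)) * h1 +
      (‖z‖ * ‖deriv F z‖ * ∏ w ∈ T₀, ‖z - w‖) * h2
  -- comparison of the constants at a tiny point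
  have hcc : c' = c * ‖(m : K)‖ := by
    obtain ⟨δ, hδ0, hδ⟩ := exists_pos_le_norm T₀ (Finset.notMem_erase 0 T)
    have hm0 : 0 < ‖(m : K)‖ := norm_pos_iff.2 (by exact_mod_cast (by omega : m ≠ 0))
    have hm1 : ‖(m : K)‖ ≤ 1 := IsUltrametricDist.norm_natCast_le_one K m
    obtain ⟨z, hz0, hz⟩ := exists_norm_between (K := K) le_rfl
      (lt_min (lt_min hδ0 hr0) (mul_pos hm0 ham0))
    have hzδ : ‖z‖ < δ := hz.trans_le ((min_le_left _ _).trans (min_le_left _ _))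
    have hzr : ‖z‖ < r := hz.trans_le ((min_le_left _ _).trans (min_le_right _ _))
    have hzm : ‖z‖ < ‖(m : K)‖ * ‖PowerSeries.coeff m A‖ := hz.trans_le (min_le_right _ _)
    have hzm' : ‖z‖ < ‖PowerSeries.coeff m A‖ :=
      hzm.trans_le (mul_le_of_le_one_left (norm_nonneg _) hm1)
    have hzne : z ≠ 0 := norm_pos_iff.1 hz0
    have hzT : z ∉ T := fun h => hit_ne j z hzne hzm' hzr.le ((hT z).1 h).2
    have hdz : ‖z * deriv F z‖ = ‖(m : K)‖ * ‖PowerSeries.coeff m A‖ * ‖z‖ ^ m := by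
      rw [← hzFc]
      refine hzF.norm_eq_of_dominant (hzr.trans hr1) (fun n hn =>
        (mul_le_mul_of_nonneg_right (hzFle n) (by positivity)).trans
          (hbdm z (hzr.trans hr1).le n hn)) ?_
      rw [hzFc]
      exact mul_lt_mul_of_pos_right hzm (pow_pos hz0 m)
    have hsmall : ∀ y : K, ‖y‖ < δ → ∏ w ∈ T₀, ‖y - w‖ = ∏ w ∈ T₀, ‖w‖ := by
      intro y hy
      refine Finset.prod_congr rfl fun w hw => ?_
      rw [norm_sub_rev, sub_eq_add_neg]
      exact norm_add_eq_left_of_lt (by rw [norm_neg]; exact hy.trans_le (hδ w hw))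
    have hFz : ‖F z‖ < δ :=
      ((hcontr z hzr.le).trans (mul_le_of_le_one_left (norm_nonneg _) hκ1.le)).trans_lt hzδ
    have := hrel z hzr.le hzT
    rw [hsmall z hzδ, hsmall (F z) hFz, hdz, hFm z hzne hzm'] at this
    have hpos : 0 < ∏ w ∈ T₀, ‖w‖ := Finset.prod_pos fun w hw => hδ0.trans_le (hδ w hw)
    have hpos' : 0 < ‖PowerSeries.coeff m A‖ * ‖z‖ ^ m * ∏ w ∈ T₀, ‖w‖ := by positivity
    apply mul_right_cancel₀ hpos'.ne'
    linear_combination this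
  -- a nonzero zero of `F` in the small disk
  obtain ⟨w₁, hw₁, hw₁0, hFw₁⟩ : ∃ w, ‖w‖ ≤ r' ∧ w ≠ 0 ∧ F w = 0 := by
    obtain ⟨ψ, hψ, hψe⟩ := hF.shift m
    -- The quotient `F / z^m` has the `m`-th coefficient of `F` as constant term. This is at most
    -- `η`, hence dominated at radius `r'` by the term coming from index `e`, and it is nonzero, so
    -- the zero found is not 0.
    obtain ⟨w, hw, hw0⟩ := hψ.exists_zero hr0' hr'1 (m := e - m) (by omega) (by
      rw [coeff_shiftSeries, coeff_shiftSeries, zero_add, Nat.sub_add_cancel hme.le]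
      refine (hη m hme).trans (hη'.le.trans ?_)
      calc _ ≤ 1 * A0 * r' ^ (e - m) := by
            gcongr ?_ * A0 * ?_
            exact pow_le_pow_of_le_one hr0'.le hr'1.le (Nat.sub_le _ _)
        _ = _ := by rw [one_mul])
    refine ⟨w, hw, ?_, ?_⟩
    · rintro rfl
      rw [hψ.zero_eq one_pos, coeff_shiftSeries, zero_add] at hw0
      exact ham hw0
    · rw [hψe w (hw.trans_lt hr'1), hw0, mul_zero, add_zero]
      exact Finset.sum_eq_zero fun i hi => by rw [hlow i (Finset.mem_range.1 hi), zero_mul]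
  have hw₁T : w₁ ∈ T₀ :=
    Finset.mem_erase.2 ⟨hw₁0, (hT w₁).2 ⟨hw₁.trans hr'r.le, hstab 1 w₁ (hw₁.trans hr'r.le) hFw₁⟩⟩
  -- comparison at a point of generic radius
  obtain ⟨z, hz1, hz2, hz3⟩ := exists_norm_between_notMem (K := K) (div_nonneg hr0'.le he0.le)
    ((div_lt_iff₀' he0).2 hrr) (T.image norm)
  have hzr' : r' < ‖(e : K)‖ * ‖z‖ := (div_lt_iff₀' he0).1 hz1
  have hzr'' : r' < ‖z‖ := hzr'.trans_le (mul_le_of_le_one_left (norm_nonneg _) he1)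
  have hzpos : 0 < ‖z‖ := hr0'.trans hzr''
  have hzw : ∀ w ∈ T, ‖z - w‖ = max ‖z‖ ‖w‖ := by
    intro w hw
    have hne : ‖z‖ ≠ ‖-w‖ := by
      rw [norm_neg]
      exact fun h => hz3 (Finset.mem_image.2 ⟨w, hw, h.symm⟩)
    rw [sub_eq_add_neg, IsUltrametricDist.norm_add_eq_max_of_norm_ne_norm hne, norm_neg]
  have hzT : z ∉ T := fun h => hz3 (Finset.mem_image.2 ⟨z, h, rfl⟩)
  have hFz : ‖F z‖ ≤ κ * ‖z‖ := hcontr z hz2.le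
  have hFz' : ‖F z‖ ≤ ‖z‖ := hFz.trans (mul_le_of_le_one_left (norm_nonneg _) hκ1.le)
  have hmain := hrel z hz2.le hzT
  rw [hcc, hFann z hzr''.le hz2.le, hdann z hzr''.le hz2.le] at hmain
  have hm1 : ‖(m : K)‖ ≤ 1 := IsUltrametricDist.norm_natCast_le_one K m
  have hle : ∏ w ∈ T₀.erase w₁, ‖F z - w‖ ≤ ∏ w ∈ T₀.erase w₁, ‖z - w‖ := by
    refine Finset.prod_le_prod (fun _ _ => norm_nonneg _) fun w hw => ?_
    rw [hzw w (Finset.mem_of_mem_erase (Finset.mem_of_mem_erase hw))]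
    exact (norm_sub_le_max' _ _).trans (max_le_max hFz' le_rfl)
  have hpos : 0 < ∏ w ∈ T₀.erase w₁, ‖z - w‖ := Finset.prod_pos fun w hw => by
    rw [hzw w (Finset.mem_of_mem_erase (Finset.mem_of_mem_erase hw))]
    exact lt_max_of_lt_left hzpos
  -- `hmain` equates `‖m‖ * ∏ ‖F z - w‖` with `‖e‖ * ∏ ‖z - w‖`, up to a positive factor. Replacing
  -- `z` by `F z` enlarges none of the factors and shrinks this one by more than `‖e‖`. Since `‖m‖ ≤
  -- 1`, equality is impossible.
  have hlt : ‖F z - w₁‖ < ‖(e : K)‖ * ‖z - w₁‖ := by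
    have h1 : ‖z‖ ≤ ‖z - w₁‖ := by
      rw [hzw w₁ (Finset.mem_of_mem_erase hw₁T)]; exact le_max_left _ _
    refine lt_of_lt_of_le ?_ (mul_le_mul_of_nonneg_left h1 he0.le)
    refine norm_sub_lt_of_lt (hFz.trans_lt ?_) (hw₁.trans_lt hzr')
    gcongr
  rw [← Finset.mul_prod_erase T₀ _ hw₁T, ← Finset.mul_prod_erase T₀ _ hw₁T] at hmain
  have hstrict : ‖(m : K)‖ * (‖F z - w₁‖ * ∏ w ∈ T₀.erase w₁, ‖F z - w‖) <
      ‖(e : K)‖ * (‖z - w₁‖ * ∏ w ∈ T₀.erase w₁, ‖z - w‖) := by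
    calc _ ≤ 1 * (‖F z - w₁‖ * ∏ w ∈ T₀.erase w₁, ‖z - w‖) := by
          gcongr
      _ < (‖(e : K)‖ * ‖z - w₁‖) * ∏ w ∈ T₀.erase w₁, ‖z - w‖ := by
          rw [one_mul]; gcongr
      _ = _ := by ring
  have hposA : 0 < c * (A0 * ‖z‖ ^ e) := by positivity
  have := mul_lt_mul_of_pos_left hstrict hposA
  refine absurd ?_ this.ne
  linear_combination hmain

end Critical

/-! ### Periods of maps close to the identity or to a rotation. -/

section Indifferent

variable {K : Type*} [NontriviallyNormedField K] [IsUltrametricDist K]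
  [IsAlgClosed K] [CharZero K] [CompleteSpace K]

theorem norm_map_sub_le {R δ : ℝ} {H : K → K} (hδ1 : δ ≤ 1)
    (hL : ∀ z w, ‖z‖ < R → ‖w‖ < R → ‖(H z - z) - (H w - w)‖ ≤ δ * ‖z - w‖) {z w : K}
    (hz : ‖z‖ < R) (hw : ‖w‖ < R) : ‖H z - H w‖ ≤ ‖z - w‖ := by
  have h1 : ‖(H z - z) - (H w - w)‖ ≤ ‖z - w‖ :=
    (hL z w hz hw).trans (mul_le_of_le_one_left (norm_nonneg _) hδ1)
  have := norm_add_le_of_le' h1 (le_refl ‖z - w‖)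
  convert this using 2; ring

theorem norm_iterate_sub_le {R δ : ℝ} {H : K → K} (hδ1 : δ ≤ 1)
    (hm : ∀ z, ‖z‖ < R → ‖H z‖ < R)
    (hL : ∀ z w, ‖z‖ < R → ‖w‖ < R → ‖(H z - z) - (H w - w)‖ ≤ δ * ‖z - w‖) (n : ℕ) {z : K}
    (hz : ‖z‖ < R) : ‖H^[n] z - z‖ ≤ ‖H z - z‖ := by
  induction n with
  | zero => simp
  | succ n ih =>
    have h1 := norm_map_sub_le hδ1 hL (iterate_norm_lt hm n hz) hz
    have := norm_add_le_of_le' (h1.trans ih) (le_refl ‖H z - z‖)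
    rw [Function.iterate_succ_apply']
    convert this using 2; ring

/-- If `H` is close to the identity, then `Hⁿ - id` is close to `n (H - id)`. -/
theorem norm_iterate_sub_sub_le {R δ : ℝ} {H : K → K} (hδ0 : 0 ≤ δ) (hδ1 : δ ≤ 1)
    (hm : ∀ z, ‖z‖ < R → ‖H z‖ < R)
    (hL : ∀ z w, ‖z‖ < R → ‖w‖ < R → ‖(H z - z) - (H w - w)‖ ≤ δ * ‖z - w‖) (n : ℕ) {z : K}
    (hz : ‖z‖ < R) : ‖H^[n] z - z - n * (H z - z)‖ ≤ δ * ‖H z - z‖ := by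
  induction n with
  | zero => simp; positivity
  | succ n ih =>
    have h1 := hL _ z (iterate_norm_lt hm n hz) hz
    have h2 := h1.trans (mul_le_mul_of_nonneg_left (norm_iterate_sub_le hδ1 hm hL n hz) hδ0)
    have := norm_add_le_of_le' ih h2
    rw [Function.iterate_succ_apply']
    convert this using 2; push_cast; ring

/-- If `H z ≠ z`, the displacement under `q` iterations is `q * (H z - z)` up to an error of
strictly smaller norm, so it cannot vanish. -/
theorem fixed_of_iterate_prime {R δ : ℝ} {H : K → K} (hδ0 : 0 ≤ δ) (hδ1 : δ ≤ 1)
    (hm : ∀ z, ‖z‖ < R → ‖H z‖ < R)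
    (hL : ∀ z w, ‖z‖ < R → ‖w‖ < R → ‖(H z - z) - (H w - w)‖ ≤ δ * ‖z - w‖) {q : ℕ}
    (hq : δ < ‖(q : K)‖) {z : K} (hz : ‖z‖ < R) (h : H^[q] z = z) : H z = z := by
  by_contra hne
  have h0 : 0 < ‖H z - z‖ := norm_pos_iff.2 (sub_ne_zero.2 hne)
  have := norm_iterate_sub_sub_le hδ0 hδ1 hm hL q hz
  rw [h, sub_self, zero_sub, norm_neg, norm_mul] at this
  exact absurd (mul_lt_mul_of_pos_right hq h0) (not_lt.2 this)

theorem An.lipschitz_sub_id {R δ : ℝ} {H : K → K} (hH : An R H)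
    (hs : ∀ z, ‖z‖ < R → ‖H z - z‖ ≤ δ * R) {z w : K} (hz : ‖z‖ < R) (hw : ‖w‖ < R) :
    ‖(H z - z) - (H w - w)‖ ≤ δ * ‖z - w‖ := by
  have hR : 0 < R := (norm_nonneg z).trans_lt hz
  have := (hH.sub (An.id R)).lipschitz hs hz hw
  rwa [mul_div_cancel_right₀ _ hR.ne'] at this

/-- Strong induction on the period: with `q` its least prime factor, `H^[n / q]` is as close to the
identity as `H`, so the prime case applies to it. -/
theorem fixed_of_iterate {R δ : ℝ} (hR : 0 < R) {H : K → K} (hδ0 : 0 ≤ δ) (hδ1 : δ ≤ 1)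
    (hH : An R H) (hm : ∀ z, ‖z‖ < R → ‖H z‖ < R) (hs : ∀ z, ‖z‖ < R → ‖H z - z‖ ≤ δ * R)
    (hq : ∀ q : ℕ, q.Prime → δ < ‖(q : K)‖) {z : K} (hz : ‖z‖ < R) {n : ℕ} (hn : n ≠ 0)
    (h : H^[n] z = z) : H z = z := by
  induction n using Nat.strong_induction_on with
  | _ n ih =>
    rcases eq_or_ne n 1 with rfl | hn1
    · exact h
    · have hprime := Nat.minFac_prime hn1
      obtain ⟨k, hk⟩ := Nat.minFac_dvd n
      have hk0 : k ≠ 0 := by rintro rfl; omega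
      have hkn : k < n := by
        rw [hk]
        exact lt_mul_of_one_lt_left (Nat.pos_of_ne_zero hk0) hprime.one_lt
      have hL : ∀ z w, ‖z‖ < R → ‖w‖ < R → ‖(H z - z) - (H w - w)‖ ≤ δ * ‖z - w‖ :=
        fun z w hz hw => hH.lipschitz_sub_id hs hz hw
      have hs' : ∀ z, ‖z‖ < R → ‖H^[k] z - z‖ ≤ δ * R := fun z hz =>
        (norm_iterate_sub_le hδ1 hm hL k hz).trans (hs z hz)
      refine ih k hkn hk0 ?_
      refine fixed_of_iterate_prime hδ0 hδ1 (H := H^[k]) (fun z hz => iterate_norm_lt hm k hz)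
        (fun z w hz hw => (hH.iterate hR hm k).lipschitz_sub_id hs' hz hw)
        (hq n.minFac hprime) hz ?_
      rw [← Function.iterate_mul, mul_comm, ← hk]
      exact h

theorem norm_natCast_eq_one_of_prime_ne {p q : ℕ} (hp : p.Prime) (hq : q.Prime) (hpq : q ≠ p)
    (hpn : ‖(p : K)‖ < 1) : ‖(q : K)‖ = 1 := by
  have hcop : IsCoprime (p : ℤ) (q : ℤ) :=
    Nat.isCoprime_iff_coprime.2 ((Nat.coprime_primes hp hq).2 hpq.symm)
  obtain ⟨u, v, huv⟩ := hcop
  have h1 : (u : K) * p + v * q = 1 := by exact_mod_cast congrArg (Int.cast : ℤ → K) huv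
  refine le_antisymm (IsUltrametricDist.norm_natCast_le_one K q) ?_
  by_contra! hlt
  have hu : ‖(u : K)‖ ≤ 1 := IsUltrametricDist.norm_intCast_le_one K u
  have hv : ‖(v : K)‖ ≤ 1 := IsUltrametricDist.norm_intCast_le_one K v
  have := norm_add_lt_of_lt' (x := (u : K) * p) (y := (v : K) * q) (C := 1)
    (by rw [norm_mul]; exact (mul_le_of_le_one_left (norm_nonneg _) hu).trans_lt hpn)
    (by rw [norm_mul]; exact (mul_le_of_le_one_left (norm_nonneg _) hv).trans_lt hlt)
  rw [h1, norm_one] at this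
  exact lt_irrefl _ this

/-- For maps whose difference from the identity is a contraction, the period of all periodic
points divides a fixed power of the residue characteristic. -/
theorem exists_pow_iterate_fixed {p : ℕ} (hp : p.Prime) (hpn : ‖(p : K)‖ < 1) {η : ℝ}
    (hη0 : 0 ≤ η) (hη1 : η < 1) :
    ∃ l, l ≠ 0 ∧ ∀ {R : ℝ}, 0 < R → ∀ {G : K → K}, An R G → (∀ z, ‖z‖ < R → ‖G z‖ < R) →
      (∀ z w, ‖z‖ < R → ‖w‖ < R → ‖(G z - z) - (G w - w)‖ ≤ η * ‖z - w‖) →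
      ∀ z, ‖z‖ < R → ∀ n, n ≠ 0 → G^[n] z = z → G^[l] z = z := by
  set θ := max ‖(p : K)‖ η with hθ
  have hθ1 : θ < 1 := max_lt hpn hη1
  have hθ0 : 0 ≤ θ := le_max_of_le_left (norm_nonneg _)
  have hp0 : 0 < ‖(p : K)‖ := norm_pos_iff.2 (by exact_mod_cast hp.ne_zero)
  -- Each `p`-th iteration multiplies the bound on the displacement by `θ`. After enough of them it
  -- is below `‖p‖`, hence below the norm of every prime, since the other primes have norm 1.
  obtain ⟨i, hi⟩ := exists_pow_lt_of_lt_one hp0 hθ1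
  have hi' : θ ^ (i + 1) < ‖(p : K)‖ :=
    (pow_le_pow_of_le_one hθ0 hθ1.le (Nat.le_succ i)).trans_lt hi
  refine ⟨p ^ (i + 1), pow_ne_zero _ hp.ne_zero, fun {R} hR {G} hG hm hL z hz n hn h => ?_⟩
  have hs : ∀ i z, ‖z‖ < R → ‖G^[p ^ (i + 1)] z - z‖ ≤ θ ^ (i + 1) * R := by
    intro i
    induction i with
    | zero =>
      intro z hz
      have h1 := norm_iterate_sub_sub_le hη0 hη1.le hm hL p hz
      have h2 : ‖(p : K) * (G z - z)‖ ≤ θ * ‖G z - z‖ := by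
        rw [norm_mul]; gcongr; exact le_max_left _ _
      have h3 := norm_add_le_of_le' (h1.trans (mul_le_mul_of_nonneg_right (le_max_right _ _)
        (norm_nonneg _))) h2
      rw [sub_add_cancel] at h3
      rw [zero_add, pow_one, pow_one]
      refine h3.trans ?_
      gcongr
      exact norm_sub_le_of_le (hm z hz).le hz.le
    | succ i ih =>
      intro z hz
      set H := G^[p ^ (i + 1)] with hH
      have hHm : ∀ z, ‖z‖ < R → ‖H z‖ < R := fun z hz => iterate_norm_lt hm _ hz
      have hHA : An R H := hG.iterate hR hm _
      have hδ0 : 0 ≤ θ ^ (i + 1) := pow_nonneg hθ0 _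
      have hδ1 : θ ^ (i + 1) ≤ 1 := pow_le_one₀ hθ0 hθ1.le
      have hδθ : θ ^ (i + 1) ≤ θ := by
        simpa using pow_le_pow_of_le_one hθ0 hθ1.le (Nat.le_add_left 1 i)
      have h1 := norm_iterate_sub_sub_le hδ0 hδ1 hHm
        (fun z w hz hw => hHA.lipschitz_sub_id ih hz hw) p hz
      have h2 : ‖(p : K) * (H z - z)‖ ≤ θ * ‖H z - z‖ := by
        rw [norm_mul]; gcongr; exact le_max_left _ _
      have h3 := norm_add_le_of_le' (h1.trans (mul_le_mul_of_nonneg_right hδθ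
        (norm_nonneg _))) h2
      rw [sub_add_cancel] at h3
      rw [pow_succ p, Function.iterate_mul]
      refine h3.trans ?_
      rw [pow_succ θ (i + 1), mul_comm _ θ, mul_assoc]
      gcongr
      exact ih z hz
  refine fixed_of_iterate hR (pow_nonneg hθ0 (i + 1)) (pow_le_one₀ hθ0 hθ1.le)
    (hG.iterate hR hm (p ^ (i + 1))) (fun z hz => iterate_norm_lt hm _ hz) (hs i) ?_ hz hn ?_
  · intro q hq
    by_cases hqp : q = p
    · rw [hqp]; exact hi'
    · rw [norm_natCast_eq_one_of_prime_ne hp hq hqp hpn]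
      exact hi'.trans hpn
  · rw [← Function.iterate_mul, mul_comm, Function.iterate_mul]
    exact Function.iterate_fixed h _

/-- Maps that are close to a fixed rotation have bounded periods, with a bound depending only on
the rotation. -/
theorem exists_iterate_fixed_of_rotation {p : ℕ} (hp : p.Prime) (hpn : ‖(p : K)‖ < 1) {τ : ℝ}
    (hτ0 : 0 ≤ τ) (hτ1 : τ < 1) {a : K} (ha : ‖a‖ = 1) :
    ∃ l, l ≠ 0 ∧ ∀ {R : ℝ}, 0 < R → ∀ {G : K → K}, An R G → (∀ z, ‖z‖ < R → ‖G z‖ < R) →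
      (∀ z w, ‖z‖ < R → ‖w‖ < R → ‖G z - G w - a * (z - w)‖ ≤ τ * ‖z - w‖) →
      ∀ z, ‖z‖ < R → IsPreperiodic G z → G^[l] z = z := by
  have hiso : ∀ {R : ℝ} {G : K → K},
      (∀ z w, ‖z‖ < R → ‖w‖ < R → ‖G z - G w - a * (z - w)‖ ≤ τ * ‖z - w‖) →
      ∀ z w, ‖z‖ < R → ‖w‖ < R → ‖G z - G w‖ = ‖z - w‖ := by
    intro R G hL z w hz hw
    rcases eq_or_ne z w with rfl | hne
    · simp
    · have h0 : 0 < ‖z - w‖ := norm_pos_iff.2 (sub_ne_zero.2 hne)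
      have hazw : ‖a * (z - w)‖ = ‖z - w‖ := by rw [norm_mul, ha, one_mul]
      rw [← hazw]
      refine norm_eq_of_norm_sub_lt ?_
      rw [norm_sub_rev, hazw]
      exact (hL z w hz hw).trans_lt (mul_lt_of_lt_one_left h0 hτ1)
  have hper : ∀ {R : ℝ} {G : K → K}, (∀ z, ‖z‖ < R → ‖G z‖ < R) →
      (∀ z w, ‖z‖ < R → ‖w‖ < R → ‖G z - G w - a * (z - w)‖ ≤ τ * ‖z - w‖) →
      ∀ z, ‖z‖ < R → IsPreperiodic G z → ∃ n, n ≠ 0 ∧ G^[n] z = z := by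
    rintro R G hm hL z hz ⟨m, n, hmn, h⟩
    refine ⟨n - m, by omega, ?_⟩
    obtain ⟨q, rfl⟩ := Nat.exists_eq_add_of_le hmn.le
    rw [Nat.add_sub_cancel_left]
    clear hmn
    induction m with
    | zero => simpa using h
    | succ m ih =>
      refine ih ?_
      rw [show m + 1 + q = (m + q) + 1 by ring, Function.iterate_succ_apply',
        Function.iterate_succ_apply'] at h
      have h1 := hiso hL _ _ (iterate_norm_lt hm (m + q) hz) (iterate_norm_lt hm m hz)
      rw [h, sub_self, norm_zero] at h1
      exact sub_eq_zero.1 (norm_eq_zero.1 h1.symm)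
  have hiter : ∀ {R : ℝ} {G : K → K}, (∀ z, ‖z‖ < R → ‖G z‖ < R) →
      (∀ z w, ‖z‖ < R → ‖w‖ < R → ‖G z - G w - a * (z - w)‖ ≤ τ * ‖z - w‖) →
      ∀ k z w, ‖z‖ < R → ‖w‖ < R → ‖G^[k] z - G^[k] w - a ^ k * (z - w)‖ ≤ τ * ‖z - w‖ := by
    intro R G hm hL k
    induction k with
    | zero => intro z w _ _; simp; positivity
    | succ k ih =>
      intro z w hz hw
      have h1 := ih (G z) (G w) (hm z hz) (hm w hw)
      rw [hiso hL z w hz hw] at h1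
      have h2 : ‖a ^ k * (G z - G w - a * (z - w))‖ ≤ τ * ‖z - w‖ := by
        rw [norm_mul, norm_pow, ha, one_pow, one_mul]; exact hL z w hz hw
      have := norm_add_le_of_le' h1 h2
      rw [Function.iterate_succ_apply, Function.iterate_succ_apply]
      convert this using 2; ring
  -- The question is whether `a` reduces to a root of unity in the residue field. If so, `G^[k]` is
  -- close to the identity. If not, `G` moves a point of period `n` nowhere, since `(a ^ n - 1) * (G
  -- z - z)` is smaller than `G z - z` while `‖a ^ n - 1‖ ≥ 1`.
  by_cases hk : ∃ k, k ≠ 0 ∧ ‖a ^ k - 1‖ < 1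
  · obtain ⟨k, hk0, hk⟩ := hk
    obtain ⟨l, hl0, hl⟩ := exists_pow_iterate_fixed (K := K) hp hpn (η := max τ ‖a ^ k - 1‖)
      (le_max_of_le_left hτ0) (max_lt hτ1 hk)
    refine ⟨k * l, mul_ne_zero hk0 hl0, fun {R} hR {G} hG hm hL z hz hz' => ?_⟩
    obtain ⟨n, hn, hnz⟩ := hper hm hL z hz hz'
    rw [Function.iterate_mul]
    refine hl hR (hG.iterate hR hm k) (fun z hz => iterate_norm_lt hm k hz) ?_ z hz n hn ?_
    · intro z w hz hw
      have h1 := (hiter hm hL k z w hz hw).trans (mul_le_mul_of_nonneg_right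
        (le_max_left τ ‖a ^ k - 1‖) (norm_nonneg _))
      have h2 : ‖(a ^ k - 1) * (z - w)‖ ≤ max τ ‖a ^ k - 1‖ * ‖z - w‖ := by
        rw [norm_mul]; gcongr; exact le_max_right _ _
      have := norm_add_le_of_le' h1 h2
      convert this using 2; ring
    · rw [← Function.iterate_mul, mul_comm, Function.iterate_mul]
      exact Function.iterate_fixed hnz _
  · push Not at hk
    refine ⟨1, one_ne_zero, fun {R} hR {G} hG hm hL z hz hz' => ?_⟩
    obtain ⟨n, hn, hnz⟩ := hper hm hL z hz hz'
    by_contra hne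
    rw [Function.iterate_one] at hne
    have h0 : 0 < ‖G z - z‖ := norm_pos_iff.2 (sub_ne_zero.2 hne)
    have h1 := hiter hm hL n (G z) z (hm z hz) hz
    rw [← Function.iterate_succ_apply, Function.iterate_succ_apply', hnz] at h1
    have h2 : G z - z - a ^ n * (G z - z) = -((a ^ n - 1) * (G z - z)) := by ring
    rw [h2, norm_neg, norm_mul] at h1
    have h3 := (le_mul_of_one_le_left h0.le (hk n hn)).trans h1
    exact absurd (mul_lt_of_lt_one_left h0 hτ1) (not_lt.2 h3)

end Indifferent

/-! ### Analytic families of self-maps of the unit disk. -/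

section Families

variable {K : Type*} [NontriviallyNormedField K] [IsUltrametricDist K]
  [IsAlgClosed K] [CharZero K] [CompleteSpace K]

theorem HasExp.norm_coeff_le_one {φ : K → K} {A : PowerSeries K} (h : HasExp 1 A φ)
    (hD : ∀ z, ‖z‖ < 1 → ‖φ z‖ ≤ 1) (n : ℕ) : ‖PowerSeries.coeff n A‖ ≤ 1 := by
  simpa using h.cauchy one_pos hD n

/-- The Taylor coefficients of an analytic family of self-maps of the unit disk are analytic in
the parameter. -/
theorem An.coeff_of_family {S : ℝ} (hS : 0 < S) {F : K → K → K} {A : K → PowerSeries K}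
    (hA : ∀ c, ‖c‖ < S → HasExp 1 (A c) (F c))
    (hA1 : ∀ c, ‖c‖ < S → ∀ n, ‖PowerSeries.coeff n (A c)‖ ≤ 1)
    (hc : ∀ z, ‖z‖ < 1 → An S (fun c => F c z)) (n : ℕ) :
    An S (fun c => PowerSeries.coeff n (A c)) := by
  induction n using Nat.strong_induction_on with
  | _ n ih =>
    refine An.of_uniform_approx hS fun ε hε => ?_
    obtain ⟨z, hz0, hz⟩ := exists_norm_between (K := K) le_rfl (lt_min hε one_pos)
    have hz1 : ‖z‖ < 1 := hz.trans_le (min_le_right _ _)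
    have hzε : ‖z‖ ≤ ε := hz.le.trans (min_le_left _ _)
    have hzne : z ≠ 0 := norm_pos_iff.1 hz0
    -- The `n`-th coefficient is the limit of this quotient as `z → 0`. The error is at most `‖z‖`,
    -- uniformly in `c`, because all Taylor coefficients are bounded by 1.
    refine ⟨fun c => (F c z - ∑ i ∈ Finset.range n, PowerSeries.coeff i (A c) * z ^ i) *
      (z ^ n)⁻¹, ?_, fun c hcS => ?_⟩
    · refine ((hc z hz1).sub (An.sum _ fun i hi => ?_)).mul (An.const S _)
      exact (ih i (Finset.mem_range.1 hi)).mul (An.const S _)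
    · obtain ⟨ψ, hψ, he⟩ := (hA c hcS).shift n
      have h1 := hψ.norm_sub_zero_le one_pos (C := 1) (fun w hw => hψ.norm_le hw fun k => by
        rw [coeff_shiftSeries]
        exact mul_le_one₀ (hA1 c hcS _) (by positivity) (pow_le_one₀ (norm_nonneg _) hw.le)) hz1
      rw [hψ.zero_eq one_pos, coeff_shiftSeries, zero_add, div_one, one_mul] at h1
      beta_reduce
      rw [he z hz1, add_sub_cancel_left, mul_comm (z ^ n), mul_assoc,
        mul_inv_cancel₀ (pow_ne_zero n hzne), mul_one, norm_sub_rev]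
      exact h1.trans hzε

theorem An.eval_family {S ρ : ℝ} (hS : 0 < S) (hρ0 : 0 ≤ ρ) (hρ1 : ρ < 1) {F : K → K → K}
    {A : K → PowerSeries K} (hA : ∀ c, ‖c‖ < S → HasExp 1 (A c) (F c))
    (hA1 : ∀ c, ‖c‖ < S → ∀ n, ‖PowerSeries.coeff n (A c)‖ ≤ 1)
    (hAn : ∀ n, An S (fun c => PowerSeries.coeff n (A c))) {β : K → K} (hβ : An S β)
    (hβρ : ∀ c, ‖c‖ < S → ‖β c‖ ≤ ρ) : An S (fun c => F c (β c)) := by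
  refine An.of_hasSum hS (a := fun n c => PowerSeries.coeff n (A c) * β c ^ n)
    (B := fun n => ρ ^ n) (fun n => (hAn n).mul (hβ.pow n))
    (tendsto_pow_atTop_nhds_zero_of_lt_one hρ0 hρ1) (fun n c hcS => ?_)
    (fun c hcS => (hA c hcS).hasSum _ ((hβρ c hcS).trans_lt hρ1))
  rw [norm_mul, norm_pow]
  calc _ ≤ 1 * ρ ^ n := by
        gcongr
        · exact hA1 c hcS n
        · exact hβρ c hcS
    _ = ρ ^ n := one_mul _

/-- Self-maps of the unit disk are well approximated by their linear term. -/
theorem HasExp.norm_sub_sub_linear_le {φ : K → K} {A : PowerSeries K} (h : HasExp 1 A φ)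
    (hA : ∀ n, ‖PowerSeries.coeff n A‖ ≤ 1) {R : ℝ} (hR1 : R ≤ 1) {z w : K} (hz : ‖z‖ < R)
    (hw : ‖w‖ < R) : ‖φ z - φ w - PowerSeries.coeff 1 A * (z - w)‖ ≤ R * ‖z - w‖ := by
  have hR : 0 < R := (norm_nonneg z).trans_lt hz
  obtain ⟨ψ, hψ, he⟩ := h.shift 2
  have hAn : An R (fun z => z ^ 2 * ψ z) := ((An.id R).pow 2).mul (An.mono ⟨_, hψ⟩ hR1)
  have hle : ∀ z : K, ‖z‖ < R → ‖z ^ 2 * ψ z‖ ≤ R * R := by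
    intro z hz
    have h1 : ‖ψ z‖ ≤ 1 := hψ.norm_le (hz.trans_le hR1) fun n => by
      rw [coeff_shiftSeries]
      exact mul_le_one₀ (hA _) (by positivity) (pow_le_one₀ (norm_nonneg _) (hz.le.trans hR1))
    rw [norm_mul, norm_pow]
    calc _ ≤ R ^ 2 * 1 := by gcongr
      _ = R * R := by ring
  have := hAn.lipschitz hle hz hw
  rw [mul_div_cancel_right₀ _ hR.ne'] at this
  refine le_of_eq_of_le (congrArg norm ?_) this
  rw [he z (hz.trans_le hR1), he w (hw.trans_le hR1)]
  simp only [Finset.sum_range_succ, Finset.sum_range_zero]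
  ring

/-- An orbit that hits 0 while inside a ball where 0 is the only zero of `F` was already at 0 one
step earlier. This can be traced back to the time `j` after which the orbit stays in the ball. -/
theorem iterate_eq_zero_of_small {F : K → K} {δ : ℝ} (hF0 : F 0 = 0)
    (hinj : ∀ y, ‖y‖ < δ → F y = 0 → y = 0) {j : ℕ} {z : K} (hsmall : ∀ k, j ≤ k → ‖F^[k] z‖ < δ)
    {k : ℕ} (hk : F^[k] z = 0) : F^[j] z = 0 := by
  rcases le_total k j with h | h
  · obtain ⟨i, rfl⟩ := Nat.exists_eq_add_of_le h
    rw [Nat.add_comm, Function.iterate_add_apply, hk, Function.iterate_fixed hF0]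
  · induction k, h using Nat.le_induction with
    | base => exact hk
    | succ k hjk ih =>
      refine ih (hinj _ (hsmall k hjk) ?_)
      rwa [← Function.iterate_succ_apply' F k z]

theorem HasExp.norm_le_of_attracting {φ : K → K} {A : PowerSeries K} (h : HasExp 1 A φ)
    (hA : ∀ n, ‖PowerSeries.coeff n A‖ ≤ 1) (h0 : φ 0 = 0) {κ : ℝ}
    (hκ : ‖PowerSeries.coeff 1 A‖ ≤ κ) {z : K} (hz : ‖z‖ < 1) :
    ‖φ z‖ ≤ max κ ‖z‖ * ‖z‖ := by
  rw [h.zero_eq one_pos] at h0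
  refine h.norm_le hz fun n => ?_
  rcases n with _ | _ | n
  · rw [h0]; simp; positivity
  · rw [zero_add, pow_one]
    gcongr
    exact hκ.trans (le_max_left _ _)
  · calc _ ≤ 1 * ‖z‖ ^ 2 := by
          refine mul_le_mul (hA _) ?_ (by positivity) zero_le_one
          exact pow_le_pow_of_le_one (norm_nonneg _) hz.le (by omega)
      _ = ‖z‖ * ‖z‖ := by ring
      _ ≤ _ := by gcongr; exact le_max_right _ _

/-- Preperiodic points in the basin of an attracting fixed point are eventually fixed. -/
theorem HasExp.eventually_zero_of_preperiodic {φ : K → K} {A : PowerSeries K} (h : HasExp 1 A φ)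
    (hA : ∀ n, ‖PowerSeries.coeff n A‖ ≤ 1) (h0 : φ 0 = 0) (hκ : ‖PowerSeries.coeff 1 A‖ < 1)
    {z : K} (hz : ‖z‖ < 1) (hp : IsPreperiodic φ z) : ∃ k, φ^[k] z = 0 := by
  obtain ⟨m, n, hmn, he⟩ := hp
  refine ⟨m, ?_⟩
  have hle : ∀ z, ‖z‖ < 1 → ‖φ z‖ ≤ ‖z‖ := fun z hz =>
    (h.norm_le_of_attracting hA h0 le_rfl hz).trans
      (mul_le_of_le_one_left (norm_nonneg _) (max_lt hκ hz).le)
  have hD : ∀ z, ‖z‖ < 1 → ‖φ z‖ < 1 := fun z hz => (hle z hz).trans_lt hz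
  have hlen : ∀ k z, ‖z‖ < 1 → ‖φ^[k] z‖ ≤ ‖z‖ := by
    intro k
    induction k with
    | zero => intro z _; exact le_rfl
    | succ k ih => intro z hz; exact (ih _ (hD z hz)).trans (hle z hz)
  by_contra hne
  set y := φ^[m] z with hy
  have hy1 : ‖y‖ < 1 := iterate_norm_lt hD m hz
  obtain ⟨q, rfl⟩ : ∃ q, n = q + 1 + m := ⟨n - m - 1, by omega⟩
  rw [Function.iterate_add_apply, ← hy, Function.iterate_succ_apply] at he
  have h1 : ‖y‖ ≤ ‖φ y‖ := by
    conv_lhs => rw [← he]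
    exact hlen q _ (hD y hy1)
  have hy0 : 0 < ‖y‖ := norm_pos_iff.2 hne
  have h2 := h.norm_le_of_attracting hA h0 le_rfl hy1
  have h3 := mul_lt_of_lt_one_left hy0 (max_lt hκ hy1)
  linarith

/-- The case of an attracting fixed point at the origin. -/
theorem exists_uniform_of_attracting {S s : ℝ} (hs0 : 0 < s) (hs : s < S) {F : K → K → K}
    {A : K → PowerSeries K} (hA : ∀ c, ‖c‖ < S → HasExp 1 (A c) (F c))
    (hA1 : ∀ c, ‖c‖ < S → ∀ n, ‖PowerSeries.coeff n (A c)‖ ≤ 1)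
    (hAn : ∀ n, An S (fun c => PowerSeries.coeff n (A c)))
    (hF0 : ∀ c, ‖c‖ < S → F c 0 = 0)
    (hnc : ∀ c, ‖c‖ < S → ∃ z, ‖z‖ < 1 ∧ F c z ≠ 0) {κ : ℝ} (hκ1 : κ < 1)
    (hκ : ∀ c, ‖c‖ < S → ‖PowerSeries.coeff 1 (A c)‖ ≤ κ) {α : K → K} {ρ : ℝ} (hρ1 : ρ < 1)
    (hα : ∀ c, ‖c‖ < S → ‖α c‖ ≤ ρ) :
    ∃ E : Set K, E.Finite ∧ ∃ n, ∀ c, ‖c‖ ≤ s → c ∉ E → (∃ k, (F c)^[k] (α c) = 0) →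
      (∀ x, ‖x‖ < 1 → deriv (F c) x = 0 → ∃ k, (F c)^[k] x = 0) → (F c)^[n] (α c) = 0 := by
  classical
  have hS := hs0.trans hs
  have hnc' : ∀ c, ‖c‖ < S → ∃ n, PowerSeries.coeff n (A c) ≠ 0 := by
    intro c hc
    by_contra! hcon
    obtain ⟨z, hz, hne⟩ := hnc c hc
    refine hne (((hA c hc).hasSum z hz).unique ?_)
    simp [hcon, hasSum_zero]
  have hex : ∃ m, ∃ c, ‖c‖ < S ∧ PowerSeries.coeff m (A c) ≠ 0 := by
    obtain ⟨m, hm⟩ := hnc' 0 (by simpa using hS)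
    exact ⟨m, 0, by simpa using hS, hm⟩
  -- The generic order of vanishing at 0: a coefficient that vanishes at one parameter only does not
  -- count.
  set m := Nat.find hex with hm
  have hm_ne : ∃ c, ‖c‖ < S ∧ PowerSeries.coeff m (A c) ≠ 0 := Nat.find_spec hex
  have hlow : ∀ i, i < m → ∀ c, ‖c‖ < S → PowerSeries.coeff i (A c) = 0 := by
    intro i hi c hc
    by_contra hne
    exact Nat.find_min hex hi ⟨c, hc, hne⟩
  have hm1 : 1 ≤ m := by
    by_contra hlt
    obtain ⟨c, hc, hne⟩ := hm_ne
    rw [show m = 0 by omega, ← (hA c hc).zero_eq one_pos] at hne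
    exact hne (hF0 c hc)
  set Z := {c : K | ‖c‖ ≤ s ∧ PowerSeries.coeff m (A c) = 0} with hZ
  have hZfin : Z.Finite := (hAn m).finite_zeros hs hm_ne
  -- near a zero of the leading coefficient some critical point is not eventually fixed
  have hnear : ∀ c₀, c₀ ∈ Z → ∃ δ > 0, ∀ c, ‖c‖ ≤ s → c ∉ Z → ‖c - c₀‖ < δ →
      ¬ ∀ x, ‖x‖ < 1 → deriv (F c) x = 0 → ∃ k, (F c)^[k] x = 0 := by
    rintro c₀ ⟨hc₀, hc₀0⟩
    have hc₀S := hc₀.trans_lt hs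
    have hexe := hnc' c₀ hc₀S
    set e := Nat.find hexe with he
    have hene : PowerSeries.coeff e (A c₀) ≠ 0 := Nat.find_spec hexe
    have helow : ∀ i, i < e → PowerSeries.coeff i (A c₀) = 0 := fun i hi => by
      by_contra hne
      exact Nat.find_min hexe hi hne
    have hme : m < e := by
      rcases lt_trichotomy m e with h | h | h
      · exact h
      · exact absurd (h ▸ hc₀0) hene
      · exact absurd (hlow e h c₀ hc₀S) hene
    set A0 := ‖PowerSeries.coeff e (A c₀)‖ with hA0
    have hA0pos : 0 < A0 := norm_pos_iff.2 hene
    have he0 : 0 < ‖(e : K)‖ := norm_pos_iff.2 (by exact_mod_cast (by omega : e ≠ 0))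
    -- The halves in `r`, `r'` and `η` make the three inequalities required by
    -- `not_forall_critical_eventually_zero` strict. For `c` close to `c₀` the coefficients below
    -- `e` stay under `η` and the `e`-th one keeps its norm.
    set r := ‖(e : K)‖ * A0 / 2 with hr
    have hr0 : 0 < r := by positivity
    set r' := ‖(e : K)‖ * r / 2 with hr'
    have hr0' : 0 < r' := by positivity
    set η := ‖(e : K)‖ * A0 * r' ^ e / 2 with hη
    have hη0 : 0 < η := by positivity
    have hr1 : r < 1 := by
      have h1 : ‖(e : K)‖ ≤ 1 := IsUltrametricDist.norm_natCast_le_one K e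
      have h2 : ‖(e : K)‖ * A0 ≤ 1 := mul_le_one₀ h1 hA0pos.le (hA1 c₀ hc₀S e)
      linarith
    have hcont : ∀ i, ∀ ε > 0, ∀ᶠ c in 𝓝 c₀,
        ‖PowerSeries.coeff i (A c) - PowerSeries.coeff i (A c₀)‖ < ε := by
      intro i ε hε
      have := ((hAn i).continuousAt hc₀S).tendsto
      rw [Metric.tendsto_nhds] at this
      simpa [dist_eq_norm] using this ε hε
    have hev : ∀ᶠ c in 𝓝 c₀,
        (∀ i ∈ Finset.range e, ‖PowerSeries.coeff i (A c) - PowerSeries.coeff i (A c₀)‖ < η) ∧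
          ‖PowerSeries.coeff e (A c) - PowerSeries.coeff e (A c₀)‖ < A0 :=
      ((Finset.eventually_all _).2 fun i _ => hcont i η hη0).and (hcont e A0 hA0pos)
    obtain ⟨δ, hδ0, hδ⟩ := Metric.eventually_nhds_iff.1 hev
    refine ⟨δ, hδ0, fun c hc hcZ hcδ hcrit => ?_⟩
    have hcS := hc.trans_lt hs
    obtain ⟨h1, h2⟩ := hδ (by rwa [dist_eq_norm])
    have hAe : ‖PowerSeries.coeff e (A c)‖ = A0 := by
      refine norm_eq_of_norm_sub_lt ?_
      rwa [norm_sub_rev]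
    refine not_forall_critical_eventually_zero (hA c hcS) (hA1 c hcS) hm1 hme
      (fun i hi => hlow i hi c hcS) (fun h => hcZ ⟨hc, h⟩) (r := r) (r' := r') (η := η) hr0'
      (fun i hi => ?_) ?_ ?_ ?_ fun x hx h0 => hcrit x (hx.trans_lt hr1) h0
    · have := (h1 i (Finset.mem_range.2 hi)).le
      rwa [helow i hi, sub_zero] at this
    · rw [hAe]; exact half_lt_self (by positivity)
    · rw [hAe]; exact half_lt_self (by positivity)
    · exact half_lt_self (by positivity)
  have hnear' : ∀ c₀, ∃ δ > 0, c₀ ∈ Z → ∀ c, ‖c‖ ≤ s → c ∉ Z → ‖c - c₀‖ < δ →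
      ¬ ∀ x, ‖x‖ < 1 → deriv (F c) x = 0 → ∃ k, (F c)^[k] x = 0 := by
    intro c₀
    by_cases h : c₀ ∈ Z
    · obtain ⟨δ, hδ0, hδ⟩ := hnear c₀ h
      exact ⟨δ, hδ0, fun _ => hδ⟩
    · exact ⟨1, one_pos, fun h' => absurd h' h⟩
  choose δ hδ0 hδ using hnear'
  -- away from the zeros, the leading coefficient is bounded below
  obtain ⟨T, u, hu, hT, hu0, hfac⟩ := (hAn m).exists_factorization hs0 hs hm_ne
  have hTZ : ∀ w ∈ T, w ∈ Z := by
    intro w hw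
    refine ⟨hT w hw, ?_⟩
    rw [hfac w ((hT w hw).trans_lt hs), Multiset.prod_eq_zero, zero_mul]
    exact Multiset.mem_map.2 ⟨w, hw, sub_self w⟩
  -- In the factorization of the `m`-th coefficient each linear factor is at least `δ w` away from
  -- the excluded disks, and the unit `u` has constant norm.
  set μ := (T.map δ).prod * ‖u 0‖ with hμ
  have hμ0 : 0 < μ := by
    refine mul_pos (Multiset.prod_induction (fun x => 0 < x) _ (fun _ _ => mul_pos) one_pos ?_)
      (norm_pos_iff.2 (hu0 0 (by simpa using hs0.le)))
    intro x hx
    obtain ⟨w, -, rfl⟩ := Multiset.mem_map.1 hx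
    exact hδ0 w
  have hlower : ∀ c, ‖c‖ ≤ s → (∀ w ∈ T, δ w ≤ ‖c - w‖) → μ ≤ ‖PowerSeries.coeff m (A c)‖ := by
    intro c hc hcT
    rw [hfac c (hc.trans_lt hs), norm_mul, hu.norm_eq_of_ne_zero hs0 hs hu0 hc, hμ]
    gcongr
    have : ‖(T.map fun w => c - w).prod‖ = (T.map fun w => ‖c - w‖).prod := by
      have := map_multiset_prod (normHom : K →*₀ ℝ) (T.map fun w => c - w)
      rw [Multiset.map_map] at this
      exact this
    rw [this]
    exact Multiset.prod_map_le_prod_map₀ _ _ (fun w _ => (hδ0 w).le) hcT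
  have hκm : max κ ρ < 1 := max_lt hκ1 hρ1
  have hκm0 : 0 ≤ max κ ρ :=
    le_max_of_le_right ((norm_nonneg _).trans (hα 0 (by simpa using hS)))
  obtain ⟨n, hn⟩ := exists_pow_lt_of_lt_one hμ0 hκm
  refine ⟨Z, hZfin, n, fun c hc hcZ ⟨k, hk⟩ hcrit => ?_⟩
  have hcS := hc.trans_lt hs
  have hcT : ∀ w ∈ T, δ w ≤ ‖c - w‖ := by
    intro w hw
    by_contra! hlt
    exact hδ w (hTZ w hw) c hc hcZ hlt hcrit
  have hμc := hlower c hc hcT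
  refine iterate_eq_zero_of_small (hF0 c hcS) (δ := μ) (fun y hy hy0 => ?_) (fun k hk => ?_) hk
  · by_contra hne
    have hypos : 0 < ‖y‖ := norm_pos_iff.2 hne
    have hylt := hy.trans_le hμc
    have hy1 : ‖y‖ < 1 := hylt.trans_le (hA1 c hcS m)
    have := (hA c hcS).norm_eq_of_dominant hy1 (e := m) (B := ‖y‖ * ‖y‖ ^ m) (fun i hi => ?_)
      (mul_lt_mul_of_pos_right hylt (pow_pos hypos m))
    · rw [hy0, norm_zero] at this
      have h2 : 0 < ‖PowerSeries.coeff m (A c)‖ * ‖y‖ ^ m :=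
        mul_pos (hypos.trans hylt) (pow_pos hypos m)
      linarith
    · rcases lt_or_gt_of_ne hi with h | h
      · rw [hlow i h c hcS]; simp; positivity
      · calc _ ≤ 1 * ‖y‖ ^ (m + 1) := by
              refine mul_le_mul (hA1 c hcS i) ?_ (by positivity) zero_le_one
              exact pow_le_pow_of_le_one (norm_nonneg _) hy1.le h
          _ = _ := by rw [one_mul, pow_succ, mul_comm]
  · have hit : ∀ k, ‖(F c)^[k] (α c)‖ ≤ max κ ρ ^ k ∧ ‖(F c)^[k] (α c)‖ ≤ ρ := by
      intro k
      induction k with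
      | zero => exact ⟨by simpa using (hα c hcS).trans hρ1.le, hα c hcS⟩
      | succ k ih =>
        have h1 := (hA c hcS).norm_le_of_attracting (hA1 c hcS) (hF0 c hcS) (hκ c hcS)
          (ih.2.trans_lt hρ1)
        have h2 : ‖F c ((F c)^[k] (α c))‖ ≤ max κ ρ * ‖(F c)^[k] (α c)‖ := by
          refine h1.trans ?_
          gcongr
          exact ih.2
        rw [Function.iterate_succ_apply']
        refine ⟨h2.trans ?_, h2.trans ((mul_le_of_le_one_left (norm_nonneg _) hκm.le).trans ih.2)⟩
        rw [pow_succ, mul_comm]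
        gcongr
        exact ih.1
    exact (hit k).1.trans_lt ((pow_le_pow_of_le_one hκm0 hκm.le hk).trans_lt hn)

theorem iterate_conj_sub {φ : K → K} {b : K} (k : ℕ) (z : K) :
    (fun z => φ (z + b) - b)^[k] z = φ^[k] (z + b) - b := by
  induction k generalizing z with
  | zero => simp
  | succ k ih =>
    rw [Function.iterate_succ_apply, ih, Function.iterate_succ_apply, sub_add_cancel]

theorem IsPreperiodic.conj_sub {φ : K → K} {b z : K} (h : IsPreperiodic φ (z + b)) :
    IsPreperiodic (fun z => φ (z + b) - b) z := by
  obtain ⟨m, n, hmn, he⟩ := h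
  exact ⟨m, n, hmn, by rw [iterate_conj_sub, iterate_conj_sub, he]⟩

/-- In an analytic family of self-maps of the unit disk with a marked point, the parameters for
which the marked point and all critical points are preperiodic satisfy, up to finitely many, one
fixed orbit relation. -/
theorem exists_uniform_orbit_relation {p : ℕ} (hp : p.Prime) (hpn : ‖(p : K)‖ < 1) {S s : ℝ}
    (hs0 : 0 < s) (hs : s < S) {F : K → K → K} (hz : ∀ c, ‖c‖ < S → An 1 (F c))
    (hD : ∀ c, ‖c‖ < S → ∀ z, ‖z‖ < 1 → ‖F c z‖ < 1)
    (hc : ∀ z, ‖z‖ < 1 → An S (fun c => F c z))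
    (hnc : ∀ c, ‖c‖ < S → ∃ z w, ‖z‖ < 1 ∧ ‖w‖ < 1 ∧ F c z ≠ F c w) {α : K → K} (hα : An S α)
    (hα1 : ∀ c, ‖c‖ < S → ‖α c‖ < 1) :
    ∃ E : Set K, E.Finite ∧ ∃ m n, m < n ∧ ∀ c, ‖c‖ ≤ s → c ∉ E → IsPreperiodic (F c) (α c) →
      (∀ x, ‖x‖ < 1 → deriv (F c) x = 0 → IsPreperiodic (F c) x) →
      (F c)^[n] (α c) = (F c)^[m] (α c) := by
  have hS := hs0.trans hs
  choose! A hA using hz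
  have hA1 : ∀ c, ‖c‖ < S → ∀ n, ‖PowerSeries.coeff n (A c)‖ ≤ 1 := fun c hcS n =>
    (hA c hcS).norm_coeff_le_one (fun z hz => (hD c hcS z hz).le) n
  have hAn : ∀ n, An S (fun c => PowerSeries.coeff n (A c)) := An.coeff_of_family hS hA hA1 hc
  obtain ⟨s', hss', hs'S⟩ := exists_between hs
  have hs'0 := hs0.trans hss'
  obtain ⟨ρ₁, hρ₁0, hρ₁1, hρ₁⟩ := hα.exists_bound_lt hS hα1 hs'0 hs'S
  obtain ⟨ρ₂, -, hρ₂1, hρ₂⟩ := (hc 0 (by simp)).exists_bound_lt hS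
    (fun c hcS => hD c hcS 0 (by simp)) hs'0 hs'S
  set ρ := max ρ₁ ρ₂ with hρ
  have hρ1 : ρ < 1 := max_lt hρ₁1 hρ₂1
  have hρ0 : 0 < ρ := lt_max_of_lt_left hρ₁0
  have hαρ : ∀ c, ‖c‖ ≤ s' → ‖α c‖ ≤ ρ := fun c h => (hρ₁ c h).trans (le_max_left _ _)
  have hFρ : ∀ c, ‖c‖ ≤ s' → ‖F c 0‖ ≤ ρ := fun c h => (hρ₂ c h).trans (le_max_right _ _)
  -- The disk of radius `R` contains the marked points and the orbits of 0, while `R < 1` makes the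
  -- terms of degree at least two strictly contracting.
  obtain ⟨R, hρR, hR1⟩ := exists_between hρ1
  have hR0 := hρ0.trans hρR
  have hlip : ∀ c, ‖c‖ < S → ∀ z w, ‖z‖ < 1 → ‖w‖ < 1 → ‖F c z - F c w‖ ≤ ‖z - w‖ := by
    intro c hcS z w hz hw
    have := An.lipschitz ⟨_, hA c hcS⟩ (fun z hz => (hD c hcS z hz).le) hz hw
    simpa using this
  have hself : ∀ c, ‖c‖ ≤ s' → ∀ r, ρ ≤ r → r < 1 → ∀ z, ‖z‖ ≤ r → ‖F c z‖ ≤ r := by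
    intro c hcs r hr hr1 z hz
    have h1 := hlip c (hcs.trans_lt hs'S) z 0 (hz.trans_lt hr1) (by simp)
    rw [sub_zero] at h1
    have := norm_add_le_of_le' (h1.trans hz) ((hFρ c hcs).trans hr)
    rwa [sub_add_cancel] at this
  -- The multiplier `c ↦ coeff 1 (A c)` is bounded by 1 on the disk of radius `S`, so by the Schwarz
  -- lemma it varies by at most `τ < 1` on the closed disk of radius `s'`. The same case of the
  -- dichotomy thus holds for all these parameters.
  set τ := s' / S with hτ
  have hτ1 : τ < 1 := (div_lt_one hS).2 hs'S
  have hτ0 : 0 ≤ τ := by positivity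
  set a := PowerSeries.coeff 1 (A 0) with ha
  have ha1 : ∀ c, ‖c‖ ≤ s' → ‖PowerSeries.coeff 1 (A c) - a‖ ≤ τ := by
    intro c hcs
    have := (hAn 1).lipschitz (fun c hcS => hA1 c hcS 1) (hcs.trans_lt hs'S) (w := 0)
      (by simpa using hS)
    rw [sub_zero] at this
    refine this.trans ?_
    rw [hτ, div_mul_eq_mul_div, one_mul]
    gcongr
  have hlin : ∀ c, ‖c‖ ≤ s' → ∀ z w, ‖z‖ < R → ‖w‖ < R →
      ‖F c z - F c w - a * (z - w)‖ ≤ max R τ * ‖z - w‖ := by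
    intro c hcs z w hz hw
    have hcS := hcs.trans_lt hs'S
    have h1 := ((hA c hcS).norm_sub_sub_linear_le (hA1 c hcS) hR1.le hz hw).trans
      (mul_le_mul_of_nonneg_right (le_max_left R τ) (norm_nonneg _))
    have h2 : ‖(PowerSeries.coeff 1 (A c) - a) * (z - w)‖ ≤ max R τ * ‖z - w‖ := by
      rw [norm_mul]
      gcongr
      exact (ha1 c hcs).trans (le_max_right _ _)
    have := norm_add_le_of_le' h1 h2
    convert this using 2; ring
  have hτR : max R τ < 1 := max_lt hR1 hτ1
  rcases (hA1 0 (by simpa using hS) 1).lt_or_eq with hlt | heq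
  · -- attracting case
    set κ := max ‖a‖ (max R τ) with hκ
    have hκ1 : κ < 1 := max_lt hlt hτR
    have hκ0 : 0 ≤ κ := le_max_of_le_left (norm_nonneg _)
    have hcontr : ∀ c, ‖c‖ ≤ s' → ∀ z w, ‖z‖ < R → ‖w‖ < R → ‖F c z - F c w‖ ≤ κ * ‖z - w‖ := by
      intro c hcs z w hz hw
      have h1 := (hlin c hcs z w hz hw).trans
        (mul_le_mul_of_nonneg_right (le_max_right ‖a‖ (max R τ)) (norm_nonneg _))
      have h2 : ‖a * (z - w)‖ ≤ κ * ‖z - w‖ := by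
        rw [norm_mul]; gcongr; exact le_max_left _ _
      have := norm_add_le_of_le' h1 h2
      rwa [sub_add_cancel] at this
    have hbρ : ∀ c, ‖c‖ ≤ s' → ∀ k, ‖(F c)^[k] 0‖ ≤ ρ := by
      intro c hcs k
      induction k with
      | zero => simpa using hρ0.le
      | succ k ih =>
        rw [Function.iterate_succ_apply']
        exact hself c hcs ρ le_rfl hρ1 _ ih
    have hbstep : ∀ c, ‖c‖ ≤ s' → ∀ k, ‖(F c)^[k + 1] 0 - (F c)^[k] 0‖ ≤ κ ^ k := by
      intro c hcs k
      induction k with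
      | zero => simpa using (hFρ c hcs).trans hρ1.le
      | succ k ih =>
        rw [Function.iterate_succ_apply' _ (k + 1), Function.iterate_succ_apply' _ k]
        rw [Function.iterate_succ_apply'] at ih
        refine (hcontr c hcs _ _ ?_ ((hbρ c hcs k).trans_lt hρR)).trans ?_
        · rw [← Function.iterate_succ_apply' (F c) k 0]
          exact (hbρ c hcs (k + 1)).trans_lt hρR
        · rw [pow_succ, mul_comm]; gcongr
    -- The fixed point is the limit of the orbit of 0. The rate `κ ^ k` does not depend on `c`, so
    -- the limit is analytic in `c`.
    have hlim : ∀ c, ‖c‖ ≤ s' → ∃ b, Tendsto (fun k => (F c)^[k] 0) atTop (𝓝 b) := by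
      intro c hcs
      refine cauchySeq_tendsto_of_complete ?_
      refine NonarchimedeanAddGroup.cauchySeq_of_tendsto_sub_nhds_zero ?_
      exact squeeze_zero_norm (hbstep c hcs) (tendsto_pow_atTop_nhds_zero_of_lt_one hκ0 hκ1)
    choose! β hβ using hlim
    have hβρ : ∀ c, ‖c‖ ≤ s' → ‖β c‖ ≤ ρ := fun c hcs =>
      le_of_tendsto (hβ c hcs).norm (Eventually.of_forall (hbρ c hcs))
    have hβfix : ∀ c, ‖c‖ ≤ s' → F c (β c) = β c := by
      intro c hcs
      have h1 := (An.continuousAt ⟨_, hA c (hcs.trans_lt hs'S)⟩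
        ((hβρ c hcs).trans_lt hρ1)).tendsto.comp (hβ c hcs)
      have h2 := (tendsto_add_atTop_iff_nat 1).2 (hβ c hcs)
      refine tendsto_nhds_unique h1 (h2.congr fun k => ?_)
      rw [Function.iterate_succ_apply', Function.comp]
    have hbdiff : ∀ c, ‖c‖ ≤ s' → ∀ k, ‖β c - (F c)^[k] 0‖ ≤ κ ^ k := by
      intro c hcs k
      induction k with
      | zero => simpa using (hβρ c hcs).trans hρ1.le
      | succ k ih =>
        rw [Function.iterate_succ_apply']
        conv_lhs => rw [← hβfix c hcs]
        refine (hcontr c hcs _ _ ((hβρ c hcs).trans_lt hρR)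
          ((hbρ c hcs k).trans_lt hρR)).trans ?_
        rw [pow_succ, mul_comm]; gcongr
    have hA' : ∀ c, ‖c‖ < s' → HasExp 1 (A c) (F c) := fun c h => hA c (h.trans hs'S)
    have hA1' : ∀ c, ‖c‖ < s' → ∀ n, ‖PowerSeries.coeff n (A c)‖ ≤ 1 :=
      fun c h => hA1 c (h.trans hs'S)
    have hAn' : ∀ n, An s' (fun c => PowerSeries.coeff n (A c)) := fun n => (hAn n).mono hs'S.le
    have hbAn : ∀ k, An s' (fun c => (F c)^[k] 0) := by
      intro k
      induction k with
      | zero => exact An.const s' 0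
      | succ k ih =>
        refine (An.eval_family hs'0 hρ0.le hρ1 hA' hA1' hAn' ih
          fun c h => hbρ c h.le k).congr fun c _ => ?_
        rw [Function.iterate_succ_apply']
    have hβAn : An s' β := by
      refine An.of_uniform_approx hs'0 fun ε hε => ?_
      obtain ⟨k, hk⟩ := exists_pow_lt_of_lt_one hε hκ1
      exact ⟨_, hbAn k, fun c h => (hbdiff c h.le k).trans hk.le⟩
    -- move the fixed point to the origin
    set F' : K → K → K := fun c z => F c (z + β c) - β c with hF'
    have hz' : ∀ c, ‖c‖ < s' → An 1 (F' c) := fun c h =>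
      (An.translate ⟨_, hA' c h⟩ ((hβρ c h.le).trans_lt hρ1)).sub (An.const 1 _)
    have hβ1 : ∀ c, ‖c‖ < s' → ‖β c‖ < 1 := fun c h => (hβρ c h.le).trans_lt hρ1
    have hD' : ∀ c, ‖c‖ < s' → ∀ z, ‖z‖ < 1 → ‖F' c z‖ < 1 := fun c h z hz =>
      norm_sub_lt_of_lt (hD c (h.trans hs'S) _ (norm_add_lt_of_lt' hz (hβ1 c h))) (hβ1 c h)
    choose! B hB using hz'
    have hB1 : ∀ c, ‖c‖ < s' → ∀ n, ‖PowerSeries.coeff n (B c)‖ ≤ 1 := fun c hcS n =>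
      (hB c hcS).norm_coeff_le_one (fun z hz => (hD' c hcS z hz).le) n
    have hc' : ∀ z, ‖z‖ < 1 → An s' (fun c => F' c z) := by
      intro z hz
      refine (An.eval_family hs'0 (le_max_of_le_right hρ0.le) (max_lt hz hρ1) hA' hA1' hAn'
        ((An.const s' z).add hβAn) fun c h => ?_).sub hβAn
      exact norm_add_le_of_le' (le_max_left _ _) ((hβρ c h.le).trans (le_max_right _ _))
    have hBn := An.coeff_of_family hs'0 hB hB1 hc'
    have hF'0 : ∀ c, ‖c‖ < s' → F' c 0 = 0 := fun c h => by
      simp only [hF', zero_add]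
      rw [hβfix c h.le, sub_self]
    have hnc' : ∀ c, ‖c‖ < s' → ∃ z, ‖z‖ < 1 ∧ F' c z ≠ 0 := by
      intro c h
      by_contra! hcon
      have hconst : ∀ z, ‖z‖ < 1 → F c z = β c := by
        intro z hz
        have := hcon (z - β c) (norm_sub_lt_of_lt hz (hβ1 c h))
        simp only [hF', sub_add_cancel] at this
        exact sub_eq_zero.1 this
      obtain ⟨z, w, hz, hw, hne⟩ := hnc c (h.trans hs'S)
      exact hne ((hconst z hz).trans (hconst w hw).symm)
    have hκ' : ∀ c, ‖c‖ < s' → ‖PowerSeries.coeff 1 (B c)‖ ≤ κ := by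
      intro c h
      have h1 : An R (F' c) := An.mono ⟨_, hB c h⟩ hR1.le
      have h2 : ∀ z, ‖z‖ < R → ‖F' c z‖ ≤ κ * R := by
        intro z hz
        have hβR : ‖β c‖ < R := (hβρ c h.le).trans_lt hρR
        have := hcontr c h.le (z + β c) (β c) (norm_add_lt_of_lt' hz hβR) hβR
        rw [hβfix c h.le, add_sub_cancel_right] at this
        exact this.trans (mul_le_mul_of_nonneg_left hz.le hκ0)
      have h3 := h1.norm_deriv_le h2 (w := 0) (by simpa using hR0)
      rwa [((hB c h).hasDerivAt_zero one_pos).deriv, mul_div_cancel_right₀ _ hR0.ne'] at h3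
    obtain ⟨E, hE, n, hn⟩ := exists_uniform_of_attracting hs0 hss' hB hB1 hBn hF'0 hnc' hκ1 hκ'
      (α := fun c => α c - β c) hρ1 (fun c h => norm_sub_le_of_le (hαρ c h.le) (hβρ c h.le))
    refine ⟨E, hE, n, n + 1, Nat.lt_succ_self n, fun c hcs hcE hpre hcrit => ?_⟩
    have hcs' := hcs.trans_lt hss'
    have hzero : ∀ z, ‖z‖ < 1 → IsPreperiodic (F c) (z + β c) → ∃ k, (F' c)^[k] z = 0 :=
      fun z hz h => (hB c hcs').eventually_zero_of_preperiodic (hB1 c hcs') (hF'0 c hcs')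
        ((hκ' c hcs').trans_lt hκ1) hz h.conj_sub
    have hfin := hn c hcs hcE (hzero _ (norm_sub_lt_of_lt (hα1 c (hcs'.trans hs'S)) (hβ1 c hcs'))
      (by rwa [sub_add_cancel])) (fun x hx h0 => hzero x hx (hcrit _
        (norm_add_lt_of_lt' hx (hβ1 c hcs')) ?_))
    · rw [hF', iterate_conj_sub, sub_add_cancel, sub_eq_zero] at hfin
      rw [Function.iterate_succ_apply', hfin, hβfix c hcs'.le]
    · rw [hF'] at h0
      simpa [deriv_comp_add_const] using h0
  · -- indifferent case
    obtain ⟨l, hl0, hl⟩ := exists_iterate_fixed_of_rotation hp hpn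
      (le_max_of_le_left hR0.le) hτR heq
    refine ⟨∅, Set.finite_empty, 0, l, Nat.pos_of_ne_zero hl0, fun c hcs _ hpre _ => ?_⟩
    have hcs' : ‖c‖ ≤ s' := hcs.trans hss'.le
    refine hl hR0 (An.mono ⟨_, hA c (hcs'.trans_lt hs'S)⟩ hR1.le) (fun z hz => ?_)
      (hlin c hcs') _ ((hαρ c hcs').trans_lt hρR) hpre
    exact (hself c hcs' (max ρ ‖z‖) (le_max_left _ _) (max_lt hρ1 (hz.trans hR1)) z
      (le_max_right _ _)).trans_lt (max_lt hρR hz)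

end Families

/-! ### Preperiodicity under iteration and semiconjugacy. -/

section Preperiodic

variable {X : Type*} {T : X → X} {x : X}

theorem IsPreperiodic.of_iterate {j : ℕ} (h : IsPreperiodic T (T^[j] x)) : IsPreperiodic T x := by
  obtain ⟨m, n, hmn, h⟩ := h
  exact ⟨m + j, n + j, by omega, by rwa [Function.iterate_add_apply, Function.iterate_add_apply]⟩

theorem IsPreperiodic.iterate (h : IsPreperiodic T x) (j : ℕ) : IsPreperiodic T (T^[j] x) := by
  obtain ⟨m, n, hmn, h⟩ := h
  refine ⟨m, n, hmn, ?_⟩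
  rw [← Function.iterate_add_apply, ← Function.iterate_add_apply, add_comm n, add_comm m,
    Function.iterate_add_apply, Function.iterate_add_apply, h]

theorem IsPreperiodic.pow (h : IsPreperiodic T x) {l : ℕ} (hl : 0 < l) :
    IsPreperiodic T^[l] x := by
  obtain ⟨m, n, hmn, h⟩ := h
  obtain ⟨q, rfl⟩ := Nat.exists_eq_add_of_lt hmn
  have key : ∀ i k, T^[m + k + i * (q + 1)] x = T^[m + k] x := by
    intro i
    induction i with
    | zero => simp
    | succ i ih =>
      intro k
      rw [show m + k + (i + 1) * (q + 1) = (k + i * (q + 1)) + (m + q + 1) by ring,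
        Function.iterate_add_apply, h, ← Function.iterate_add_apply,
        show k + i * (q + 1) + m = m + k + i * (q + 1) by ring, ih k]
  -- In terms of `T` these are the times `l * m` and `l * m + l * (q + 1)`. The first is past the
  -- preperiod `m` and the difference is a multiple of the period.
  refine ⟨m, m + (q + 1), by omega, ?_⟩
  rw [← Function.iterate_mul, ← Function.iterate_mul]
  obtain ⟨k, hk⟩ := Nat.exists_eq_add_of_le (Nat.le_mul_of_pos_left m hl)
  rw [mul_add, hk, key]

theorem IsPreperiodic.of_semiconj {Y : Type*} {G : Y → Y} {μ : Y → X} {D : Set Y}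
    (hD : Set.MapsTo G D D) (hμ : Set.InjOn μ D) (hs : ∀ y ∈ D, μ (G y) = T (μ y)) {y : Y}
    (hy : y ∈ D) (h : IsPreperiodic T (μ y)) : IsPreperiodic G y := by
  have hit : ∀ n, μ (G^[n] y) = T^[n] (μ y) := by
    intro n
    induction n with
    | zero => rfl
    | succ n ih =>
      rw [Function.iterate_succ_apply', Function.iterate_succ_apply', hs _ (hD.iterate n hy), ih]
  obtain ⟨m, n, hmn, h⟩ := h
  exact ⟨m, n, hmn, hμ (hD.iterate n hy) (hD.iterate m hy) (by rw [hit, hit, h])⟩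

end Preperiodic

/-! ### Rational maps in homogeneous coordinates. -/

section Projective

variable {K : Type*} [Field K]

theorem ratio_eq_ratio_iff {a b a' b' : K} (h : a ≠ 0 ∨ b ≠ 0) (h' : a' ≠ 0 ∨ b' ≠ 0) :
    ratio a b = ratio a' b' ↔ a * b' = a' * b := by
  unfold ratio
  by_cases hb : b = 0 <;> by_cases hb' : b' = 0
  · simp [hb, hb']
  · have : a ≠ 0 := by simpa [hb] using h
    simp [hb, hb', this]
  · have : a' ≠ 0 := by simpa [hb'] using h'
    simp [hb, hb', this]
  · simp only [hb, hb', if_false, OnePoint.coe_eq_coe]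
    rw [div_eq_div_iff hb hb']

theorem ratio_mul_left {k : K} (hk : k ≠ 0) (a b : K) : ratio (k * a) (k * b) = ratio a b := by
  unfold ratio
  by_cases hb : b = 0
  · simp [hb]
  · simp [hb, hk, mul_div_mul_left]

theorem ratio_of_ne {a b : K} (hb : b ≠ 0) : ratio a b = ((a / b : K) : OnePoint K) := by
  simp [ratio, hb]

theorem ratio_zero (a : K) : ratio a 0 = OnePoint.infty := by simp [ratio]

theorem exists_ratio_eq (x : OnePoint K) : ∃ a b : K, (a ≠ 0 ∨ b ≠ 0) ∧ ratio a b = x := by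
  induction x using OnePoint.rec with
  | infty => exact ⟨1, 0, by simp, ratio_zero 1⟩
  | coe z => exact ⟨z, 1, by simp, by simp [ratio]⟩

/-- The binary form of degree `d` attached to a polynomial of degree at most `d`. -/
def form (d : ℕ) (P : K[X]) (x y : K) : K :=
  ∑ i ∈ Finset.range (d + 1), P.coeff i * x ^ i * y ^ (d - i)

theorem form_of_ne {d : ℕ} {P : K[X]} (hP : P.natDegree ≤ d) (x : K) {y : K} (hy : y ≠ 0) :
    form d P x y = y ^ d * P.eval (x / y) := by
  rw [form, eval_eq_sum_range' (Nat.lt_succ_of_le hP), Finset.mul_sum]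
  refine Finset.sum_congr rfl fun i hi => ?_
  have hi : i ≤ d := by simpa [Nat.lt_succ_iff] using hi
  obtain ⟨j, rfl⟩ := Nat.exists_eq_add_of_le hi
  rw [Nat.add_sub_cancel_left, pow_add, div_pow]
  field_simp

theorem form_swap (d : ℕ) (P : K[X]) (x y : K) : form d (P.reflect d) y x = form d P x y := by
  rw [form, form, ← Finset.sum_range_reflect]
  refine Finset.sum_congr rfl fun i hi => ?_
  have hi : i ≤ d := by simpa [Nat.lt_succ_iff] using hi
  rw [coeff_reflect, show d + 1 - 1 - i = d - i by omega, revAt_le (Nat.sub_le d i),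
    Nat.sub_sub_self hi]
  ring

theorem natDegree_reflect_le' {d : ℕ} {P : K[X]} (hP : P.natDegree ≤ d) :
    (P.reflect d).natDegree ≤ d := by
  rw [natDegree_le_iff_coeff_eq_zero]
  intro i hi
  rw [coeff_reflect, revAt_eq_self_of_lt hi]
  exact coeff_eq_zero_of_natDegree_lt (hP.trans_lt hi)

theorem form_of_ne' {d : ℕ} {P : K[X]} (hP : P.natDegree ≤ d) {x : K} (y : K) (hx : x ≠ 0) :
    form d P x y = x ^ d * (P.reflect d).eval (y / x) := by
  rw [← form_swap, form_of_ne (natDegree_reflect_le' hP) _ hx]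

theorem form_zero (d : ℕ) (P : K[X]) (x : K) : form d P x 0 = P.coeff d * x ^ d := by
  rw [form, Finset.sum_range_succ, Finset.sum_eq_zero]
  · simp
  · intro i hi
    have hi := Finset.mem_range.1 hi
    rw [zero_pow (by omega), mul_zero]

theorem form_C_mul (d : ℕ) (k : K) (P : K[X]) (x y : K) :
    form d (C k * P) x y = k * form d P x y := by
  simp [form, Finset.mul_sum, mul_assoc]

/-- The self-map of the affine plane given by the binary forms of degree `d` of `a` and `b`. -/
def planeLift (d : ℕ) (a b : K[X]) (v : K × K) : K × K := (form d a v.1 v.2, form d b v.1 v.2)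

/-- `a` and `b` are, up to a common factor in `K`, the numerator and denominator of `φ`, which has
degree `d`. -/
structure IsLowestTerms (d : ℕ) (a b : K[X]) (φ : RatFunc K) : Prop where
  degree_eq : ratDegree φ = d
  exists_eq : ∃ k : K, k ≠ 0 ∧ a = C k * φ.num ∧ b = C k * φ.denom

theorem exists_num_denom_mul {a b : K[X]} (hb : b ≠ 0) :
    ∃ q : K[X], q ≠ 0 ∧
      a = (algebraMap K[X] (RatFunc K) a / algebraMap K[X] (RatFunc K) b).num * q ∧
      b = (algebraMap K[X] (RatFunc K) a / algebraMap K[X] (RatFunc K) b).denom * q := by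
  set φ := algebraMap K[X] (RatFunc K) a / algebraMap K[X] (RatFunc K) b with hφ
  have hb' : algebraMap K[X] (RatFunc K) b ≠ 0 := RatFunc.algebraMap_ne_zero hb
  have hd' : algebraMap K[X] (RatFunc K) φ.denom ≠ 0 :=
    RatFunc.algebraMap_ne_zero φ.denom_ne_zero
  have h1 : φ.num * b = a * φ.denom := by
    have h := RatFunc.num_div_denom φ
    rw [hφ, ← hφ, div_eq_div_iff hd' hb', ← map_mul, ← map_mul] at h
    exact RatFunc.algebraMap_injective K h
  have hdvd : φ.denom ∣ b :=
    φ.isCoprime_num_denom.symm.dvd_of_dvd_mul_left (h1 ▸ Dvd.intro_left _ rfl)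
  obtain ⟨q, hq⟩ := hdvd
  refine ⟨q, ?_, ?_, hq⟩
  · rintro rfl; exact hb (by rw [hq, mul_zero])
  · refine mul_right_cancel₀ φ.denom_ne_zero ?_
    rw [← h1, hq]; ring

/-- A nonconstant common factor of `a` and `b` would push the degree of the reduced fraction below
`d`. -/
theorem IsLowestTerms.of_natDegree_le {d : ℕ} {a b : K[X]} (hb : b ≠ 0) (had : a.natDegree ≤ d)
    (hbd : b.natDegree ≤ d)
    (hdeg : ratDegree (algebraMap K[X] (RatFunc K) a / algebraMap K[X] (RatFunc K) b) = d) :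
    IsLowestTerms d a b (algebraMap K[X] (RatFunc K) a / algebraMap K[X] (RatFunc K) b) := by
  refine ⟨hdeg, ?_⟩
  obtain ⟨q, hq0, ha, hb'⟩ := exists_num_denom_mul (a := a) hb
  set φ := algebraMap K[X] (RatFunc K) a / algebraMap K[X] (RatFunc K) b with hφ
  have hq : q.natDegree = 0 := by
    have h2 : φ.denom.natDegree + q.natDegree ≤ d := by
      rw [← natDegree_mul φ.denom_ne_zero hq0, ← hb']; exact hbd
    by_cases hn : φ.num = 0
    · simp only [ratDegree, hn, natDegree_zero] at hdeg
      omega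
    · have h1 : φ.num.natDegree + q.natDegree ≤ d := by
        rw [← natDegree_mul hn hq0, ← ha]; exact had
      simp only [ratDegree] at hdeg
      omega
  obtain ⟨k, rfl⟩ := natDegree_eq_zero.1 hq
  refine ⟨k, by simpa using hq0, ?_, ?_⟩
  · rw [mul_comm]; exact ha
  · rw [mul_comm]; exact hb'

theorem natDegree_max_le_ratDegree {a b : K[X]} (hb : b ≠ 0) (hab : IsCoprime a b) :
    a.natDegree ≤ ratDegree (algebraMap K[X] (RatFunc K) a / algebraMap K[X] (RatFunc K) b) ∧
    b.natDegree ≤ ratDegree (algebraMap K[X] (RatFunc K) a / algebraMap K[X] (RatFunc K) b) := by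
  obtain ⟨q, hq0, ha, hb'⟩ := exists_num_denom_mul (a := a) hb
  set φ := algebraMap K[X] (RatFunc K) a / algebraMap K[X] (RatFunc K) b with hφ
  have hu : IsUnit q := hab.isUnit_of_dvd' (ha ▸ Dvd.intro_left _ rfl) (hb' ▸ Dvd.intro_left _ rfl)
  have hq : q.natDegree = 0 := natDegree_eq_zero_of_isUnit hu
  constructor
  · calc a.natDegree = (φ.num * q).natDegree := by rw [← ha]
      _ ≤ φ.num.natDegree + q.natDegree := natDegree_mul_le
      _ ≤ _ := by rw [hq]; exact le_max_left _ _
  · calc b.natDegree = (φ.denom * q).natDegree := by rw [← hb']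
      _ ≤ φ.denom.natDegree + q.natDegree := natDegree_mul_le
      _ ≤ _ := by rw [hq]; exact le_max_right _ _

theorem natDegree_num_le {d : ℕ} {φ : RatFunc K} (h : ratDegree φ = d) : φ.num.natDegree ≤ d :=
  h ▸ le_max_left _ _

theorem natDegree_denom_le {d : ℕ} {φ : RatFunc K} (h : ratDegree φ = d) :
    φ.denom.natDegree ≤ d := h ▸ le_max_right _ _

theorem form_num_denom_ne_zero {φ : RatFunc K} {x y : K} (hxy : x ≠ 0 ∨ y ≠ 0) :
    form (ratDegree φ) φ.num x y ≠ 0 ∨ form (ratDegree φ) φ.denom x y ≠ 0 := by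
  by_contra! h
  by_cases hy : y = 0
  · have hx : x ≠ 0 := by simpa [hy] using hxy
    subst hy
    rw [form_zero, form_zero, mul_eq_zero, mul_eq_zero] at h
    have hx' := pow_ne_zero (ratDegree φ) hx
    have hn := h.1.resolve_right hx'
    have hd := h.2.resolve_right hx'
    rcases le_total φ.num.natDegree φ.denom.natDegree with h' | h'
    · rw [ratDegree, max_eq_right h', coeff_natDegree, leadingCoeff_eq_zero] at hd
      exact φ.denom_ne_zero hd
    · rw [ratDegree, max_eq_left h', coeff_natDegree, leadingCoeff_eq_zero] at hn
      rw [ratDegree, hn] at hd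
      rw [hn, natDegree_zero, Nat.le_zero] at h'
      rw [natDegree_zero, h', max_self, ← h', coeff_natDegree, leadingCoeff_eq_zero] at hd
      exact φ.denom_ne_zero hd
  · rw [form_of_ne (natDegree_num_le rfl) _ hy, form_of_ne (natDegree_denom_le rfl) _ hy,
      mul_eq_zero, mul_eq_zero] at h
    have hy' := pow_ne_zero (ratDegree φ) hy
    obtain ⟨u, v, huv⟩ := φ.isCoprime_num_denom
    have := congrArg (eval (x / y)) huv
    simp [h.1.resolve_left hy', h.2.resolve_left hy'] at this

theorem ratMap_ratio (φ : RatFunc K) {x y : K} (hxy : x ≠ 0 ∨ y ≠ 0) :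
    ratMap φ (ratio x y) =
      ratio (form (ratDegree φ) φ.num x y) (form (ratDegree φ) φ.denom x y) := by
  by_cases hy : y = 0
  · have hx : x ≠ 0 := by simpa [hy] using hxy
    subst hy
    rw [form_zero, form_zero, mul_comm, mul_comm (φ.denom.coeff _),
      ratio_mul_left (pow_ne_zero _ hx), ratio_zero]
    rfl
  · rw [form_of_ne (natDegree_num_le rfl) _ hy, form_of_ne (natDegree_denom_le rfl) _ hy,
      ratio_mul_left (pow_ne_zero _ hy), ratio_of_ne hy]
    rfl

namespace IsLowestTerms

variable {d : ℕ} {a b : K[X]} {φ : RatFunc K}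

theorem planeLift_ne_zero (h : IsLowestTerms d a b φ) {v : K × K} (hv : v.1 ≠ 0 ∨ v.2 ≠ 0) :
    (planeLift d a b v).1 ≠ 0 ∨ (planeLift d a b v).2 ≠ 0 := by
  obtain ⟨rfl, k, hk, rfl, rfl⟩ := h
  simpa [planeLift, form_C_mul, hk] using form_num_denom_ne_zero (φ := φ) hv

theorem ratMap_ratio (h : IsLowestTerms d a b φ) {v : K × K} (hv : v.1 ≠ 0 ∨ v.2 ≠ 0) :
    ratMap φ (ratio v.1 v.2) = ratio (planeLift d a b v).1 (planeLift d a b v).2 := by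
  obtain ⟨rfl, k, hk, rfl, rfl⟩ := h
  simp only [planeLift, form_C_mul]
  rw [ratio_mul_left hk, PadicFamily.ratMap_ratio φ hv]

theorem iterate_planeLift (h : IsLowestTerms d a b φ) {v : K × K} (hv : v.1 ≠ 0 ∨ v.2 ≠ 0)
    (n : ℕ) :
    (((planeLift d a b)^[n] v).1 ≠ 0 ∨ ((planeLift d a b)^[n] v).2 ≠ 0) ∧
    (ratMap φ)^[n] (ratio v.1 v.2) =
      ratio ((planeLift d a b)^[n] v).1 ((planeLift d a b)^[n] v).2 := by
  induction n with
  | zero => exact ⟨hv, rfl⟩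
  | succ n ih =>
    rw [Function.iterate_succ_apply', Function.iterate_succ_apply', ih.2]
    exact ⟨h.planeLift_ne_zero ih.1, h.ratMap_ratio ih.1⟩

theorem natDegree_le (h : IsLowestTerms d a b φ) : a.natDegree ≤ d ∧ b.natDegree ≤ d := by
  obtain ⟨rfl, k, hk, rfl, rfl⟩ := h
  exact ⟨(natDegree_C_mul_le _ _).trans (natDegree_num_le rfl),
    (natDegree_C_mul_le _ _).trans (natDegree_denom_le rfl)⟩

theorem isCriticalPoint_of_ne (h : IsLowestTerms d a b φ) {x y : K} (hy : y ≠ 0)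
    (hw : (wronskian a b).eval (x / y) = 0) : IsCriticalPoint φ (ratio x y) := by
  obtain ⟨rfl, k, hk, rfl, rfl⟩ := h
  rw [ratio_of_ne hy]
  show (wronskian φ.num φ.denom).eval (x / y) = 0
  have : wronskian (C k * φ.num) (C k * φ.denom) = C (k ^ 2) * wronskian φ.num φ.denom := by
    simp only [wronskian, derivative_mul, derivative_C, C_pow]; ring
  simpa [this, hk] using hw

theorem isCriticalPoint_infty (h : IsLowestTerms d a b φ)
    (hw : (wronskian (a.reflect d) (b.reflect d)).eval 0 = 0) :
    IsCriticalPoint φ OnePoint.infty := by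
  obtain ⟨rfl, k, hk, rfl, rfl⟩ := h
  show (wronskian (φ.num.reflect (ratDegree φ)) (φ.denom.reflect (ratDegree φ))).eval 0 = 0
  rw [reflect_C_mul, reflect_C_mul] at hw
  generalize φ.num.reflect (ratDegree φ) = P at *
  generalize φ.denom.reflect (ratDegree φ) = Q at *
  have : wronskian (C k * P) (C k * Q) = C (k ^ 2) * wronskian P Q := by
    simp only [wronskian, derivative_mul, derivative_C, C_pow]; ring
  simpa [this, hk] using hw

end IsLowestTerms

/-- The finite preimages of `[u : v]` are roots of `v * num - u * denom`, which is nonzero because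
`φ` is not constant. -/
theorem finite_preimage_ratMap {φ : RatFunc K} (hd : 1 ≤ ratDegree φ) (w : OnePoint K) :
    (ratMap φ ⁻¹' {w}).Finite := by
  obtain ⟨u, v, huv, rfl⟩ := exists_ratio_eq w
  have hP : C v * φ.num - C u * φ.denom ≠ 0 := by
    intro h
    rw [sub_eq_zero] at h
    have hv : v ≠ 0 := by
      rintro rfl
      have hu : u ≠ 0 := by simpa using huv
      simp [hu, φ.denom_ne_zero] at h
    have hnum : φ.num = C (v⁻¹ * u) * φ.denom := by
      rw [C_mul, mul_assoc, ← h, ← mul_assoc, ← C_mul, inv_mul_cancel₀ hv, C_1, one_mul]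
    have hunit : IsUnit φ.denom :=
      φ.isCoprime_num_denom.isUnit_of_dvd' (hnum ▸ Dvd.intro_left _ rfl) dvd_rfl
    have h0 := natDegree_eq_zero_of_isUnit hunit
    have h1 : φ.num.natDegree ≤ 0 := by
      rw [hnum]; exact (natDegree_C_mul_le _ _).trans h0.le
    rw [ratDegree, h0] at hd
    omega
  refine (((C v * φ.num - C u * φ.denom).rootSet_finite K).image
    (fun z : K => (z : OnePoint K))).insert OnePoint.infty |>.subset ?_
  intro x hx
  induction x using OnePoint.rec with
  | infty => exact Or.inl rfl
  | coe z =>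
    refine Or.inr ⟨z, ?_, rfl⟩
    rw [mem_rootSet]
    refine ⟨hP, ?_⟩
    have hx : ratio (φ.num.eval z) (φ.denom.eval z) = ratio u v := hx
    have hne := form_num_denom_ne_zero (φ := φ) (x := z) (y := 1) (by simp)
    rw [form_of_ne (natDegree_num_le rfl) _ one_ne_zero,
      form_of_ne (natDegree_denom_le rfl) _ one_ne_zero] at hne
    rw [ratio_eq_ratio_iff (by simpa using hne) huv] at hx
    simp only [coe_aeval_eq_eval, eval_sub, eval_mul, eval_C]
    rw [mul_comm v, hx, sub_self]

theorem finite_preimage_iterate_ratMap {φ : RatFunc K} (hd : 1 ≤ ratDegree φ) (n : ℕ)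
    (w : OnePoint K) : ((ratMap φ)^[n] ⁻¹' {w}).Finite := by
  induction n generalizing w with
  | zero => exact Set.finite_singleton w
  | succ n ih =>
    rw [Function.iterate_succ', Set.preimage_comp, ← Set.biUnion_preimage_singleton]
    exact (finite_preimage_ratMap hd w).biUnion fun y _ => ih y

end Projective

/-! ### The chain rule for Wronskians and critical points of iterates. -/

section ChainRule

variable {K : Type*} [NontriviallyNormedField K]

/-- The Wronskian `x' y - x y'` of a pair of functions. -/
def planeWronskian (v : K → K × K) (z : K) : K :=
  deriv (fun t => (v t).1) z * (v z).2 - (v z).1 * deriv (fun t => (v t).2) z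

theorem deriv_pow_mul_eval {u t : K → K} {z : K} (hu : DifferentiableAt K u z)
    (ht : DifferentiableAt K t z) (d : ℕ) (P : K[X]) :
    deriv (fun s => u s ^ d * P.eval (t s)) z =
      deriv (fun s => u s ^ d) z * P.eval (t z) +
        u z ^ d * (P.derivative.eval (t z) * deriv t z) := by
  have h2 : HasDerivAt (fun s => P.eval (t s)) (P.derivative.eval (t z) * deriv t z) z :=
    (P.hasDerivAt (t z)).comp z ht.hasDerivAt
  exact ((hu.fun_pow d).hasDerivAt.mul h2).deriv

/-- The form taken by a lift in either affine chart, where `t` is the quotient of the coordinates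
and `u` the nonvanishing one. The derivative of the common factor `u ^ d` cancels in the Wronskian.
-/
theorem planeWronskian_pow_mul_eval {v : K → K × K} {u t : K → K} {z : K}
    (hu : DifferentiableAt K u z) (ht : DifferentiableAt K t z) {d : ℕ} {P Q : K[X]}
    (h : ∀ᶠ s in 𝓝 z, v s = (u s ^ d * P.eval (t s), u s ^ d * Q.eval (t s))) :
    planeWronskian v z = -(u z ^ (2 * d) * (wronskian P Q).eval (t z) * deriv t z) := by
  have h1 : (fun s => (v s).1) =ᶠ[𝓝 z] fun s => u s ^ d * P.eval (t s) :=
    h.mono fun s hs => congrArg Prod.fst hs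
  have h2 : (fun s => (v s).2) =ᶠ[𝓝 z] fun s => u s ^ d * Q.eval (t s) :=
    h.mono fun s hs => congrArg Prod.snd hs
  rw [planeWronskian, h1.deriv_eq, h2.deriv_eq, h.self_of_nhds, deriv_pow_mul_eval hu ht,
    deriv_pow_mul_eval hu ht]
  simp only [wronskian, eval_sub, eval_mul]
  ring

theorem IsLowestTerms.planeWronskian_planeLift {d : ℕ} {a b : K[X]} {φ : RatFunc K}
    (h : IsLowestTerms d a b φ) {v : K → K × K} {z : K}
    (h1 : DifferentiableAt K (fun s => (v s).1) z) (h2 : DifferentiableAt K (fun s => (v s).2) z)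
    (hv : (v z).1 ≠ 0 ∨ (v z).2 ≠ 0)
    (hw : planeWronskian (fun s => planeLift d a b (v s)) z = 0) :
    planeWronskian v z = 0 ∨ IsCriticalPoint φ (ratio (v z).1 (v z).2) := by
  by_cases hy : (v z).2 = 0
  · have hx : (v z).1 ≠ 0 := by simpa [hy] using hv
    have he : ∀ᶠ s in 𝓝 z, (v s).1 ≠ 0 := h1.continuousAt.eventually_ne hx
    have ht : HasDerivAt (fun s => (v s).2 / (v s).1) _ z := h2.hasDerivAt.div h1.hasDerivAt hx
    rw [planeWronskian_pow_mul_eval (P := a.reflect d) (Q := b.reflect d) (d := d) h1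
      ht.differentiableAt (he.mono fun s hs => by
        rw [planeLift, form_of_ne' h.natDegree_le.1 _ hs, form_of_ne' h.natDegree_le.2 _ hs]),
      neg_eq_zero, mul_eq_zero, mul_eq_zero] at hw
    rcases hw with (hw | hw) | hw
    · exact absurd hw (pow_ne_zero _ hx)
    · right
      rw [hy, ratio_zero]
      refine h.isCriticalPoint_infty ?_
      simpa [hy] using hw
    · left
      rw [ht.deriv, div_eq_zero_iff, or_iff_left (pow_ne_zero _ hx)] at hw
      rw [planeWronskian]
      linear_combination -hw
  · have he : ∀ᶠ s in 𝓝 z, (v s).2 ≠ 0 := h2.continuousAt.eventually_ne hy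
    have ht : HasDerivAt (fun s => (v s).1 / (v s).2) _ z := h1.hasDerivAt.div h2.hasDerivAt hy
    rw [planeWronskian_pow_mul_eval (P := a) (Q := b) (d := d) h2
      ht.differentiableAt (he.mono fun s hs => by
        rw [planeLift, form_of_ne h.natDegree_le.1 _ hs, form_of_ne h.natDegree_le.2 _ hs]),
      neg_eq_zero, mul_eq_zero, mul_eq_zero] at hw
    rcases hw with (hw | hw) | hw
    · exact absurd hw (pow_ne_zero _ hy)
    · exact Or.inr (h.isCriticalPoint_of_ne hy hw)
    · left
      rw [ht.deriv, div_eq_zero_iff, or_iff_left (pow_ne_zero _ hy)] at hw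
      rw [planeWronskian]
      linear_combination hw

theorem differentiableAt_form {d : ℕ} (P : K[X]) {x y : K → K} {z : K}
    (hx : DifferentiableAt K x z) (hy : DifferentiableAt K y z) :
    DifferentiableAt K (fun s => form d P (x s) (y s)) z := by
  unfold form
  fun_prop

theorem differentiableAt_iterate_planeLift {d : ℕ} (a b : K[X]) {v : K → K × K} {z : K}
    (h1 : DifferentiableAt K (fun s => (v s).1) z) (h2 : DifferentiableAt K (fun s => (v s).2) z)
    (n : ℕ) : DifferentiableAt K (fun s => ((planeLift d a b)^[n] (v s)).1) z ∧
      DifferentiableAt K (fun s => ((planeLift d a b)^[n] (v s)).2) z := by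
  induction n with
  | zero => exact ⟨h1, h2⟩
  | succ n ih =>
    simp only [Function.iterate_succ_apply']
    exact ⟨differentiableAt_form a ih.1 ih.2, differentiableAt_form b ih.1 ih.2⟩

/-- Working with lifts to the plane, the chain rule needs no case distinction for orbits that pass
through infinity. -/
theorem IsLowestTerms.exists_isCriticalPoint {d : ℕ} {a b : K[X]} {φ : RatFunc K}
    (h : IsLowestTerms d a b φ) {v : K → K × K} {z : K}
    (h1 : DifferentiableAt K (fun s => (v s).1) z) (h2 : DifferentiableAt K (fun s => (v s).2) z)
    (hv : (v z).1 ≠ 0 ∨ (v z).2 ≠ 0) (hvw : planeWronskian v z ≠ 0) {n : ℕ}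
    (hw : planeWronskian (fun s => (planeLift d a b)^[n] (v s)) z = 0) :
    ∃ j < n, IsCriticalPoint φ ((ratMap φ)^[j] (ratio (v z).1 (v z).2)) := by
  induction n with
  | zero => exact absurd hw hvw
  | succ n ih =>
    simp only [Function.iterate_succ_apply'] at hw
    obtain ⟨hd1, hd2⟩ := differentiableAt_iterate_planeLift (d := d) a b h1 h2 n
    obtain ⟨hne, heq⟩ := h.iterate_planeLift hv n
    rcases h.planeWronskian_planeLift hd1 hd2 hne hw with hw | hw
    · obtain ⟨j, hj, hc⟩ := ih hw
      exact ⟨j, by omega, hc⟩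
    · exact ⟨n, by omega, by rwa [heq]⟩

end ChainRule

/-! ### Analyticity of iterated lifts in a parameter. -/

section Families

variable {K : Type*} [NontriviallyNormedField K] [IsUltrametricDist K]
  [IsAlgClosed K] [CharZero K] [CompleteSpace K]

theorem An.form {S : ℝ} {d : ℕ} {P : K → K[X]} {x y : K → K} (hP : ∀ i, An S fun t => (P t).coeff i)
    (hx : An S x) (hy : An S y) : An S fun t => form d (P t) (x t) (y t) :=
  An.sum _ fun i _ => ((hP i).mul (hx.pow i)).mul (hy.pow (d - i))

theorem An.iterate_planeLift {S : ℝ} {d : ℕ} {a b : K → K[X]} {v : K → K × K}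
    (ha : ∀ i, An S fun t => (a t).coeff i) (hb : ∀ i, An S fun t => (b t).coeff i)
    (h1 : An S fun t => (v t).1) (h2 : An S fun t => (v t).2) (n : ℕ) :
    An S (fun t => ((planeLift d (a t) (b t))^[n] (v t)).1) ∧
      An S (fun t => ((planeLift d (a t) (b t))^[n] (v t)).2) := by
  induction n with
  | zero => exact ⟨h1, h2⟩
  | succ n ih =>
    simp only [Function.iterate_succ_apply']
    exact ⟨An.form ha ih.1 ih.2, An.form hb ih.1 ih.2⟩

end Families

/-! ### Removal of common zeros of analytic functions. -/

section CommonZeros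

variable {K : Type*} [NontriviallyNormedField K] [IsUltrametricDist K]
  [IsAlgClosed K] [CharZero K] [CompleteSpace K]

theorem An.eqOn_of_mul_eq {S : ℝ} (hS : 0 < S) {P : K[X]} (hP : P ≠ 0) {φ ψ : K → K}
    (hφ : An S φ) (hψ : An S ψ) (h : ∀ z, ‖z‖ < S → P.eval z * φ z = P.eval z * ψ z) :
    ∀ z, ‖z‖ < S → φ z = ψ z := by
  rcases An.mul_eq_zero hS (An.polynomial S P) (hφ.sub hψ)
    (fun z hz => by rw [mul_sub, h z hz, sub_self]) with h0 | h0
  · exfalso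
    have := (HasExp.polynomial S P).eq_zero hS h0
    exact hP (by exact_mod_cast this)
  · exact fun z hz => sub_eq_zero.1 (h0 z hz)

/-- Induction on the number of zeros of one member `φ i₀`. A common zero of the family in the disk
is one of these, and dividing all members by its linear factor removes it from the list. -/
theorem exists_common_factor_of_factorization {ι : Type*} {S S' : ℝ} (hS : S' < S)
    (hS' : 0 < S') {u : K → K} (hu : An S u) (hu0 : ∀ z, ‖z‖ ≤ S' → u z ≠ 0) (i₀ : ι) (k : ℕ)
    (φ : ι → K → K) (hφ : ∀ i, An S (φ i)) (T : Multiset K) (hT : T.card = k)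
    (h : ∀ z, ‖z‖ < S → φ i₀ z = (T.map fun w => z - w).prod * u z) :
    ∃ (P : K[X]) (ψ : ι → K → K), P ≠ 0 ∧ (∀ i, An S (ψ i)) ∧
      (∀ i z, ‖z‖ < S → φ i z = P.eval z * ψ i z) ∧ ∀ z, ‖z‖ < S' → ∃ i, ψ i z ≠ 0 := by
  induction k generalizing φ T with
  | zero =>
    refine ⟨1, φ, one_ne_zero, hφ, by simp, fun z hz => ⟨i₀, ?_⟩⟩
    rw [Multiset.card_eq_zero] at hT
    rw [h z (hz.trans hS), hT]
    simpa using hu0 z hz.le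
  | succ k ih =>
    by_cases hc : ∀ z, ‖z‖ < S' → ∃ i, φ i z ≠ 0
    · exact ⟨1, φ, one_ne_zero, hφ, by simp, hc⟩
    push Not at hc
    obtain ⟨w, hw, hw0⟩ := hc
    have hwS := hw.trans hS
    have hwT : w ∈ T := by
      have h1 := h w hwS
      rw [hw0 i₀, eq_comm, _root_.mul_eq_zero, or_iff_left (hu0 w hw.le),
        Multiset.prod_eq_zero_iff, Multiset.mem_map] at h1
      obtain ⟨w', hw', he⟩ := h1
      rwa [sub_eq_zero.1 he]
    choose χ hχ hχe using fun i => An.exists_factor (hφ i) hwS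
    have hχe' : ∀ i z, ‖z‖ < S → φ i z = (X - C w).eval z * χ i z := fun i z hz => by
      rw [hχe i z hz, hw0 i, zero_add]; simp
    obtain ⟨T', rfl⟩ := Multiset.exists_cons_of_mem hwT
    have hprod : An S fun z => (T'.map fun w => z - w).prod := by
      refine (An.polynomial S (T'.map fun w => X - C w).prod).congr fun z _ => ?_
      rw [eval_multiset_prod, Multiset.map_map]
      simp
    have hχ₀ := An.eqOn_of_mul_eq (hS'.trans hS) (X_sub_C_ne_zero w) (hχ i₀) (hprod.mul hu)
      (fun z hz => by
        rw [← hχe' i₀ z hz, h z hz, Multiset.map_cons, Multiset.prod_cons, mul_assoc]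
        simp)
    obtain ⟨P, ψ, hP, hψ, he, hne⟩ := ih χ hχ T' (by simpa using hT) hχ₀
    refine ⟨(X - C w) * P, ψ, mul_ne_zero (X_sub_C_ne_zero w) hP, hψ, fun i z hz => ?_, hne⟩
    rw [hχe' i z hz, he i z hz, eval_mul, mul_assoc]

/-- A family of analytic functions, not all zero, has a common polynomial factor outside of which
it has no common zero in a smaller disk. -/
theorem exists_common_factor {ι : Type*} {S S' : ℝ} (hS : S' < S) (hS' : 0 < S')
    (φ : ι → K → K) (hφ : ∀ i, An S (φ i)) (hne : ∃ i z, ‖z‖ < S ∧ φ i z ≠ 0) :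
    ∃ (P : K[X]) (ψ : ι → K → K), P ≠ 0 ∧ (∀ i, An S (ψ i)) ∧
      (∀ i z, ‖z‖ < S → φ i z = P.eval z * ψ i z) ∧ ∀ z, ‖z‖ < S' → ∃ i, ψ i z ≠ 0 := by
  obtain ⟨i₀, hne⟩ := hne
  obtain ⟨T, u, hu, -, hu0, h⟩ := (hφ i₀).exists_factorization hS' hS hne
  exact exists_common_factor_of_factorization hS hS' hu hu0 i₀ _ φ hφ T rfl h

theorem An.coeff_mul {S : ℝ} {P Q : K → K[X]} (hP : ∀ i, An S fun t => (P t).coeff i)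
    (hQ : ∀ i, An S fun t => (Q t).coeff i) (n : ℕ) : An S fun t => (P t * Q t).coeff n := by
  simp only [Polynomial.coeff_mul]
  exact An.sum _ fun i _ => (hP _).mul (hQ _)

end CommonZeros

/-! ### Polynomials with prescribed coefficients. -/

section OfFin

variable {K : Type*} [Field K]

/-- The polynomial of degree at most `d` with given coefficients. -/
def polyOfCoeff (d : ℕ) (ψ : Fin (d + 1) → K) : K[X] := ∑ i : Fin (d + 1), monomial (i : ℕ) (ψ i)

theorem coeff_polyOfCoeff {d : ℕ} (ψ : Fin (d + 1) → K) (j : ℕ) :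
    (polyOfCoeff d ψ).coeff j = if h : j < d + 1 then ψ ⟨j, h⟩ else 0 := by
  rw [polyOfCoeff, finsetSum_coeff]
  simp only [coeff_monomial]
  split_ifs with h
  · rw [Finset.sum_eq_single ⟨j, h⟩]
    · simp
    · intro i _ hi
      rw [if_neg]
      rintro rfl
      exact hi rfl
    · simp
  · refine Finset.sum_eq_zero fun i _ => if_neg ?_
    rintro rfl
    exact h i.2

theorem natDegree_polyOfCoeff_le {d : ℕ} (ψ : Fin (d + 1) → K) :
    (polyOfCoeff d ψ).natDegree ≤ d := by
  rw [natDegree_le_iff_coeff_eq_zero]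
  intro i hi
  rw [coeff_polyOfCoeff, dif_neg (by omega)]

end OfFin

/-! ### Families over the meromorphic functions with analytic coefficients. -/

section NormalForms

variable {p : ℕ} [Fact p.Prime] {S : ℝ}

/-- The function on `ℂ_[p]` given by a power series; its values matter on `D(0, S)` only. -/
def Analytic.fn (g : Analytic p S) (c : ℂ_[p]) : ℂ_[p] :=
  ∑' n : ℕ, PowerSeries.coeff n (g : PowerSeries ℂ_[p]) * c ^ n

theorem Analytic.eval_eq_fn (c : Metric.ball (0 : ℂ_[p]) S) (g : Analytic p S) :
    Analytic.eval c g = Analytic.fn g c := rfl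

theorem Analytic.hasExp (g : Analytic p S) : HasExp S (g : PowerSeries ℂ_[p]) (Analytic.fn g) where
  conv := g.2
  hasSum z hz := (Analytic.summable_norm ⟨z, mem_ball_zero_iff.2 hz⟩ g).of_norm.hasSum

theorem Analytic.an (g : Analytic p S) : An S (Analytic.fn g) := ⟨_, Analytic.hasExp g⟩

theorem Analytic.exists_eval_ne_zero (hS : 0 < S) {g : Analytic p S} (hg : g ≠ 0) :
    ∃ c : Metric.ball (0 : ℂ_[p]) S, Analytic.eval c g ≠ 0 := by
  by_contra! h
  refine hg (Subtype.ext ((Analytic.hasExp g).eq_zero hS fun z hz => ?_))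
  exact h ⟨z, mem_ball_zero_iff.2 hz⟩

theorem Mero.algebraMap_injective :
    Function.Injective (algebraMap (Analytic p S) (Mero p S)) :=
  IsFractionRing.injective _ _

theorem Mero.exists_clear (q : (Mero p S)[X]) : ∃ (b : Analytic p S) (Q : (Analytic p S)[X]),
    b ≠ 0 ∧ Q.map (algebraMap (Analytic p S) (Mero p S)) =
      C (algebraMap (Analytic p S) (Mero p S) b) * q := by
  obtain ⟨b, hbm, hb⟩ := IsLocalization.integerNormalization_spec
    (nonZeroDivisors (Analytic p S)) q
  refine ⟨b, _, nonZeroDivisors.ne_zero hbm, hb.trans ?_⟩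
  rw [← smul_eq_C_mul, algebraMap_smul]

/-- A family of rational functions of degree `d` is the family of specializations of a fraction
of polynomials of degree at most `d`. -/
theorem exists_fraction (hS : 0 < S) {Φ : RatFunc (Mero p S)}
    {f : Metric.ball (0 : ℂ_[p]) S → RatFunc ℂ_[p]} (hf : ∀ c, IsSpecialization Φ c (f c))
    {d : ℕ} (hdeg : ∀ c, ratDegree (f c) = d) :
    ∃ A B : (Analytic p S)[X], B ≠ 0 ∧ A.natDegree ≤ d ∧ B.natDegree ≤ d ∧
      ∀ c, ∃ G H : (Analytic p S)[X], H.map (Analytic.eval c) ≠ 0 ∧ G * B = H * A ∧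
        f c = algebraMap ℂ_[p][X] (RatFunc ℂ_[p]) (G.map (Analytic.eval c)) /
          algebraMap ℂ_[p][X] (RatFunc ℂ_[p]) (H.map (Analytic.eval c)) := by
  set ι := algebraMap (Analytic p S) (Mero p S) with hι
  have hinj : Function.Injective ι := Mero.algebraMap_injective
  have hpinj : Function.Injective (Polynomial.map ι) := Polynomial.map_injective ι hinj
  obtain ⟨b₁, A₀, hb₁, hA₀⟩ := Mero.exists_clear Φ.num
  obtain ⟨b₂, B₀, hb₂, hB₀⟩ := Mero.exists_clear Φ.denom
  obtain ⟨u, v, huv⟩ := Φ.isCoprime_num_denom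
  obtain ⟨b₃, u₀, hb₃, hu₀⟩ := Mero.exists_clear u
  obtain ⟨b₄, v₀, hb₄, hv₀⟩ := Mero.exists_clear v
  rw [← hι] at hA₀ hB₀ hu₀ hv₀
  set A := C b₂ * A₀ with hA
  set B := C b₁ * B₀ with hB
  clear_value A B
  have hAm : A.map ι = C (ι (b₁ * b₂)) * Φ.num := by
    rw [hA, Polynomial.map_mul, map_C, hA₀, map_mul, C_mul]; ring
  have hBm : B.map ι = C (ι (b₁ * b₂)) * Φ.denom := by
    rw [hB, Polynomial.map_mul, map_C, hB₀, map_mul, C_mul]; ring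
  have hb₁₂ : ι (b₁ * b₂) ≠ 0 := (map_ne_zero_iff ι hinj).2 (mul_ne_zero hb₁ hb₂)
  -- A Bézout relation with denominators cleared: wherever the right-hand side does not vanish, the
  -- specializations of `A` and `B` are coprime.
  have hBez : (C b₄ * u₀) * A + (C b₃ * v₀) * B = C (b₁ * b₂ * b₃ * b₄) := by
    apply hpinj
    simp only [Polynomial.map_add, Polynomial.map_mul, map_C] at hAm hBm ⊢
    rw [hAm, hBm, hu₀, hv₀]
    have : (C (ι (b₁ * b₂ * b₃ * b₄)) : (Mero p S)[X]) =
        C (ι (b₁ * b₂ * b₃ * b₄)) * (u * Φ.num + v * Φ.denom) := by rw [huv, mul_one]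
    rw [this]
    simp only [map_mul]
    ring
  have hB0 : B ≠ 0 := by
    intro h
    rw [h, Polynomial.map_zero, eq_comm, mul_eq_zero] at hBm
    exact hBm.elim (by simpa using hb₁₂) Φ.denom_ne_zero
  have hGH : ∀ c, ∃ G H : (Analytic p S)[X], H.map (Analytic.eval c) ≠ 0 ∧ G * B = H * A ∧
        f c = algebraMap ℂ_[p][X] (RatFunc ℂ_[p]) (G.map (Analytic.eval c)) /
          algebraMap ℂ_[p][X] (RatFunc ℂ_[p]) (H.map (Analytic.eval c)) := by
    intro c
    obtain ⟨G, H, hH, hΦ, hφ⟩ := hf c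
    refine ⟨G, H, hH, hpinj ?_, hφ⟩
    have hH0 : H.map ι ≠ 0 := by
      rw [Ne, Polynomial.map_eq_zero_iff hinj]
      rintro rfl
      simp at hH
    have h1 := (RatFunc.num_div_denom Φ).trans hΦ
    rw [div_eq_div_iff (RatFunc.algebraMap_ne_zero Φ.denom_ne_zero)
      (RatFunc.algebraMap_ne_zero hH0), ← map_mul, ← map_mul] at h1
    have h2 := RatFunc.algebraMap_injective _ h1
    rw [Polynomial.map_mul, Polynomial.map_mul, hAm, hBm]
    linear_combination (-C (ι (b₁ * b₂))) * h2
  -- At a parameter where the Bézout constant is nonzero, the specialized fraction is reduced and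
  -- equals `f c`, so both degrees are at most `d`. With `g` a leading coefficient, this bounds the
  -- degree over `Analytic p S`.
  have hdegle : ∀ g : Analytic p S, g ≠ 0 → ∃ c, Analytic.eval c g ≠ 0 ∧
      (A.map (Analytic.eval c)).natDegree ≤ d ∧ (B.map (Analytic.eval c)).natDegree ≤ d := by
    intro g hg
    obtain ⟨c, hc⟩ := Analytic.exists_eval_ne_zero hS
      (mul_ne_zero (mul_ne_zero (mul_ne_zero (mul_ne_zero hb₁ hb₂) hb₃) hb₄) hg)
    rw [map_mul] at hc
    refine ⟨c, right_ne_zero_of_mul hc, ?_⟩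
    have hcop : IsCoprime (A.map (Analytic.eval c)) (B.map (Analytic.eval c)) := by
      have h3 := congrArg (Polynomial.map (Analytic.eval c)) hBez
      rw [Polynomial.map_add, Polynomial.map_mul, Polynomial.map_mul _ (q := B), map_C] at h3
      set e := Analytic.eval c (b₁ * b₂ * b₃ * b₄)
      have he : e ≠ 0 := left_ne_zero_of_mul hc
      refine ⟨C e⁻¹ * (C b₄ * u₀).map (Analytic.eval c), C e⁻¹ * (C b₃ * v₀).map (Analytic.eval c),
        ?_⟩
      rw [mul_assoc, mul_assoc, ← mul_add, h3, ← C_mul, inv_mul_cancel₀ he, C_1]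
    obtain ⟨G, H, hH, hGB, hφ⟩ := hGH c
    have h4 := congrArg (Polynomial.map (Analytic.eval c)) hGB
    rw [Polynomial.map_mul, Polynomial.map_mul] at h4
    have hBc : B.map (Analytic.eval c) ≠ 0 := by
      intro h0
      rw [h0, mul_zero, eq_comm, mul_eq_zero] at h4
      rw [h4.resolve_left hH, h0] at hcop
      exact not_isCoprime_zero_zero hcop
    have hfc : f c = algebraMap ℂ_[p][X] (RatFunc ℂ_[p]) (A.map (Analytic.eval c)) /
        algebraMap ℂ_[p][X] (RatFunc ℂ_[p]) (B.map (Analytic.eval c)) := by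
      rw [hφ, div_eq_div_iff (RatFunc.algebraMap_ne_zero hH) (RatFunc.algebraMap_ne_zero hBc),
        ← map_mul, ← map_mul, h4, mul_comm]
    rw [← hdeg c, hfc]
    exact natDegree_max_le_ratDegree hBc hcop
  refine ⟨A, B, hB0, ?_, ?_, hGH⟩
  · by_cases hA0 : A = 0
    · simp [hA0]
    · obtain ⟨c, hc, h1, -⟩ := hdegle A.leadingCoeff (leadingCoeff_ne_zero.2 hA0)
      rwa [natDegree_map_of_leadingCoeff_ne_zero _ hc] at h1
  · obtain ⟨c, hc, -, h1⟩ := hdegle B.leadingCoeff (leadingCoeff_ne_zero.2 hB0)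
    rwa [natDegree_map_of_leadingCoeff_ne_zero _ hc] at h1

/-- On smaller disks, the family `f` has numerators and denominators with analytic coefficients. -/
theorem exists_isLowestTerms {Φ : RatFunc (Mero p S)}
    {f : Metric.ball (0 : ℂ_[p]) S → RatFunc ℂ_[p]} (hf : ∀ c, IsSpecialization Φ c (f c))
    {d : ℕ} (hdeg : ∀ c, ratDegree (f c) = d) {S' : ℝ} (hS' : 0 < S') (hS : S' < S) :
    ∃ a b : ℂ_[p] → ℂ_[p][X], (∀ i, An S' fun c => (a c).coeff i) ∧
      (∀ i, An S' fun c => (b c).coeff i) ∧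
      ∀ c : Metric.ball (0 : ℂ_[p]) S, ‖(c : ℂ_[p])‖ < S' → IsLowestTerms d (a c) (b c) (f c) := by
  have hS0 := hS'.trans hS
  obtain ⟨A, B, hB0, hA, hB, hGH⟩ := exists_fraction hS0 hf hdeg
  have hne : ∃ (i : Fin (d + 1) ⊕ Fin (d + 1)) (z : ℂ_[p]), ‖z‖ < S ∧
      Sum.elim (fun i : Fin (d + 1) => Analytic.fn (A.coeff i))
        (fun i : Fin (d + 1) => Analytic.fn (B.coeff i)) i z ≠ 0 := by
    obtain ⟨c, hc⟩ := Analytic.exists_eval_ne_zero hS0 (leadingCoeff_ne_zero.2 hB0)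
    exact ⟨Sum.inr ⟨B.natDegree, Nat.lt_succ_of_le hB⟩, c, mem_ball_zero_iff.1 c.2, hc⟩
  obtain ⟨P, ψ, hP, hψ, he, hcz⟩ := exists_common_factor hS hS' _
    (by rintro (i | i) <;> exact Analytic.an _) hne
  set a : ℂ_[p] → ℂ_[p][X] := fun c => polyOfCoeff d fun i => ψ (Sum.inl i) c with ha
  set b : ℂ_[p] → ℂ_[p][X] := fun c => polyOfCoeff d fun i => ψ (Sum.inr i) c with hb
  have haAn : ∀ i, An S fun c => (a c).coeff i := by
    intro i
    simp only [ha, coeff_polyOfCoeff]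
    split_ifs
    · exact hψ _
    · exact An.const S 0
  have hbAn : ∀ i, An S fun c => (b c).coeff i := by
    intro i
    simp only [hb, coeff_polyOfCoeff]
    split_ifs
    · exact hψ _
    · exact An.const S 0
  have hAa : ∀ c : Metric.ball (0 : ℂ_[p]) S,
      A.map (Analytic.eval c) = C (P.eval (c : ℂ_[p])) * a c := by
    intro c
    ext i
    rw [coeff_map, coeff_C_mul, ha, coeff_polyOfCoeff]
    split_ifs with h
    · exact he (Sum.inl ⟨i, h⟩) c (mem_ball_zero_iff.1 c.2)
    · rw [coeff_eq_zero_of_natDegree_lt (by omega), map_zero, mul_zero]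
  have hBb : ∀ c : Metric.ball (0 : ℂ_[p]) S,
      B.map (Analytic.eval c) = C (P.eval (c : ℂ_[p])) * b c := by
    intro c
    ext i
    rw [coeff_map, coeff_C_mul, hb, coeff_polyOfCoeff]
    split_ifs with h
    · exact he (Sum.inr ⟨i, h⟩) c (mem_ball_zero_iff.1 c.2)
    · rw [coeff_eq_zero_of_natDegree_lt (by omega), map_zero, mul_zero]
  refine ⟨a, b, fun i => (haAn i).mono hS.le, fun i => (hbAn i).mono hS.le, fun c hc => ?_⟩
  obtain ⟨G, H, hH, hGB, hφ⟩ := hGH c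
  have hfam : ∀ Q : (Analytic p S)[X], ∃ q : ℂ_[p] → ℂ_[p][X], (∀ i, An S fun t => (q t).coeff i) ∧
      ∀ t : Metric.ball (0 : ℂ_[p]) S, q t = Q.map (Analytic.eval t) := by
    intro Q
    refine ⟨fun t => ∑ i ∈ Finset.range (Q.natDegree + 1), monomial i (Analytic.fn (Q.coeff i) t),
      fun i => ?_, fun t => ?_⟩
    · simp only [finsetSum_coeff, coeff_monomial]
      refine An.sum _ fun j _ => ?_
      split_ifs
      · exact Analytic.an _
      · exact An.const S 0
    · conv_rhs => rw [Q.as_sum_range, Polynomial.map_sum]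
      simp only [map_monomial, Analytic.eval_eq_fn]
  obtain ⟨g, hg, hge⟩ := hfam G
  obtain ⟨k, hk, hke⟩ := hfam H
  -- Specializing `G * B = H * A` gives this relation multiplied by `P(c)`. Cancelling `P` as an
  -- analytic function of the parameter keeps it valid at the zeros of `P`.
  have hcross : G.map (Analytic.eval c) * b c = H.map (Analytic.eval c) * a c := by
    ext n
    rw [← hge, ← hke]
    refine An.eqOn_of_mul_eq hS0 hP (An.coeff_mul hg hbAn n) (An.coeff_mul hk haAn n) ?_ c
      (mem_ball_zero_iff.1 c.2)
    intro z hz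
    have h1 := congrArg (Polynomial.map (Analytic.eval ⟨z, mem_ball_zero_iff.2 hz⟩)) hGB
    rw [Polynomial.map_mul, Polynomial.map_mul, hAa, hBb, ← hge, ← hke] at h1
    rw [← coeff_C_mul, ← coeff_C_mul]
    congr 1
    linear_combination h1
  have hb0 : b c ≠ 0 := by
    intro h0
    rw [h0, mul_zero, eq_comm, mul_eq_zero, or_iff_right hH] at hcross
    obtain ⟨i | i, hi⟩ := hcz c hc
    · have := congrArg (fun q => q.coeff i) hcross
      simp only [ha, coeff_polyOfCoeff, coeff_zero, dif_pos i.2] at this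
      exact hi this
    · have := congrArg (fun q => q.coeff i) h0
      simp only [hb, coeff_polyOfCoeff, coeff_zero, dif_pos i.2] at this
      exact hi this
  have hfc : f c = algebraMap ℂ_[p][X] (RatFunc ℂ_[p]) (a c) /
      algebraMap ℂ_[p][X] (RatFunc ℂ_[p]) (b c) := by
    rw [hφ, div_eq_div_iff (RatFunc.algebraMap_ne_zero hH) (RatFunc.algebraMap_ne_zero hb0),
      ← map_mul, ← map_mul, hcross, mul_comm]
  have hd := hdeg c
  rw [hfc] at hd ⊢
  exact IsLowestTerms.of_natDegree_le hb0 (natDegree_polyOfCoeff_le _)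
    (natDegree_polyOfCoeff_le _) hd

theorem Mero.exists_ratio_eq (α : OnePoint (Mero p S)) : ∃ g h : Analytic p S, (g ≠ 0 ∨ h ≠ 0) ∧
    α = ratio (algebraMap (Analytic p S) (Mero p S) g) (algebraMap (Analytic p S) (Mero p S) h) := by
  induction α using OnePoint.rec with
  | infty => exact ⟨1, 0, by simp, by rw [map_zero, ratio_zero]⟩
  | coe m =>
    obtain ⟨g, h, hh, rfl⟩ := IsFractionRing.div_surjective (A := Analytic p S) m
    have hh0 := nonZeroDivisors.ne_zero hh
    exact ⟨g, h, Or.inr hh0,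
      by rw [ratio_of_ne ((map_ne_zero_iff _ Mero.algebraMap_injective).2 hh0)]⟩

/-- On smaller disks, a point of the projective line over the field of meromorphic functions has
analytic homogeneous coordinates. -/
theorem exists_coordinates {α : OnePoint (Mero p S)}
    {a : Metric.ball (0 : ℂ_[p]) S → OnePoint ℂ_[p]} (ha : ∀ c, HasValue α c (a c))
    {S' : ℝ} (hS' : 0 < S') (hS : S' < S) :
    ∃ v : ℂ_[p] → ℂ_[p] × ℂ_[p], An S' (fun c => (v c).1) ∧ An S' (fun c => (v c).2) ∧
      ∀ c : Metric.ball (0 : ℂ_[p]) S, ‖(c : ℂ_[p])‖ < S' →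
        ((v c).1 ≠ 0 ∨ (v c).2 ≠ 0) ∧ a c = ratio (v c).1 (v c).2 := by
  have hS0 := hS'.trans hS
  have hinj : Function.Injective (algebraMap (Analytic p S) (Mero p S)) :=
    Mero.algebraMap_injective
  obtain ⟨g₀, h₀, h0, hα⟩ := Mero.exists_ratio_eq α
  have hne : ∃ (i : Bool) (z : ℂ_[p]), ‖z‖ < S ∧
      (bif i then Analytic.fn g₀ else Analytic.fn h₀) z ≠ 0 := by
    rcases h0 with h | h
    · obtain ⟨c, hc⟩ := Analytic.exists_eval_ne_zero hS0 h
      exact ⟨true, c, mem_ball_zero_iff.1 c.2, hc⟩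
    · obtain ⟨c, hc⟩ := Analytic.exists_eval_ne_zero hS0 h
      exact ⟨false, c, mem_ball_zero_iff.1 c.2, hc⟩
  obtain ⟨P, ψ, hP, hψ, he, hcz⟩ := exists_common_factor hS hS' _
    (by rintro (i | i) <;> exact Analytic.an _) hne
  refine ⟨fun c => (ψ true c, ψ false c), (hψ true).mono hS.le, (hψ false).mono hS.le,
    fun c hc => ?_⟩
  have hv : ψ true c ≠ 0 ∨ ψ false c ≠ 0 := by
    obtain ⟨i | i, hi⟩ := hcz c hc
    · exact Or.inr hi
    · exact Or.inl hi
  refine ⟨hv, ?_⟩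
  obtain ⟨g, h, hgh, hne', hac⟩ := ha c
  have hgh0 : algebraMap (Analytic p S) (Mero p S) g ≠ 0 ∨
      algebraMap (Analytic p S) (Mero p S) h ≠ 0 := by
    refine hne'.imp (fun h1 h2 => h1 ?_) (fun h1 h2 => h1 ?_) <;>
    · rw [map_eq_zero_iff _ hinj] at h2
      rw [h2, map_zero]
  have h0' : algebraMap (Analytic p S) (Mero p S) g₀ ≠ 0 ∨
      algebraMap (Analytic p S) (Mero p S) h₀ ≠ 0 := by
    simpa only [map_ne_zero_iff _ hinj] using h0
  rw [hα, ratio_eq_ratio_iff h0' hgh0, ← map_mul, ← map_mul] at hgh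
  have hgh := hinj hgh
  rw [hac, ratio_eq_ratio_iff hne' hv]
  refine An.eqOn_of_mul_eq hS0 hP ((Analytic.an g).mul (hψ false)) ((hψ true).mul (Analytic.an h)) ?_ c
    (mem_ball_zero_iff.1 c.2)
  intro z hz
  have h1 := congrArg (Analytic.eval ⟨z, mem_ball_zero_iff.2 hz⟩) hgh
  rw [map_mul, map_mul] at h1
  simp only [Analytic.eval_eq_fn] at h1
  have h2 := he true z hz
  have h3 := he false z hz
  simp only [cond_true, cond_false] at h2 h3
  rw [h2, h3] at h1
  linear_combination -h1

end NormalForms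

/-! ### Möbius coordinates on rational open disks. -/

section Mobius

variable {K : Type*} [Field K]

/-- Homogeneous coordinates of `(m₁ z + m₂) / (m₃ z + m₄)`. -/
def mobius (m₁ m₂ m₃ m₄ z : K) : K × K := (m₁ * z + m₂, m₃ * z + m₄)

/-- The inverse of the Möbius transformation with the given coefficients. -/
def mobiusInv (m₁ m₂ m₃ m₄ : K) (w : K × K) : K :=
  (m₄ * w.1 - m₂ * w.2) / (m₁ * w.2 - m₃ * w.1)

variable {m₁ m₂ m₃ m₄ : K}

theorem mobius_ne_zero (hm : m₁ * m₄ - m₂ * m₃ ≠ 0) (z : K) :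
    (mobius m₁ m₂ m₃ m₄ z).1 ≠ 0 ∨ (mobius m₁ m₂ m₃ m₄ z).2 ≠ 0 := by
  by_contra! h
  simp only [mobius] at h
  exact hm (by linear_combination m₁ * h.2 - m₃ * h.1)

/-- Since `w` is a nonzero multiple of the Möbius lift of `z`, the denominator of the inverse is
that multiple of the determinant. -/
theorem mobiusInv_eq (hm : m₁ * m₄ - m₂ * m₃ ≠ 0) {w : K × K} (hw : w.1 ≠ 0 ∨ w.2 ≠ 0) {z : K}
    (h : ratio (mobius m₁ m₂ m₃ m₄ z).1 (mobius m₁ m₂ m₃ m₄ z).2 = ratio w.1 w.2) :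
    m₁ * w.2 - m₃ * w.1 ≠ 0 ∧ mobiusInv m₁ m₂ m₃ m₄ w = z := by
  rw [ratio_eq_ratio_iff (mobius_ne_zero hm z) hw] at h
  simp only [mobius] at h
  have h0 : m₁ * w.2 - m₃ * w.1 ≠ 0 := by
    intro h0
    have h1 : (m₁ * m₄ - m₂ * m₃) * w.1 = 0 := by linear_combination -m₁ * h + (m₁ * z + m₂) * h0
    have h2 : (m₁ * m₄ - m₂ * m₃) * w.2 = 0 := by linear_combination -m₃ * h + (m₃ * z + m₄) * h0
    rcases hw with hw | hw
    · exact hw ((mul_eq_zero.1 h1).resolve_left hm)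
    · exact hw ((mul_eq_zero.1 h2).resolve_left hm)
  refine ⟨h0, ?_⟩
  rw [mobiusInv, div_eq_iff h0]
  linear_combination -h

end Mobius

/-- The coordinate is `b + r z` on a disk and `b + r / z` on the complement of a closed disk. Such
an `r` exists because the radius lies in the value group. -/
theorem IsRationalOpenDisk.exists_mobius {p : ℕ} [Fact p.Prime] {U : Set (OnePoint ℂ_[p])}
    (hU : IsRationalOpenDisk U) : ∃ m₁ m₂ m₃ m₄ : ℂ_[p], m₁ * m₄ - m₂ * m₃ ≠ 0 ∧
      U = (fun z => ratio (mobius m₁ m₂ m₃ m₄ z).1 (mobius m₁ m₂ m₃ m₄ z).2) '' {z | ‖z‖ < 1} := by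
  obtain ⟨b, R, ⟨r, hr, rfl⟩, rfl | rfl⟩ := hU
  · refine ⟨r, b, 0, 1, by simpa using hr, Set.ext fun x => ⟨?_, ?_⟩⟩
    · rintro ⟨w, hw, rfl⟩
      refine ⟨(w - b) / r, ?_, ?_⟩
      · rw [Metric.mem_ball, dist_eq_norm] at hw
        simpa [div_lt_one (norm_pos_iff.2 hr)] using hw
      · simp only [mobius, zero_mul, zero_add]
        rw [ratio_of_ne one_ne_zero, mul_div_cancel₀ _ hr, sub_add_cancel, div_one]
    · rintro ⟨z, hz, rfl⟩
      refine ⟨r * z + b, ?_, ?_⟩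
      · rw [Metric.mem_ball, dist_eq_norm, add_sub_cancel_right, norm_mul]
        exact mul_lt_of_lt_one_right (norm_pos_iff.2 hr) hz
      · simp only [mobius, zero_mul, zero_add]
        rw [ratio_of_ne one_ne_zero, div_one]
  · refine ⟨b, r, 1, 0, by simpa using hr, Set.ext fun x => ⟨?_, ?_⟩⟩
    · intro hx
      induction x using OnePoint.rec with
      | infty => exact ⟨0, by simp, by simp [mobius, ratio_zero]⟩
      | coe w =>
        have hw : ‖r‖ < ‖w - b‖ := by
          by_contra! h
          exact hx ⟨w, by simpa [dist_eq_norm] using h, rfl⟩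
        have hwb : w - b ≠ 0 := norm_pos_iff.1 ((norm_nonneg r).trans_lt hw)
        refine ⟨r / (w - b), ?_, ?_⟩
        · simpa [div_lt_one (norm_pos_iff.2 hwb)] using hw
        · simp only [mobius, one_mul, add_zero]
          rw [ratio_of_ne (div_ne_zero hr hwb)]
          congr 1
          field_simp
          ring
    · rintro ⟨z, hz, rfl⟩ ⟨w, hw, he⟩
      simp only [mobius, one_mul, add_zero] at he
      by_cases hz0 : z = 0
      · rw [hz0, ratio_zero] at he
        exact OnePoint.coe_ne_infty w he
      · rw [ratio_of_ne hz0, OnePoint.coe_eq_coe] at he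
        rw [Metric.mem_closedBall, dist_eq_norm, he,
          show (b * z + r) / z - b = r / z by field_simp; ring, norm_div,
          div_le_iff₀ (norm_pos_iff.2 hz0)] at hw
        have : ‖r‖ * ‖z‖ < ‖r‖ := mul_lt_of_lt_one_right (norm_pos_iff.2 hr) hz
        linarith

/-! ### Transfer of the orbit relation from the unit disk to rational maps. -/

section Orbits

variable {K : Type*} [NontriviallyNormedField K] [IsUltrametricDist K]
  [IsAlgClosed K] [CharZero K] [CompleteSpace K]

theorem deriv_mobiusInv {m₁ m₂ m₃ m₄ : K} {w : K → K × K} {z : K}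
    (h1 : DifferentiableAt K (fun s => (w s).1) z) (h2 : DifferentiableAt K (fun s => (w s).2) z)
    (hw : m₁ * (w z).2 - m₃ * (w z).1 ≠ 0) :
    deriv (fun s => mobiusInv m₁ m₂ m₃ m₄ (w s)) z =
      (m₁ * m₄ - m₂ * m₃) * planeWronskian w z / (m₁ * (w z).2 - m₃ * (w z).1) ^ 2 := by
  have := ((h1.hasDerivAt.const_mul m₄).sub (h2.hasDerivAt.const_mul m₂)).div
    ((h2.hasDerivAt.const_mul m₁).sub (h1.hasDerivAt.const_mul m₃)) hw
  refine this.deriv.trans ?_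
  congr 1
  rw [planeWronskian]
  simp only [Pi.sub_apply]
  ring

theorem An.mobiusInv {S : ℝ} (hS : 0 < S) {m₁ m₂ m₃ m₄ : K} {w : K → K × K}
    (h1 : An S fun s => (w s).1) (h2 : An S fun s => (w s).2)
    (hw : ∀ s, ‖s‖ < S → m₁ * (w s).2 - m₃ * (w s).1 ≠ 0) :
    An S fun s => mobiusInv m₁ m₂ m₃ m₄ (w s) :=
  An.div hS (((An.const S m₄).mul h1).sub ((An.const S m₂).mul h2))
    (((An.const S m₁).mul h2).sub ((An.const S m₃).mul h1)) hw

/-- The `(N - M)`-th iterate maps `U M` into itself. Conjugated to the unit disk, it forms an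
analytic family whose marked point is the `M`-th iterate of the original one. -/
theorem exists_uniform_orbit_relation_ratMap {p : ℕ} (hp : p.Prime) (hpn : ‖(p : K)‖ < 1)
    {S s : ℝ} (hs0 : 0 < s) (hs : s < S) {d : ℕ} (hd : 1 ≤ d) {A B : K → K[X]}
    (hA : ∀ i, An S fun c => (A c).coeff i) (hB : ∀ i, An S fun c => (B c).coeff i)
    {φ : K → RatFunc K} (hφ : ∀ c, ‖c‖ < S → IsLowestTerms d (A c) (B c) (φ c))
    {v : K → K × K} (hv1 : An S fun c => (v c).1) (hv2 : An S fun c => (v c).2)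
    (hv : ∀ c, ‖c‖ < S → (v c).1 ≠ 0 ∨ (v c).2 ≠ 0) {M N : ℕ} (hMN : M < N)
    {U : ℕ → Set (OnePoint K)} {m₁ m₂ m₃ m₄ : K} (hm : m₁ * m₄ - m₂ * m₃ ≠ 0)
    (hUM : U M =
      (fun z => ratio (mobius m₁ m₂ m₃ m₄ z).1 (mobius m₁ m₂ m₃ m₄ z).2) '' {z | ‖z‖ < 1})
    (hvU : ∀ c, ‖c‖ < S → ratio (v c).1 (v c).2 ∈ U 0)
    (hfU : ∀ c, ‖c‖ < S → ∀ j < N, Set.MapsTo (ratMap (φ c)) (U j) (U (j + 1)))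
    (hUN : U N ⊆ U M) :
    ∃ E : Set K, E.Finite ∧ ∃ m n, m < n ∧ ∀ c, ‖c‖ ≤ s → c ∉ E →
      IsPreperiodic (ratMap (φ c)) (ratio (v c).1 (v c).2) →
      (∀ x, (∃ j, M ≤ j ∧ j < N ∧ x ∈ U j) → IsCriticalPoint (φ c) x →
        IsPreperiodic (ratMap (φ c)) x) →
      (ratMap (φ c))^[n] (ratio (v c).1 (v c).2) = (ratMap (φ c))^[m] (ratio (v c).1 (v c).2) := by
  have hS : 0 < S := hs0.trans hs
  set μ : K → OnePoint K :=
    fun z => ratio (mobius m₁ m₂ m₃ m₄ z).1 (mobius m₁ m₂ m₃ m₄ z).2 with hμ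
  have hμinj : Function.Injective μ := fun z z' h => by
    rw [← (mobiusInv_eq hm (mobius_ne_zero hm z') h).2,
      (mobiusInv_eq hm (mobius_ne_zero hm z') rfl).2]
  obtain ⟨l, rfl⟩ := Nat.exists_eq_add_of_lt hMN
  set L := l + 1 with hL
  have hMN' : M + l + 1 = M + L := by omega
  rw [hMN'] at hUN hfU
  have hiter : ∀ c, ‖c‖ < S → ∀ i j, i + j ≤ M + L →
      Set.MapsTo (ratMap (φ c))^[j] (U i) (U (i + j)) := by
    intro c hc i j
    induction j with
    | zero => exact fun _ _ hx => hx
    | succ j ih =>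
      intro hij
      rw [Function.iterate_succ']
      exact (hfU c hc (i + j) (by omega)).comp (ih (by omega))
  have hinv : ∀ w : K × K, w.1 ≠ 0 ∨ w.2 ≠ 0 → ratio w.1 w.2 ∈ U M →
      m₁ * w.2 - m₃ * w.1 ≠ 0 ∧ ‖mobiusInv m₁ m₂ m₃ m₄ w‖ < 1 ∧
        μ (mobiusInv m₁ m₂ m₃ m₄ w) = ratio w.1 w.2 := by
    intro w hw hwU
    rw [hUM] at hwU
    obtain ⟨z, hz, he⟩ := hwU
    obtain ⟨h0, h1⟩ := mobiusInv_eq hm hw he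
    rw [h1]
    exact ⟨h0, hz, he⟩
  have hμU : ∀ z, ‖z‖ < 1 → μ z ∈ U M := fun z hz => hUM ▸ ⟨z, hz, rfl⟩
  set G : K → K → K × K := fun c z => (planeLift d (A c) (B c))^[L] (mobius m₁ m₂ m₃ m₄ z) with hG
  have hGi := fun c hc z => (hφ c hc).iterate_planeLift (mobius_ne_zero hm z) L
  have hG' : ∀ c, ‖c‖ < S → ∀ z, ‖z‖ < 1 → _ := fun c hc z hz =>
    hinv (G c z) (hGi c hc z).1 ((hGi c hc z).2 ▸ hUN (hiter c hc M L le_rfl (hμU z hz)))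
  set w : K → K × K := fun c => (planeLift d (A c) (B c))^[M] (v c) with hw
  have hwi := fun c hc => (hφ c hc).iterate_planeLift (hv c hc) M
  have hw' : ∀ c, ‖c‖ < S → _ := fun c hc => hinv (w c) (hwi c hc).1 (by
    have := hiter c hc 0 M (by omega) (hvU c hc)
    rwa [(hwi c hc).2, zero_add] at this)
  set F : K → K → K := fun c z => mobiusInv m₁ m₂ m₃ m₄ (G c z) with hF
  set α : K → K := fun c => mobiusInv m₁ m₂ m₃ m₄ (w c) with hα
  have hsemi : ∀ c, ‖c‖ < S → ∀ z, ‖z‖ < 1 → μ (F c z) = (ratMap (φ c))^[L] (μ z) :=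
    fun c hc z hz => (hG' c hc z hz).2.2.trans (hGi c hc z).2.symm
  have hμα : ∀ c, ‖c‖ < S → μ (α c) = (ratMap (φ c))^[M] (ratio (v c).1 (v c).2) :=
    fun c hc => (hw' c hc).2.2.trans (hwi c hc).2.symm
  have hmob1 : ∀ S, An S fun z => (mobius m₁ m₂ m₃ m₄ z).1 := fun S =>
    ((An.const S m₁).mul (An.id S)).add (An.const S m₂)
  have hmob2 : ∀ S, An S fun z => (mobius m₁ m₂ m₃ m₄ z).2 := fun S =>
    ((An.const S m₃).mul (An.id S)).add (An.const S m₄)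
  have hGz := fun c => An.iterate_planeLift (S := 1) (d := d) (a := fun _ => A c) (b := fun _ => B c)
    (fun i => An.const 1 _) (fun i => An.const 1 _) (hmob1 1) (hmob2 1) L
  have hFz : ∀ c, ‖c‖ < S → An 1 (F c) := fun c hc =>
    An.mobiusInv one_pos (hGz c).1 (hGz c).2 fun z hz => (hG' c hc z hz).1
  have hFc : ∀ z, ‖z‖ < 1 → An S fun c => F c z := fun z hz => by
    have h := An.iterate_planeLift (d := d) hA hB (v := fun _ => mobius m₁ m₂ m₃ m₄ z)
      (An.const S _) (An.const S _) L
    exact An.mobiusInv hS h.1 h.2 fun c hc => (hG' c hc z hz).1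
  have hαAn : An S α := by
    have h := An.iterate_planeLift (d := d) hA hB hv1 hv2 M
    exact An.mobiusInv hS h.1 h.2 fun c hc => (hw' c hc).1
  -- If `F c` were constant, a fibre of an iterate of the rational map would contain the infinite
  -- set `U M`.
  have hnc : ∀ c, ‖c‖ < S → ∃ z z', ‖z‖ < 1 ∧ ‖z'‖ < 1 ∧ F c z ≠ F c z' := by
    intro c hc
    by_contra! h
    have hfin : {z : K | ‖z‖ < 1}.Finite := by
      refine Set.Finite.of_finite_image (f := μ) ?_ hμinj.injOn
      refine (finite_preimage_iterate_ratMap (hd.trans_eq (hφ c hc).degree_eq.symm) L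
        (μ (F c 0))).subset ?_
      rintro _ ⟨z, hz, rfl⟩
      exact (hsemi c hc z hz).symm.trans (congrArg μ (h z 0 hz (by simp)))
    refine infinite_of_mem_nhds (0 : K) ?_ hfin
    simpa [Metric.ball, dist_zero_right] using Metric.ball_mem_nhds (0 : K) one_pos
  obtain ⟨E, hE, m, n, hmn, h⟩ := exists_uniform_orbit_relation hp hpn hs0 hs hFz
    (fun c hc z hz => (hG' c hc z hz).2.1) hFc hnc hαAn (fun c hc => (hw' c hc).2.1)
  -- One step of `F c` is `L` steps of the rational map, and the marked point starts at time `M`.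
  refine ⟨E, hE, L * m + M, L * n + M, by gcongr, fun c hcs hcE hpre hcrit => ?_⟩
  have hc := hcs.trans_lt hs
  have hmaps : Set.MapsTo (F c) {z | ‖z‖ < 1} {z | ‖z‖ < 1} := fun z hz => (hG' c hc z hz).2.1
  have htrans : ∀ x, ‖x‖ < 1 → IsPreperiodic (ratMap (φ c)) (μ x) → IsPreperiodic (F c) x :=
    fun x hx hxp => (hxp.pow (Nat.succ_pos l)).of_semiconj hmaps hμinj.injOn
      (fun y hy => hsemi c hc y hy) hx
  have hit : ∀ k, μ ((F c)^[k] (α c)) = (ratMap (φ c))^[L * k + M] (ratio (v c).1 (v c).2) := by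
    intro k
    induction k with
    | zero => simpa using hμα c hc
    | succ k ih =>
      rw [Function.iterate_succ_apply', hsemi c hc _ (hmaps.iterate k (hw' c hc).2.1), ih,
        ← Function.iterate_add_apply, show L + (L * k + M) = L * (k + 1) + M by ring]
  rw [← hit, ← hit, h c hcs hcE (htrans _ (hw' c hc).2.1 (hμα c hc ▸ hpre.iterate M))]
  intro x hx hdx
  have hd1 : DifferentiableAt K (fun z => (mobius m₁ m₂ m₃ m₄ z).1) x := (hmob1 1).differentiableAt hx
  have hd2 : DifferentiableAt K (fun z => (mobius m₁ m₂ m₃ m₄ z).2) x := (hmob2 1).differentiableAt hx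
  have hwr : planeWronskian (mobius m₁ m₂ m₃ m₄) x = m₁ * m₄ - m₂ * m₃ := by
    have e1 : HasDerivAt (fun z => (mobius m₁ m₂ m₃ m₄ z).1) (m₁ * 1) x :=
      ((hasDerivAt_id x).const_mul m₁).add_const m₂
    have e2 : HasDerivAt (fun z => (mobius m₁ m₂ m₃ m₄ z).2) (m₃ * 1) x :=
      ((hasDerivAt_id x).const_mul m₃).add_const m₄
    rw [planeWronskian, e1.deriv, e2.deriv]
    simp only [mobius]
    ring
  have hw0 : planeWronskian (G c) x = 0 := by
    have := deriv_mobiusInv (m₂ := m₂) (m₄ := m₄) ((hGz c).1.differentiableAt hx)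
      ((hGz c).2.differentiableAt hx) (hG' c hc x hx).1
    have h0 := this.symm.trans hdx
    rw [div_eq_zero_iff, or_iff_left (pow_ne_zero _ (hG' c hc x hx).1), mul_eq_zero,
      or_iff_right hm] at h0
    exact h0
  -- The orbit of a critical point of `F c` meets a critical point of the rational map at some time
  -- `j < L`, inside `U (M + j)`. Preperiodicity of the latter passes back along the orbit.
  obtain ⟨j, hj, hjc⟩ := (hφ c hc).exists_isCriticalPoint hd1 hd2 (mobius_ne_zero hm x)
    (by rw [hwr]; exact hm) hw0
  refine htrans x hx (IsPreperiodic.of_iterate (j := j) (hcrit _ ⟨M + j, by omega, by omega, ?_⟩ hjc))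
  exact hiter c hc M j (by omega) (hμU x hx)

end Orbits

/-! ### Finiteness of a nontrivial orbit relation and the theorem. -/

section Main

variable {p : ℕ} [Fact p.Prime] {S : ℝ}

theorem norm_natCast_prime_lt_one : ‖(p : ℂ_[p])‖ < 1 := by
  have h := PadicComplex.norm_extends' p (p : ℚ_[p])
  simp only [PadicComplex.coe_natCast, map_natCast] at h
  rw [h]
  exact Padic.norm_p_lt_one

/-- If an orbit relation of a family of points fails somewhere, it holds for finitely many
parameters only in every smaller disk. -/
theorem finite_orbit_relation {Φ : RatFunc (Mero p S)} {α : OnePoint (Mero p S)}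
    {f : Metric.ball (0 : ℂ_[p]) S → RatFunc ℂ_[p]} (hf : ∀ c, IsSpecialization Φ c (f c))
    {a : Metric.ball (0 : ℂ_[p]) S → OnePoint ℂ_[p]} (ha : ∀ c, HasValue α c (a c))
    {d : ℕ} (hdeg : ∀ c, ratDegree (f c) = d) {m n : ℕ} {c₀ : Metric.ball (0 : ℂ_[p]) S}
    (hc₀ : (ratMap (f c₀))^[n] (a c₀) ≠ (ratMap (f c₀))^[m] (a c₀)) {s : ℝ} (hs0 : 0 < s)
    (hs : s < S) :
    {c : Metric.ball (0 : ℂ_[p]) S | ‖(c : ℂ_[p])‖ ≤ s ∧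
      (ratMap (f c))^[n] (a c) = (ratMap (f c))^[m] (a c)}.Finite := by
  -- The smaller disk must still contain `c₀`, which witnesses that the analytic function expressing
  -- the relation is not identically zero there.
  obtain ⟨S', hS', hS'S⟩ := exists_between (max_lt hs (mem_ball_zero_iff.1 c₀.2))
  have hsS' := (le_max_left _ _).trans_lt hS'
  have hc₀S' := (le_max_right _ _).trans_lt hS'
  obtain ⟨A, B, hA, hB, hφ⟩ := exists_isLowestTerms hf hdeg (hs0.trans hsS') hS'S
  obtain ⟨v, hv1, hv2, hv⟩ := exists_coordinates ha (hs0.trans hsS') hS'S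
  have hX := An.iterate_planeLift (d := d) hA hB hv1 hv2
  have hrel : ∀ c : Metric.ball (0 : ℂ_[p]) S, ‖(c : ℂ_[p])‖ < S' →
      ((ratMap (f c))^[n] (a c) = (ratMap (f c))^[m] (a c) ↔
        ((planeLift d (A c) (B c))^[n] (v c)).1 * ((planeLift d (A c) (B c))^[m] (v c)).2 -
        ((planeLift d (A c) (B c))^[m] (v c)).1 * ((planeLift d (A c) (B c))^[n] (v c)).2 = 0) := by
    intro c hc
    obtain ⟨hv0, hac⟩ := hv c hc
    obtain ⟨hn0, hn⟩ := (hφ c hc).iterate_planeLift hv0 n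
    obtain ⟨hm0, hm⟩ := (hφ c hc).iterate_planeLift hv0 m
    rw [hac, hn, hm, ratio_eq_ratio_iff hn0 hm0, sub_eq_zero]
  have hfin := An.finite_zeros hsS' (((hX n).1.mul (hX m).2).sub ((hX m).1.mul (hX n).2))
    ⟨c₀, hc₀S', fun h0 => hc₀ ((hrel c₀ hc₀S').2 h0)⟩
  refine (hfin.preimage (f := Subtype.val) Subtype.val_injective.injOn).subset ?_
  rintro c ⟨hc, he⟩
  exact ⟨hc, (hrel c (hc.trans_lt hsS')).1 he⟩

end Main

end PadicFamily

end

theorem theorem5p1 (p : ℕ) [Fact p.Prime] (S : ℝ) (hS : 0 < S)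
    (Φ : RatFunc (PadicFamily.Mero p S)) (α : OnePoint (PadicFamily.Mero p S))
    -- the rational functions `f_c(z) = Φ(c, z)` and the points `α(c)`, for `c ∈ D(0, S)`
    (f : Metric.ball (0 : ℂ_[p]) S → RatFunc ℂ_[p])
    (hf : ∀ c, PadicFamily.IsSpecialization Φ c (f c))
    (a : Metric.ball (0 : ℂ_[p]) S → OnePoint ℂ_[p])
    (ha : ∀ c, PadicFamily.HasValue α c (a c))
    (d : ℕ) (hd : 2 ≤ d) (hdeg : ∀ c, PadicFamily.ratDegree (f c) = d)
    (M N : ℕ) (hMN : M < N)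
    (U : ℕ → Set (OnePoint ℂ_[p]))
    (hU : ∀ j ≤ N, PadicFamily.IsRationalOpenDisk (U j))
    (haU : ∀ c, a c ∈ U 0)
    (hfU : ∀ c, ∀ j < N, PadicFamily.ratMap (f c) '' U j ⊆ U (j + 1))
    (hUN : U N ⊆ U M) :
    (∀ s : ℝ, 0 < s → s < S →
      {c : Metric.ball (0 : ℂ_[p]) S | ‖(c : ℂ_[p])‖ ≤ s ∧
        PadicFamily.IsPreperiodic (PadicFamily.ratMap (f c)) (a c) ∧
        ∀ x : OnePoint ℂ_[p], (∃ j, M ≤ j ∧ j < N ∧ x ∈ U j) →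
          PadicFamily.IsCriticalPoint (f c) x →
          PadicFamily.IsPreperiodic (PadicFamily.ratMap (f c)) x}.Finite) ∨
    (∃ m n : ℕ, m < n ∧ ∀ c,
      (PadicFamily.ratMap (f c))^[n] (a c) = (PadicFamily.ratMap (f c))^[m] (a c)) := by
  classical
  by_cases hb : ∃ m n : ℕ, m < n ∧ ∀ c,
      (PadicFamily.ratMap (f c))^[n] (a c) = (PadicFamily.ratMap (f c))^[m] (a c)
  · exact Or.inr hb
  refine Or.inl fun s hs0 hs => ?_
  push Not at hb
  obtain ⟨S', hsS', hS'S⟩ := exists_between hs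
  have hS'0 := hs0.trans hsS'
  obtain ⟨A, B, hA, hB, hφ⟩ := PadicFamily.exists_isLowestTerms hf hdeg hS'0 hS'S
  obtain ⟨v, hv1, hv2, hv⟩ := PadicFamily.exists_coordinates ha hS'0 hS'S
  obtain ⟨m₁, m₂, m₃, m₄, hm, hUM⟩ := (hU M hMN.le).exists_mobius
  -- The value 0 outside the disk is arbitrary; it only turns `f` into a function on all of `ℂ_[p]`.
  set g : ℂ_[p] → RatFunc ℂ_[p] :=
    fun c => if h : c ∈ Metric.ball (0 : ℂ_[p]) S then f ⟨c, h⟩ else 0 with hg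
  have hmem : ∀ c : ℂ_[p], ‖c‖ < S' → c ∈ Metric.ball (0 : ℂ_[p]) S := fun c hc =>
    mem_ball_zero_iff.2 (hc.trans hS'S)
  have hgf : ∀ c : Metric.ball (0 : ℂ_[p]) S, g c = f c := fun c => dif_pos c.2
  obtain ⟨E, hE, m, n, hmn, h⟩ := PadicFamily.exists_uniform_orbit_relation_ratMap
    (Fact.out : p.Prime) PadicFamily.norm_natCast_prime_lt_one hs0 hsS' (d := d) (by omega)
    hA hB (φ := g) (fun c hc => hgf ⟨c, hmem c hc⟩ ▸ hφ ⟨c, hmem c hc⟩ hc) hv1 hv2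
    (fun c hc => (hv ⟨c, hmem c hc⟩ hc).1) hMN hm hUM
    (fun c hc => (hv ⟨c, hmem c hc⟩ hc).2 ▸ haU ⟨c, hmem c hc⟩)
    (fun c hc j hj => by
      rw [hgf ⟨c, hmem c hc⟩]
      exact Set.mapsTo_iff_image_subset.2 (hfU _ j hj)) hUN
  -- As (b) fails, the uniform relation fails at some `c₀`, so only finitely many parameters satisfy
  -- it. The remaining ones belong to the exceptional set `E`.
  obtain ⟨c₀, hc₀⟩ := hb m n hmn
  refine ((PadicFamily.finite_orbit_relation hf ha hdeg hc₀ hs0 hs).union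
    (hE.preimage (f := Subtype.val) Subtype.val_injective.injOn)).subset ?_
  rintro c ⟨hcs, hpre, hcrit⟩
  by_cases hcE : (c : ℂ_[p]) ∈ E
  · exact Or.inr hcE
  · refine Or.inl ⟨hcs, ?_⟩
    have := h c hcs hcE
    rw [hgf, ← (hv c (hcs.trans_lt hsS')).2] at this
    exact this hpre hcrit
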